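/- Let $n\ge 2$, let $\Omega\subset\mathbb R^n$ be a bounded open set with $C^2$ boundary and outward unit normal $\nu$, and let $T>0$. Put $Q=(0,T)\times\Omega$, $\Sigma=(0,T)\times\partial\Omega$ and, for $\omega\in\mathbb S^{n-1}$, $$\Sigma_{\pm,\omega}=(0,T)\times\{x\in\partial\Omega:\ \pm\,\nu(x)\cdot\omega\ge 0\},\qquad \varphi(t,x)=t+x\cdot\omega .$$ Let $q=(q_{ij})_{1\le i,j\le n}$ be a matrix-valued potential with $q_{ij}\in L^\infty(Q;\mathbb C)$, and for $\vec u=(u_1,\dots,u_n)$ let $\mathcal L_q\vec u=\Box\vec u+q\vec u$, where $\Box=\partial_t^2-\Delta_x$ acts componentwise. Then there are constants $C>0$ and $h_0>0$, depending only on $T$, $\Omega$ and $q$, such that for every $\omega\in\mathbb S^{n-1}$, every $h\in(0,h_0]$ and every $\vec u\in C^2(\overline Q;\mathbb C^n)$ with $$\vec u|_{\Sigma}=0,\qquad \vec u|_{t=0}=\partial_t\vec u|_{t=0}=0,$$ one has $$\begin{aligned} &\|e^{-\varphi/h}\vec u\|_{L^2(Q)}^2+h\int_{\Sigma_{+,\omega}}\partial_\nu\varphi\,\bigl|e^{-\varphi/h}\partial_\nu\vec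 u\bigr|^2\,dS_x\,dt+h\int_\Omega\bigl|e^{-\varphi(T,x)/h}\partial_t\vec u(T,x)\bigr|^2dx\\ &\quad\le C\Bigl(\|h\,e^{-\varphi/h}\mathcal L_q\vec u\|_{L^2(Q)}^2+\frac1h\int_\Omega\bigl|e^{-\varphi(T,x)/h}\vec u(T,x)\bigr|^2dx+h\int_\Omega\bigl|e^{-\varphi(T,x)/h}\nabla_x\vec u(T,x)\bigr|^2dx\\ &\qquad\qquad+h\int_{\Sigma_{-,\omega}}(-\partial_\nu\varphi)\,\bigl|e^{-\varphi/h}\partial_\nu\vec u\bigr|^2\,dS_x\,dt\Bigr). \end{aligned}$$ Here $\partial_\nu\vec u$ is the componentwise normal derivative, $|\cdot|$ is the Euclidean (Hermitian) norm, $|\nabla_x\vec u|^2=\sum_{i,j}|\partial_{x_i}u_j|^2$, and $dS_x$ is the surface measure on $\partial\Omega$. -/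

import Mathlib

open MeasureTheory Set Filter Topology

namespace CarlemanWave

noncomputable section

/-- The Euclidean space `ℝⁿ`. -/
abbrev E (n : ℕ) : Type := EuclideanSpace ℝ (Fin n)

/-- The space `ℂⁿ` of values of the vector functions, with its Hermitian norm. -/
abbrev V (n : ℕ) : Type := EuclideanSpace ℂ (Fin n)

/-- `ρ` is a local `C²` defining function of `Ω` at the boundary point `x`:
near `x`, the set `Ω` is `{ρ < 0}`, where `ρ` is `C²` with `ρ x = 0` and `∇ρ x ≠ 0`. -/
structure IsDefiningFunctionAt {n : ℕ} (Ω : Set (E n)) (ρ : E n → ℝ) (x : E n) : Prop where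
  contDiffAt : ContDiffAt ℝ 2 ρ x
  map_eq_zero : ρ x = 0
  gradient_ne_zero : gradient ρ x ≠ 0
  eventually_mem_iff : ∀ᶠ y in 𝓝 x, (y ∈ Ω ↔ ρ y < 0)

/-- `Ω` has a `C²` boundary (and lies locally on one side of it). -/
def HasC2Boundary {n : ℕ} (Ω : Set (E n)) : Prop :=
  ∀ x ∈ frontier Ω, ∃ ρ : E n → ℝ, IsDefiningFunctionAt Ω ρ x

open Classical in
/-- The outward unit normal `ν(x) = ∇ρ(x) / |∇ρ(x)|` at a boundary point `x` of `Ω`, for any local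
defining function `ρ`; it does not depend on `ρ`, see `outwardNormal_eq`. -/
def outwardNormal {n : ℕ} (Ω : Set (E n)) (x : E n) : E n :=
  if H : ∃ ρ : E n → ℝ, IsDefiningFunctionAt Ω ρ x then
    ‖gradient H.choose x‖⁻¹ • gradient H.choose x
  else 0

/-- If the derivative of `ρ` along `v` at a zero `x` of `ρ` is negative, then `ρ < 0` at the points
`x + s v` with small `s > 0`. -/
theorem eventually_neg_of_inner_neg {n : ℕ} {ρ : E n → ℝ} {x v : E n}
    (hρ : DifferentiableAt ℝ ρ x) (hx : ρ x = 0) (hv : inner ℝ (gradient ρ x) v < 0) :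
    ∀ᶠ s in 𝓝[>] (0 : ℝ), ρ (x + s • v) < 0 := by
  have h1 : HasDerivAt (fun s : ℝ => ρ (x + s • v)) (inner ℝ (gradient ρ x) v) 0 := by
    have h2 : HasDerivAt (fun s : ℝ => x + s • v) v 0 := by
      simpa using ((hasDerivAt_id (0 : ℝ)).smul_const v).const_add x
    have h3 : HasFDerivAt ρ (fderiv ℝ ρ x) (x + (0 : ℝ) • v) := by
      simpa using hρ.hasFDerivAt
    have h4 := h3.comp_hasDerivAt (0 : ℝ) h2
    have h5 : inner ℝ (gradient ρ x) v = fderiv ℝ ρ x v := by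
      simp [gradient]
    rw [h5]
    exact h4
  have h6 := (hasDerivAt_iff_tendsto_slope.1 h1).eventually_lt_const hv
  have h7 : ∀ᶠ s in 𝓝[>] (0 : ℝ), slope (fun s : ℝ => ρ (x + s • v)) 0 s < 0 :=
    h6.filter_mono (nhdsWithin_mono _ fun s hs => ne_of_gt hs)
  filter_upwards [h7, self_mem_nhdsWithin] with s hs hs0
  have hs0' : (0 : ℝ) < s := hs0
  simp only [slope, sub_zero, zero_smul, add_zero, hx, vsub_eq_sub, smul_eq_mul] at hs
  by_contra hcon
  push Not at hcon
  exact absurd hs (not_lt.2 (mul_nonneg (inv_nonneg.2 hs0'.le) hcon))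

/-- The outward unit normal does not depend on the choice of the defining function. -/
theorem outwardNormal_eq {n : ℕ} {Ω : Set (E n)} {ρ : E n → ℝ} {x : E n}
    (hρ : IsDefiningFunctionAt Ω ρ x) :
    outwardNormal Ω x = ‖gradient ρ x‖⁻¹ • gradient ρ x := by
  have H : ∃ ρ : E n → ℝ, IsDefiningFunctionAt Ω ρ x := ⟨ρ, hρ⟩
  have hσ := H.choose_spec
  rw [outwardNormal, dif_pos H]
  generalize H.choose = σ at hσ ⊢
  have ha := hσ.gradient_ne_zero
  have hb := hρ.gradient_ne_zero
  have hda : DifferentiableAt ℝ σ x := hσ.contDiffAt.differentiableAt (by norm_num)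
  have hdb : DifferentiableAt ℝ ρ x := hρ.contDiffAt.differentiableAt (by norm_num)
  by_contra hne
  have key : ∀ a b : E n, a ≠ 0 → b ≠ 0 → ‖a‖⁻¹ • a ≠ ‖b‖⁻¹ • b →
      inner ℝ a (‖b‖⁻¹ • b - ‖a‖⁻¹ • a) < 0 := by
    intro a b ha hb hab
    have ha' := norm_pos_iff.2 ha
    have h1 : inner ℝ (‖a‖⁻¹ • a) (‖b‖⁻¹ • b) < 1 :=
      (inner_lt_one_iff_real_of_norm_eq_one (by simp [norm_smul, ha'.ne'])
        (by simp [norm_smul, (norm_pos_iff.2 hb).ne'])).2 hab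
    have h2 : inner ℝ a (‖b‖⁻¹ • b) = ‖a‖ * inner ℝ (‖a‖⁻¹ • a) (‖b‖⁻¹ • b) := by
      rw [real_inner_smul_left, ← mul_assoc, mul_inv_cancel₀ ha'.ne', one_mul]
    have h3 : inner ℝ a (‖a‖⁻¹ • a) = ‖a‖ := by
      rw [real_inner_smul_right, real_inner_self_eq_norm_sq]
      field_simp
    rw [inner_sub_right, h2, h3]
    nlinarith
  set v := ‖gradient ρ x‖⁻¹ • gradient ρ x - ‖gradient σ x‖⁻¹ • gradient σ x with hv
  have h1 := eventually_neg_of_inner_neg hda hσ.map_eq_zero (key _ _ ha hb hne)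
  have h2 : inner ℝ (gradient (fun y => -ρ y) x) v < 0 := by
    have h3 : gradient (fun y => -ρ y) x = -gradient ρ x := by
      simp [gradient, fderiv_fun_neg]
    have h4 := key _ _ hb ha (Ne.symm hne)
    rw [h3, hv, inner_neg_left, ← inner_neg_right, neg_sub]
    exact h4
  have h5 := eventually_neg_of_inner_neg hdb.neg (by simp [hρ.map_eq_zero]) h2
  have hcont : Tendsto (fun s : ℝ => x + s • v) (𝓝[>] 0) (𝓝 x) := by
    have : Tendsto (fun s : ℝ => x + s • v) (𝓝 0) (𝓝 (x + (0 : ℝ) • v)) :=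
      Continuous.tendsto (by fun_prop) 0
    rw [zero_smul, add_zero] at this
    exact this.mono_left nhdsWithin_le_nhds
  obtain ⟨s, hs1, hs2, hs3, hs4⟩ := (h1.and (h5.and
    ((hcont.eventually hσ.eventually_mem_iff).and
      (hcont.eventually hρ.eventually_mem_iff)))).exists
  have h6 := hs4.1 (hs3.2 hs1)
  have h7 : -ρ (x + s • v) < 0 := hs2
  linarith

/-- The surface measure of `∂Ω`: the `(n-1)`-dimensional Hausdorff measure, normalised as in the
Euclidean setting, restricted to the boundary. -/
def surfaceMeasure {n : ℕ} (Ω : Set (E n)) : Measure (E n) :=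
  (Measure.euclideanHausdorffMeasure (n - 1)).restrict (frontier Ω)

/-- The space-time cylinder `Q = (0,T) × Ω`. -/
def cyl {n : ℕ} (T : ℝ) (Ω : Set (E n)) : Set (ℝ × E n) := Ioo 0 T ×ˢ Ω

/-- The closed cylinder `[0,T] × closure Ω`. -/
def closedCyl {n : ℕ} (T : ℝ) (Ω : Set (E n)) : Set (ℝ × E n) := Icc 0 T ×ˢ closure Ω

/-- The lateral boundary `Σ = (0,T) × ∂Ω`. -/
def lateral {n : ℕ} (T : ℝ) (Ω : Set (E n)) : Set (ℝ × E n) := Ioo 0 T ×ˢ frontier Ω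

/-- `Σ_{+,ω} = (0,T) × {x ∈ ∂Ω : ν(x)·ω ≥ 0}`. -/
def lateralPos {n : ℕ} (T : ℝ) (Ω : Set (E n)) (ω : E n) : Set (ℝ × E n) :=
  Ioo 0 T ×ˢ {x | x ∈ frontier Ω ∧ 0 ≤ inner ℝ (outwardNormal Ω x) ω}

/-- `Σ_{-,ω} = (0,T) × {x ∈ ∂Ω : ν(x)·ω ≤ 0}`. -/
def lateralNeg {n : ℕ} (T : ℝ) (Ω : Set (E n)) (ω : E n) : Set (ℝ × E n) :=
  Ioo 0 T ×ˢ {x | x ∈ frontier Ω ∧ inner ℝ (outwardNormal Ω x) ω ≤ 0}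

/-- The measure `dS_x dt` on the lateral boundary. -/
def lateralMeasure {n : ℕ} (T : ℝ) (Ω : Set (E n)) : Measure (ℝ × E n) :=
  (volume.restrict (Ioo 0 T)).prod (surfaceMeasure Ω)

section Derivatives

variable {n : ℕ} {F : Type*} [NormedAddCommGroup F] [NormedSpace ℝ F]

/-- The derivative of `f` in the space-time direction `w`, on the closed cylinder (one-sided at the
boundary of the cylinder). -/
def dirDeriv (T : ℝ) (Ω : Set (E n)) (w : ℝ × E n) (f : ℝ × E n → F) (p : ℝ × E n) : F :=
  fderivWithin ℝ f (closedCyl T Ω) p w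

/-- The time derivative `∂_t f`. -/
def timeDeriv (T : ℝ) (Ω : Set (E n)) (f : ℝ × E n → F) : ℝ × E n → F :=
  dirDeriv T Ω (1, 0) f

/-- The spatial partial derivative `∂_{x_i} f`. -/
def spaceDeriv (T : ℝ) (Ω : Set (E n)) (i : Fin n) (f : ℝ × E n → F) : ℝ × E n → F :=
  dirDeriv T Ω (0, EuclideanSpace.single i 1) f

/-- The normal derivative `∂_ν f = ν · ∇_x f` on the lateral boundary. -/
def normalDeriv (T : ℝ) (Ω : Set (E n)) (f : ℝ × E n → F) (p : ℝ × E n) : F :=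
  dirDeriv T Ω (0, outwardNormal Ω p.2) f p

/-- The wave operator `□ f = ∂_t² f - Δ_x f`. -/
def box (T : ℝ) (Ω : Set (E n)) (f : ℝ × E n → F) (p : ℝ × E n) : F :=
  timeDeriv T Ω (timeDeriv T Ω f) p - ∑ i : Fin n, spaceDeriv T Ω i (spaceDeriv T Ω i f) p

end Derivatives

/-- The operator `L_q u = □ u + q u`, componentwise `□ u_i + ∑_j q_{ij} u_j`. -/
def waveOp {n : ℕ} (T : ℝ) (Ω : Set (E n)) (q : ℝ × E n → Matrix (Fin n) (Fin n) ℂ)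
    (u : ℝ × E n → V n) (p : ℝ × E n) : V n :=
  box T Ω u p + WithLp.toLp 2 (fun i => ∑ j : Fin n, q p i j * u p j)

/-- The phase `φ(t,x) = t + x·ω`. -/
def phase {n : ℕ} (ω : E n) (p : ℝ × E n) : ℝ := p.1 + inner ℝ p.2 ω

/-- The weighted function `e^{-φ/h} f`. -/
def weighted {n : ℕ} (ω : E n) (h : ℝ) (f : ℝ × E n → V n) (p : ℝ × E n) : V n :=
  Real.exp (-phase ω p / h) • f p

/-- Vector functions `u ∈ C²([0,T] × closure Ω)` with `u = 0` on `Σ` and `u = ∂_t u = 0` at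
`t = 0`. -/
structure IsAdmissible {n : ℕ} (T : ℝ) (Ω : Set (E n)) (u : ℝ × E n → V n) : Prop where
  contDiffOn : ContDiffOn ℝ 2 u (closedCyl T Ω)
  eq_zero_lateral : ∀ p ∈ lateral T Ω, u p = 0
  eq_zero_initial : ∀ x ∈ Ω, u (0, x) = 0
  timeDeriv_eq_zero_initial : ∀ x ∈ Ω, timeDeriv T Ω u (0, x) = 0

end

end CarlemanWave

namespace CarlemanWave

/-! ### Local geometry of a `C²` boundary: normal, tangent cone, curves in the boundary. -/

section Geometry

variable {n : ℕ} {Ω : Set (E n)} {ρ : E n → ℝ} {x : E n}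

/-! Put `v = e^{-φ/h} u` and `X = ∂_t - ω·∇`. Since `|∂_t φ| = |∇φ| = 1`, the phase is
characteristic for `□`: the terms of order `h⁻²` cancel and `h e^{-φ/h} □ u = h □ v + 2 X v`
(`conjugated_box`). Expanding the square and dropping `‖h □ v‖²` leaves `4 ‖X v‖² + 4 h ⟨□ v, X v⟩`.

Both remaining terms are useful. The field `X` has constant coefficients, so `⟨□ v, X v⟩` is an
exact space-time divergence (`inner_box_eq_divergence`). Its integral consists of an energy at time
`T` and, because `∇v` is normal on `Σ`, half the integral of `(ν·ω) |∂_ν v|²` over `Σ`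
(`integral_inner_box`). The energy at `T` controls `|∂_t v|²` up to `|∇v|²` (`le_energyDensity`).
The term `‖X v‖²` controls `‖v‖²` by a Poincaré inequality along `X` (`integral_norm_sq_le`).
Together these give `carleman_conjugated`. Returning from `v` to `u` at time `T` costs the term `h⁻¹
|v(T)|²`, and the potential contributes `O(h²) ‖v‖²`, absorbed for small `h`
(`absorb_carleman_terms`).

The integrations by parts need Gauss-Green on `Ω`. It is proved not for the surface measure itself
but for some measure `μ` comparable to it from both sides (`exists_divergence_measure`). This
suffices: the flux identity is exact for `μ`, and its positive and negative parts are then compared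
separately with those for the surface measure (`flux_comparison`), which only changes the constant.
Locally, a field splits into a part tangent to the level sets of a defining function, which has no
flux, and a multiple of a fixed direction, which is integrated along lines up to a Lipschitz graph.
A partition of unity makes this global. -/

theorem inner_gradient_eq_fderiv (ρ : E n → ℝ) (x v : E n) :
    inner ℝ (gradient ρ x) v = fderiv ℝ ρ x v := by
  simp [gradient]

theorem contDiffAt_gradient (hρ : ContDiffAt ℝ 2 ρ x) : ContDiffAt ℝ 1 (gradient ρ) x := by
  have h : ContDiffAt ℝ 1 (fderiv ℝ ρ) x := hρ.fderiv_right (by norm_num)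
  exact ((InnerProductSpace.toDual ℝ (E n)).symm.contDiff.contDiffAt).comp x h

/-- Regularity, nonzero gradient and the local description of `Ω` are open conditions. For `ρ y =
0`: a frontier point is a limit of points where `ρ < 0`, and it is not in the open set `Ω`. One `ρ`
therefore serves all nearby boundary points. -/
theorem IsDefiningFunctionAt.eventually (hΩ : IsOpen Ω) (hρ : IsDefiningFunctionAt Ω ρ x) :
    ∀ᶠ y in 𝓝 x, y ∈ frontier Ω → IsDefiningFunctionAt Ω ρ y := by
  have h1 : ∀ᶠ y in 𝓝 x, ContDiffAt ℝ 2 ρ y := hρ.contDiffAt.eventually (by simp)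
  have h2 : ∀ᶠ y in 𝓝 x, gradient ρ y ≠ 0 :=
    (contDiffAt_gradient hρ.contDiffAt).continuousAt.eventually_ne hρ.gradient_ne_zero
  filter_upwards [h1, h2, hρ.eventually_mem_iff.eventually_nhds] with y hy1 hy2 hy3 hy
  refine ⟨hy1, le_antisymm ?_ ?_, hy2, hy3⟩
  · have hcl : y ∈ closure Ω := hy.1
    have hf : ∃ᶠ z in 𝓝 y, z ∈ Ω := mem_closure_iff_frequently.1 hcl
    have hf2 : ∃ᶠ z in 𝓝 y, ρ z < 0 := (hf.and_eventually hy3).mono fun z hz => hz.2.1 hz.1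
    by_contra hcon
    push Not at hcon
    have := hy1.continuousAt.eventually_const_lt hcon
    obtain ⟨z, hz⟩ := (hf2.and_eventually this).exists
    exact lt_asymm hz.1 hz.2
  · have hy4 : y ∉ Ω := by
      rw [hΩ.frontier_eq] at hy
      exact hy.2
    have := hy3.self_of_nhds
    rw [this] at hy4
    exact not_lt.1 hy4

theorem norm_outwardNormal (hΩ2 : HasC2Boundary Ω) (hx : x ∈ frontier Ω) :
    ‖outwardNormal Ω x‖ = 1 := by
  obtain ⟨ρ, hρ⟩ := hΩ2 x hx
  rw [outwardNormal_eq hρ, norm_smul, norm_inv, norm_norm,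
    inv_mul_cancel₀ (norm_ne_zero_iff.2 hρ.gradient_ne_zero)]

/-- `outwardNormal` chooses a defining function at each point separately; by `outwardNormal_eq` a
single `ρ` computes it near `x`, and `∇ρ` is continuous. -/
theorem continuousOn_outwardNormal (hΩ : IsOpen Ω) (hΩ2 : HasC2Boundary Ω) :
    ContinuousOn (outwardNormal Ω) (frontier Ω) := by
  intro x hx
  obtain ⟨ρ, hρ⟩ := hΩ2 x hx
  have h1 : ContinuousAt (gradient ρ) x := (contDiffAt_gradient hρ.contDiffAt).continuousAt
  have h2 : ContinuousAt (fun y => ‖gradient ρ y‖⁻¹ • gradient ρ y) x :=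
    (h1.norm.inv₀ (norm_ne_zero_iff.2 hρ.gradient_ne_zero)).smul h1
  refine h2.continuousWithinAt.congr_of_eventuallyEq ?_ (outwardNormal_eq hρ)
  have h3 := hρ.eventually hΩ
  filter_upwards [nhdsWithin_le_nhds h3, self_mem_nhdsWithin] with y hy hy2
  exact outwardNormal_eq (hy hy2)

/-- Rays leaving `x` in a direction of the open half-space `⟨∇ρ, v⟩ < 0` enter `Ω`, so the tangent
cone contains a nonempty open set and spans. This makes the one-sided derivatives on the closed
cylinder well defined. -/
theorem uniqueDiffWithinAt_of_isDefiningFunctionAt (hρ : IsDefiningFunctionAt Ω ρ x) :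
    UniqueDiffWithinAt ℝ Ω x := by
  have hd : DifferentiableAt ℝ ρ x := hρ.contDiffAt.differentiableAt (by norm_num)
  have hsub : {v : E n | inner ℝ (gradient ρ x) v < 0} ⊆ tangentConeAt ℝ Ω x := by
    intro v hv
    have h1 := eventually_neg_of_inner_neg hd hρ.map_eq_zero hv
    have hcont : Tendsto (fun s : ℝ => x + s • v) (𝓝[>] 0) (𝓝 x) := by
      have : Tendsto (fun s : ℝ => x + s • v) (𝓝 0) (𝓝 (x + (0 : ℝ) • v)) :=
        Continuous.tendsto (by fun_prop) 0
      rw [zero_smul, add_zero] at this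
      exact this.mono_left nhdsWithin_le_nhds
    have h2 := hcont.eventually hρ.eventually_mem_iff
    have hs : Tendsto (fun s : ℝ => s • v) (𝓝[>] 0) (𝓝 0) := by
      have : Tendsto (fun s : ℝ => s • v) (𝓝 0) (𝓝 ((0 : ℝ) • v)) :=
        Continuous.tendsto (by fun_prop) 0
      rw [zero_smul] at this
      exact this.mono_left nhdsWithin_le_nhds
    refine mem_tangentConeAt_of_frequently (𝓝[>] (0 : ℝ)) (fun s => s⁻¹) (fun s => s • v)
      hs ?_ ?_
    · refine Eventually.frequently ?_
      filter_upwards [h1, h2] with s hs1 hs2 using hs2.2 hs1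
    · refine tendsto_const_nhds.congr' ?_
      filter_upwards [self_mem_nhdsWithin] with s hs
      rw [smul_smul, inv_mul_cancel₀ (ne_of_gt hs), one_smul]
  have hopen : IsOpen {v : E n | inner ℝ (gradient ρ x) v < 0} :=
    isOpen_lt (by fun_prop) continuous_const
  have hne : ({v : E n | inner ℝ (gradient ρ x) v < 0}).Nonempty := by
    refine ⟨-gradient ρ x, ?_⟩
    have := norm_pos_iff.2 hρ.gradient_ne_zero
    simp only [mem_ofPred_eq, inner_neg_right, real_inner_self_eq_norm_sq]
    nlinarith
  refine ⟨?_, ?_⟩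
  · have : Submodule.span ℝ (tangentConeAt ℝ Ω x) = ⊤ := by
      refine Submodule.eq_top_of_nonempty_interior' _ ?_
      obtain ⟨v, hv⟩ := hne
      refine ⟨v, mem_interior.2 ⟨_, hsub.trans Submodule.subset_span, hopen, hv⟩⟩
    rw [this]
    exact dense_univ
  · obtain ⟨v, hv⟩ := hne
    exact mem_closure_of_nonempty_tangentConeAt ⟨v, hsub hv⟩

theorem IsDefiningFunctionAt.mem_frontier (hΩ : IsOpen Ω) (hρ : IsDefiningFunctionAt Ω ρ x) :
    x ∈ frontier Ω := by
  rw [hΩ.frontier_eq]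
  refine ⟨(uniqueDiffWithinAt_of_isDefiningFunctionAt hρ).mem_closure, fun h => ?_⟩
  have := hρ.eventually_mem_iff.self_of_nhds.1 h
  exact this.ne hρ.map_eq_zero

theorem IsDefiningFunctionAt.eventually_mem_frontier (hΩ : IsOpen Ω)
    (hρ : IsDefiningFunctionAt Ω ρ x) : ∀ᶠ y in 𝓝 x, ρ y = 0 → y ∈ frontier Ω := by
  have h1 : ∀ᶠ y in 𝓝 x, ContDiffAt ℝ 2 ρ y := hρ.contDiffAt.eventually (by simp)
  have h2 : ∀ᶠ y in 𝓝 x, gradient ρ y ≠ 0 :=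
    (contDiffAt_gradient hρ.contDiffAt).continuousAt.eventually_ne hρ.gradient_ne_zero
  filter_upwards [h1, h2, hρ.eventually_mem_iff.eventually_nhds] with y hy1 hy2 hy3 hy
  exact IsDefiningFunctionAt.mem_frontier hΩ ⟨hy1, hy, hy2, hy3⟩

theorem uniqueDiffOn_closure (hΩ : IsOpen Ω) (hΩ2 : HasC2Boundary Ω) :
    UniqueDiffOn ℝ (closure Ω) := by
  intro x hx
  by_cases h : x ∈ Ω
  · exact (hΩ.uniqueDiffWithinAt h).mono subset_closure
  · obtain ⟨ρ, hρ⟩ := hΩ2 x (by rw [hΩ.frontier_eq]; exact ⟨hx, h⟩)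
    exact (uniqueDiffWithinAt_of_isDefiningFunctionAt hρ).mono subset_closure

theorem uniqueDiffOn_closedCyl (hΩ : IsOpen Ω) (hΩ2 : HasC2Boundary Ω) {T : ℝ} (hT : 0 < T) :
    UniqueDiffOn ℝ (closedCyl T Ω) :=
  (uniqueDiffOn_Icc hT).prod (uniqueDiffOn_closure hΩ hΩ2)

/-- Every vector orthogonal to the normal is the velocity of a curve in the boundary. -/
theorem exists_curve_frontier (hΩ : IsOpen Ω) (hΩ2 : HasC2Boundary Ω) (hx : x ∈ frontier Ω)
    {w : E n} (hw : inner ℝ (outwardNormal Ω x) w = 0) :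
    ∃ c : ℝ → E n, c 0 = x ∧ HasDerivAt c w 0 ∧ ∀ᶠ s in 𝓝 (0 : ℝ), c s ∈ frontier Ω := by
  obtain ⟨ρ, hρ⟩ := hΩ2 x hx
  have hst : HasStrictFDerivAt ρ (fderiv ℝ ρ x) x :=
    hρ.contDiffAt.hasStrictFDerivAt (by norm_num)
  have hpos := norm_pos_iff.2 hρ.gradient_ne_zero
  have hsurj : (fderiv ℝ ρ x).range = ⊤ := by
    refine LinearMap.range_eq_top.2 (LinearMap.surjective ?_)
    intro h0
    have h1 : fderiv ℝ ρ x (gradient ρ x) = 0 := by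
      have := congrArg (fun L => L (gradient ρ x)) h0
      simpa using this
    rw [← inner_gradient_eq_fderiv, real_inner_self_eq_norm_sq] at h1
    exact absurd h1 (by positivity)
  have hwk : w ∈ (fderiv ℝ ρ x).ker := by
    have : fderiv ℝ ρ x w = 0 := by
      rw [outwardNormal_eq hρ, real_inner_smul_left, inner_gradient_eq_fderiv] at hw
      exact (mul_eq_zero.1 hw).resolve_left (inv_ne_zero hpos.ne')
    simpa using this
  -- The implicit function `g` parametrises `{ρ = 0}` by `ker dρ`, with derivative at `0` the
  -- inclusion of the kernel; the image of the line `s ↦ s • w` is then a curve with velocity `w`.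
  have hg := hst.to_implicitFunction hsurj
  set g := hst.implicitFunction (f := ρ) (f' := fderiv ℝ ρ x) hsurj (ρ x) with hgdef
  set k : (fderiv ℝ ρ x).ker := ⟨w, hwk⟩
  have hg0 : g 0 = x :=
    hst.implicitFunction_apply_image hsurj
  have hder : HasDerivAt (fun s : ℝ => g (s • k)) w 0 := by
    have h2 : HasDerivAt (fun s : ℝ => s • k) k 0 := by
      simpa using (hasDerivAt_id (0 : ℝ)).smul_const k
    have h3 : HasFDerivAt g (fderiv ℝ ρ x).ker.subtypeL ((0 : ℝ) • k) := by
      rw [zero_smul]; exact hg.hasFDerivAt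
    exact h3.comp_hasDerivAt (0 : ℝ) h2
  refine ⟨fun s => g (s • k), by simp [hg0], hder, ?_⟩
  have hcont : Tendsto (fun s : ℝ => g (s • k)) (𝓝 0) (𝓝 x) := by
    have := hder.continuousAt.tendsto
    simpa [hg0] using this
  have hpair : Tendsto (fun s : ℝ => (ρ x, s • k)) (𝓝 0) (𝓝 (ρ x, 0)) := by
    have : Tendsto (fun s : ℝ => (ρ x, s • k)) (𝓝 0) (𝓝 (ρ x, (0 : ℝ) • k)) :=
      Continuous.tendsto (by fun_prop) 0
    rwa [zero_smul] at this
  filter_upwards [hpair.eventually (hst.map_implicitFunction_eq hsurj),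
    hcont.eventually (hρ.eventually_mem_frontier hΩ)] with s hs1 hs2
  exact hs2 (hs1.trans hρ.map_eq_zero)

end Geometry

/-! ### Lipschitz images and the normalised Hausdorff measure. -/

section Hausdorff

variable {X Y : Type*} [EMetricSpace X] [MeasurableSpace X] [BorelSpace X]
  [EMetricSpace Y] [MeasurableSpace Y] [BorelSpace Y]

/-- The normalising factor depends only on `d`, so it is the same on both sides of the usual bound
for `μH[d]`. -/
theorem euclideanHausdorffMeasure_image_le {f : X → Y} {s : Set X} {K : NNReal}
    (hf : LipschitzOnWith K f s) (d : ℕ) :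
    (Measure.euclideanHausdorffMeasure d : Measure Y) (f '' s) ≤
      (K : ENNReal) ^ d * (Measure.euclideanHausdorffMeasure d : Measure X) s := by
  have h := hf.hausdorffMeasure_image_le (d := (d : ℝ)) (by positivity)
  simp only [Measure.euclideanHausdorffMeasure_def, Measure.smul_apply, ENNReal.smul_def,
    smul_eq_mul]
  calc _ ≤ _ * ((K : ENNReal) ^ (d : ℝ) * (μH[(d : ℝ)] : Measure X) s) := by gcongr
    _ = _ := by rw [ENNReal.rpow_natCast]; ring

end Hausdorff

/-! ### Divergence, and the vanishing flux of tangential fields. -/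

section Divergence

variable {n : ℕ} {Ω : Set (E n)} {ρ : E n → ℝ} {x : E n}

/-- The divergence of a vector field on `ℝⁿ`. -/
noncomputable def divergence (F : E n → E n) (x : E n) : ℝ :=
  ∑ i : Fin n, fderiv ℝ F x (EuclideanSpace.single i 1) i

theorem sum_smul_single (v : E n) :
    ∑ i : Fin n, v i • (EuclideanSpace.single i (1 : ℝ) : E n) = v := by
  have := (EuclideanSpace.basisFun (Fin n) ℝ).sum_repr v
  simpa using this

theorem sum_apply_single_mul (L : E n →L[ℝ] ℝ) (v : E n) :
    ∑ i : Fin n, L (EuclideanSpace.single i 1) * v i = L v := by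
  conv_rhs => rw [← sum_smul_single v]
  simp [map_sum, mul_comm]

theorem divergence_smul {f : E n → ℝ} {G : E n → E n} (hf : DifferentiableAt ℝ f x)
    (hG : DifferentiableAt ℝ G x) :
    divergence (fun y => f y • G y) x = f x * divergence G x + fderiv ℝ f x (G x) := by
  simp only [divergence]
  rw [fderiv_fun_smul hf hG, ← sum_apply_single_mul (fderiv ℝ f x) (G x), Finset.mul_sum,
    ← Finset.sum_add_distrib]
  simp

theorem divergence_add {F G : E n → E n} (hF : DifferentiableAt ℝ F x)
    (hG : DifferentiableAt ℝ G x) :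
    divergence (fun y => F y + G y) x = divergence F x + divergence G x := by
  simp only [divergence]
  rw [fderiv_fun_add hF hG, ← Finset.sum_add_distrib]
  simp

theorem divergence_congr {F G : E n → E n} (h : F =ᶠ[𝓝 x] G) :
    divergence F x = divergence G x := by
  simp only [divergence, h.fderiv_eq]

theorem fderiv_eq_zero_of_notMem_tsupport {F' : Type*} [NormedAddCommGroup F'] [NormedSpace ℝ F']
    {F : E n → F'} (h : x ∉ tsupport F) : fderiv ℝ F x = 0 := by
  by_contra hcon
  exact h (support_fderiv_subset ℝ hcon)

theorem divergence_eq_zero_of_notMem_tsupport {F : E n → E n} (h : x ∉ tsupport F) :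
    divergence F x = 0 := by
  simp [divergence, fderiv_eq_zero_of_notMem_tsupport h]

theorem abs_divergence_le (F : E n → E n) (x : E n) :
    |divergence F x| ≤ n * ‖fderiv ℝ F x‖ := by
  refine (Finset.abs_sum_le_sum_abs _ _).trans ?_
  calc ∑ i : Fin n, |fderiv ℝ F x (EuclideanSpace.single i 1) i|
      ≤ ∑ _i : Fin n, ‖fderiv ℝ F x‖ := by
        refine Finset.sum_le_sum fun i _ => ?_
        refine (PiLp.norm_apply_le (fderiv ℝ F x (EuclideanSpace.single i 1)) i).trans ?_
        refine ((fderiv ℝ F x).le_opNorm _).trans ?_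
        simp
    _ = _ := by simp

theorem integral_fderiv_eq_zero {f : E n → ℝ} (hf : ContDiff ℝ 1 f) (hs : HasCompactSupport f)
    (v : E n) : ∫ x, fderiv ℝ f x v = 0 := by
  have hc : Continuous fun x => fderiv ℝ f x v := (hf.continuous_fderiv one_ne_zero).clm_apply
    continuous_const
  have hcs : HasCompactSupport fun x => fderiv ℝ f x v := hs.fderiv_apply (𝕜 := ℝ) v
  have := integral_mul_fderiv_eq_neg_fderiv_mul_of_integrable (μ := (volume : Measure (E n)))
    (f := fun _ : E n => (1 : ℝ)) (g := f) (v := v) (by simp)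
    (by simpa using hc.integrable_of_hasCompactSupport hcs)
    (by simpa using hf.continuous.integrable_of_hasCompactSupport hs)
    (fun _ _ => differentiableAt_const _) (fun x _ => hf.differentiable one_ne_zero x)
  simpa using this

theorem integral_divergence_eq_zero {F : E n → E n} (hF : ContDiff ℝ 1 F)
    (hs : HasCompactSupport F) : ∫ x, divergence F x = 0 := by
  have hcs : ∀ v : E n, HasCompactSupport fun x => fderiv ℝ F x v := fun v => hs.fderiv_apply ℝ v
  have hc : ∀ v : E n, Continuous fun x => fderiv ℝ F x v := fun v =>
    (hF.continuous_fderiv one_ne_zero).clm_apply continuous_const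
  have h1 : ∀ i : Fin n, ∀ x, fderiv ℝ (fun y => F y i) x (EuclideanSpace.single i 1) =
      fderiv ℝ F x (EuclideanSpace.single i 1) i := by
    intro i x
    have h := ((EuclideanSpace.proj i : E n →L[ℝ] ℝ).hasFDerivAt.comp x
      (hF.differentiable one_ne_zero x).hasFDerivAt).fderiv
    have h' : fderiv ℝ (fun y => F y i) x = (EuclideanSpace.proj i : E n →L[ℝ] ℝ).comp
        (fderiv ℝ F x) := h
    rw [h']
    rfl
  have h2 : ∀ i : Fin n, ContDiff ℝ 1 fun y => F y i := fun i =>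
    (EuclideanSpace.proj i : E n →L[ℝ] ℝ).contDiff.comp hF
  have h3 : ∀ i : Fin n, HasCompactSupport fun y => F y i := fun i =>
    hs.comp_left (g := fun v : E n => v i) rfl
  unfold divergence
  rw [integral_finsetSum]
  · refine Finset.sum_eq_zero fun i _ => ?_
    rw [← integral_fderiv_eq_zero (h2 i) (h3 i) (EuclideanSpace.single i 1)]
    simp only [h1]
  · intro i _
    simp only [← h1]
    exact (((h2 i).continuous_fderiv one_ne_zero).clm_apply
      continuous_const).integrable_of_hasCompactSupport ((h3 i).fderiv_apply ℝ _)

theorem contDiffAt_of_contDiffOn_closure {F' : Type*} [NormedAddCommGroup F'] [NormedSpace ℝ F']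
    (hΩ : IsOpen Ω) {G : E n → F'} (hG : ContDiffOn ℝ 1 G (closure Ω)) (hx : x ∈ Ω) :
    ContDiffAt ℝ 1 G x :=
  hG.contDiffAt (mem_of_superset (hΩ.mem_nhds hx) subset_closure)

theorem integrableOn_of_continuousOn_of_bound {α G : Type*} [TopologicalSpace α] [MeasurableSpace α]
    [OpensMeasurableSpace α] [SecondCountableTopology α]
    [NormedAddCommGroup G] {μ : Measure α}
    {S : Set α} (hS : MeasurableSet S) (hfin : μ S < ⊤) {f : α → G}
    (hf : ContinuousOn f S) [TopologicalSpace.PseudoMetrizableSpace α]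
    {M : ℝ} (hM : ∀ x ∈ S, ‖f x‖ ≤ M) : IntegrableOn f S μ := by
  have : IsFiniteMeasure (μ.restrict S) := ⟨by simpa using hfin⟩
  exact Integrable.of_bound (hf.aestronglyMeasurable hS) M
    ((ae_restrict_iff' hS).2 (Eventually.of_forall hM))

section Bounds

variable {F' : Type*} [NormedAddCommGroup F'] [NormedSpace ℝ F']

theorem exists_norm_fderiv_le (hΩ : IsOpen Ω) (hΩb : Bornology.IsBounded Ω)
    (hΩ2 : HasC2Boundary Ω) {G : E n → F'} (hG : ContDiffOn ℝ 1 G (closure Ω)) :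
    ∃ M : ℝ, ∀ x ∈ Ω, ‖fderiv ℝ G x‖ ≤ M := by
  have hK : IsCompact (closure Ω) := hΩb.isCompact_closure
  have hc := hG.continuousOn_fderivWithin (uniqueDiffOn_closure hΩ hΩ2) le_rfl
  obtain ⟨M, hM⟩ := hK.exists_bound_of_continuousOn hc
  refine ⟨M, fun x hx => ?_⟩
  have := hM x (subset_closure hx)
  rwa [fderivWithin_of_mem_nhds (mem_of_superset (hΩ.mem_nhds hx) subset_closure)] at this

theorem continuousOn_fderiv (hΩ : IsOpen Ω) {G : E n → F'}
    (hG : ContDiffOn ℝ 1 G (closure Ω)) : ContinuousOn (fderiv ℝ G) Ω :=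
  (hG.mono subset_closure).continuousOn_fderiv_of_isOpen hΩ le_rfl

theorem integrableOn_fderiv_apply (hΩ : IsOpen Ω) (hΩb : Bornology.IsBounded Ω)
    (hΩ2 : HasC2Boundary Ω) {G : E n → F'} (hG : ContDiffOn ℝ 1 G (closure Ω)) (v : E n) :
    IntegrableOn (fun x => fderiv ℝ G x v) Ω := by
  obtain ⟨M, hM⟩ := exists_norm_fderiv_le hΩ hΩb hΩ2 hG
  refine integrableOn_of_continuousOn_of_bound hΩ.measurableSet hΩb.measure_lt_top
    ((continuousOn_fderiv hΩ hG).clm_apply continuousOn_const) (M := M * ‖v‖) fun x hx => ?_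
  exact ((fderiv ℝ G x).le_opNorm v).trans (by gcongr; exact hM x hx)

theorem continuousOn_divergence (hΩ : IsOpen Ω) {G : E n → E n}
    (hG : ContDiffOn ℝ 1 G (closure Ω)) : ContinuousOn (divergence G) Ω := by
  unfold divergence
  refine continuousOn_finsetSum _ fun i _ => ?_
  exact (EuclideanSpace.proj i : E n →L[ℝ] ℝ).continuous.comp_continuousOn
    ((continuousOn_fderiv hΩ hG).clm_apply continuousOn_const)

theorem integrableOn_divergence (hΩ : IsOpen Ω) (hΩb : Bornology.IsBounded Ω)
    (hΩ2 : HasC2Boundary Ω) {G : E n → E n} (hG : ContDiffOn ℝ 1 G (closure Ω)) :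
    IntegrableOn (divergence G) Ω := by
  obtain ⟨M, hM⟩ := exists_norm_fderiv_le hΩ hΩb hΩ2 hG
  refine integrableOn_of_continuousOn_of_bound hΩ.measurableSet hΩb.measure_lt_top
    (continuousOn_divergence hΩ hG) (M := n * M) fun x hx => ?_
  exact (abs_divergence_le G x).trans (by gcongr; exact hM x hx)

end Bounds

/-- A vector field tangent to the level sets of a local defining function has no flux. -/
theorem setIntegral_divergence_eq_zero_of_tangential (hΩ : IsOpen Ω)
    (hΩb : Bornology.IsBounded Ω) (hΩ2 : HasC2Boundary Ω) {U : Set (E n)}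
    (hρ : ∀ x ∈ U, ContDiffAt ℝ 2 ρ x) (hmem : ∀ x ∈ U, (x ∈ Ω ↔ ρ x < 0))
    {G : E n → E n} (hG : ContDiffOn ℝ 1 G (closure Ω)) (hsupp : tsupport G ⊆ U)
    (htan : ∀ x ∈ U, x ∈ Ω → inner ℝ (gradient ρ x) (G x) = 0) :
    ∫ x in Ω, divergence G x = 0 := by
  -- The cutoff is `0` where `-ρ ≤ 1/(k+1)` and `1` where `-ρ ≥ 2/(k+1)`. As a function of `ρ`
  -- alone, its gradient is parallel to `∇ρ`, hence orthogonal to `G`: cutting off creates no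
  -- boundary layer term, however steep `χ k` becomes.
  set χ : ℕ → E n → ℝ := fun k x => Real.smoothTransition (-ρ x * (k + 1) - 1) with hχ
  have hχd : ∀ k, ∀ x ∈ U, ContDiffAt ℝ 1 (χ k) x := fun k x hx =>
    Real.smoothTransition.contDiff.contDiffAt.comp x
      ((((hρ x hx).of_le (by norm_num)).neg.mul contDiffAt_const).sub contDiffAt_const)
  -- Extension by zero stays `C¹`: near a point outside `Ω` either `χ k` or `G` vanishes
  -- identically.
  set H : ℕ → E n → E n := fun k => Ω.indicator fun x => χ k x • G x with hH
  have hHΩ : ∀ k, ∀ x ∈ Ω, H k =ᶠ[𝓝 x] fun x => χ k x • G x := by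
    intro k x hx
    filter_upwards [hΩ.mem_nhds hx] with y hy
    simp [hH, hy]
  have hH0 : ∀ k x, x ∉ Ω → H k =ᶠ[𝓝 x] 0 := by
    intro k x hx
    by_cases hxs : x ∈ tsupport G
    · have hxU := hsupp hxs
      have hx0 : -ρ x * (k + 1) - 1 < 0 := by
        have : 0 ≤ ρ x := not_lt.1 fun h => hx ((hmem x hxU).2 h)
        nlinarith [mul_nonneg this (by positivity : (0 : ℝ) ≤ k + 1)]
      have hcont : ContinuousAt (fun y => -ρ y * (k + 1) - 1) x :=
        ((hρ x hxU).continuousAt.neg.mul continuousAt_const).sub continuousAt_const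
      filter_upwards [hcont.eventually_lt_const hx0] with y hy
      have h0 : χ k y = 0 := Real.smoothTransition.zero_of_nonpos hy.le
      by_cases hyΩ : y ∈ Ω <;> simp [hH, hyΩ, h0]
    · have := notMem_tsupport_iff_eventuallyEq.1 hxs
      filter_upwards [this] with y hy
      by_cases hyΩ : y ∈ Ω <;> simp [hH, hyΩ, hy]
  have hHd : ∀ k, ContDiff ℝ 1 (H k) := by
    intro k
    refine contDiff_iff_contDiffAt.2 fun x => ?_
    by_cases hx : x ∈ Ω
    · by_cases hxs : x ∈ tsupport G
      · exact ((hχd k x (hsupp hxs)).smul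
          (contDiffAt_of_contDiffOn_closure hΩ hG hx)).congr_of_eventuallyEq (hHΩ k x hx)
      · have h1 := notMem_tsupport_iff_eventuallyEq.1 hxs
        have h2 : H k =ᶠ[𝓝 x] fun _ => 0 := by
          filter_upwards [h1] with y hy
          by_cases hyΩ : y ∈ Ω <;> simp [hH, hyΩ, hy]
        exact contDiffAt_const.congr_of_eventuallyEq h2
    · exact (contDiffAt_const (c := (0 : E n))).congr_of_eventuallyEq (hH0 k x hx)
  have hHs : ∀ k, HasCompactSupport (H k) := by
    intro k
    refine HasCompactSupport.of_support_subset_isCompact hΩb.isCompact_closure ?_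
    exact (support_indicator_subset).trans subset_closure
  have hdivH : ∀ k, ∀ x, divergence (H k) x = Ω.indicator (fun x => χ k x * divergence G x) x := by
    intro k x
    by_cases hx : x ∈ Ω
    · rw [divergence_congr (hHΩ k x hx), indicator_of_mem hx]
      by_cases hxs : x ∈ tsupport G
      · have hxU := hsupp hxs
        rw [divergence_smul ((hχd k x hxU).differentiableAt one_ne_zero)
          ((contDiffAt_of_contDiffOn_closure hΩ hG hx).differentiableAt one_ne_zero)]
        have hχ' : HasFDerivAt (χ k)
            (deriv Real.smoothTransition (-ρ x * (k + 1) - 1) •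
              (-((k : ℝ) + 1) • fderiv ℝ ρ x)) x := by
          have h1 : HasFDerivAt (fun y => -ρ y * ((k : ℝ) + 1) - 1)
              (-((k : ℝ) + 1) • fderiv ℝ ρ x) x := by
            have h2 : HasFDerivAt ρ (fderiv ℝ ρ x) x :=
              ((hρ x hxU).differentiableAt (by norm_num)).hasFDerivAt
            have h3 := (h2.neg.mul_const ((k : ℝ) + 1)).sub_const 1
            refine h3.congr_fderiv ?_
            ext v
            simp
            ring
          have h4 : HasDerivAt Real.smoothTransition
              (deriv Real.smoothTransition (-ρ x * (k + 1) - 1)) (-ρ x * (k + 1) - 1) :=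
            ((Real.smoothTransition.contDiff (n := 1)).differentiable one_ne_zero _).hasDerivAt
          exact h4.comp_hasFDerivAt x h1
        rw [hχ'.fderiv]
        have h5 := htan x hxU hx
        rw [inner_gradient_eq_fderiv] at h5
        simp [h5]
      · have h1 := notMem_tsupport_iff_eventuallyEq.1 hxs
        have h2 : (fun x => χ k x • G x) =ᶠ[𝓝 x] G := by
          filter_upwards [h1] with y hy
          simp [hy]
        rw [divergence_congr h2, divergence_eq_zero_of_notMem_tsupport hxs, mul_zero]
    · rw [divergence_congr (hH0 k x hx), indicator_of_notMem hx]
      simp [divergence]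
  have hzero : ∀ k, ∫ x in Ω, χ k x * divergence G x = 0 := by
    intro k
    rw [← integral_indicator hΩ.measurableSet, ← integral_divergence_eq_zero (hHd k) (hHs k)]
    simp only [hdivH]
  have hint := integrableOn_divergence hΩ hΩb hΩ2 hG
  have hmeas : ∀ k, AEStronglyMeasurable (fun x => χ k x * divergence G x)
      (volume.restrict Ω) := by
    intro k
    have h1 : ContDiffOn ℝ 1 (H k) (closure Ω) := (hHd k).contDiffOn
    refine (integrableOn_divergence hΩ hΩb hΩ2 h1).aestronglyMeasurable.congr ?_
    refine (ae_restrict_iff' hΩ.measurableSet).2 (Eventually.of_forall fun x hx => ?_)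
    rw [hdivH, indicator_of_mem hx]
  -- At a fixed point of `Ω` in the support of `G` one has `ρ < 0`, so `χ k` is eventually `1`; the
  -- domination is by `|divergence G|`.
  have hlim : Tendsto (fun k => ∫ x in Ω, χ k x * divergence G x) atTop
      (𝓝 (∫ x in Ω, divergence G x)) := by
    refine tendsto_integral_of_dominated_convergence (fun x => |divergence G x|) hmeas
      hint.abs ?_ ?_
    · intro k
      refine Eventually.of_forall fun x => ?_
      rw [norm_mul, Real.norm_eq_abs, Real.norm_eq_abs,
        abs_of_nonneg (Real.smoothTransition.nonneg _)]
      exact mul_le_of_le_one_left (abs_nonneg _) (Real.smoothTransition.le_one _)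
    · refine (ae_restrict_iff' hΩ.measurableSet).2 (Eventually.of_forall fun x hx => ?_)
      by_cases hxs : x ∈ tsupport G
      · have hneg : ρ x < 0 := (hmem x (hsupp hxs)).1 hx
        refine tendsto_const_nhds.congr' ?_
        have ht : Tendsto (fun k : ℕ => -ρ x * ((k : ℝ) + 1)) atTop atTop :=
          (tendsto_natCast_atTop_atTop.atTop_add tendsto_const_nhds).const_mul_atTop (by linarith)
        filter_upwards [ht.eventually_ge_atTop 2] with k hk
        have : χ k x = 1 := Real.smoothTransition.one_of_one_le (by linarith)
        rw [this, one_mul]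
      · simp [divergence_eq_zero_of_notMem_tsupport hxs]
  simp only [hzero] at hlim
  exact (tendsto_nhds_unique hlim tendsto_const_nhds)

end Divergence

/-! ### Orthogonal frame coordinates and Fubini in them. -/

section Chart

variable {n : ℕ}

/-- The hyperplane orthogonal to `e`. -/
noncomputable abbrev hyperplane (e : E n) : Submodule ℝ (E n) := (Submodule.span ℝ {e})ᗮ

/-- The point with coordinates `(y, s)` in the frame with origin `x₀` and axis `e`. -/
noncomputable def framePoint (x₀ e : E n) (y : hyperplane e) (s : ℝ) : E n := x₀ + (y : E n) + s • e

/-- The open cylinder of radius and half-height `r` with axis `e`. -/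
noncomputable def frameCyl (x₀ e : E n) (r : ℝ) : Set (E n) :=
  {x | ‖(hyperplane e).orthogonalProjectionOnto (x - x₀)‖ < r ∧ |inner ℝ e (x - x₀)| < r}

variable {x₀ e : E n}

theorem inner_hyperplane (y : hyperplane e) : inner ℝ e (y : E n) = 0 :=
  Submodule.mem_orthogonal_singleton_iff_inner_right.1 y.2

theorem framePoint_orthogonalProjection (he : ‖e‖ = 1) (x : E n) :
    framePoint x₀ e ((hyperplane e).orthogonalProjectionOnto (x - x₀)) (inner ℝ e (x - x₀)) = x := by
  have h := Submodule.starProjection_add_starProjection_orthogonal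
    (K := Submodule.span ℝ {e}) (x - x₀)
  rw [Submodule.starProjection_unit_singleton ℝ he] at h
  have h2 : ((hyperplane e).orthogonalProjectionOnto (x - x₀) : E n) =
      (hyperplane e).starProjection (x - x₀) := rfl
  rw [framePoint, h2, add_assoc, add_comm ((hyperplane e).starProjection _), h]
  abel

theorem inner_framePoint_sub (he : ‖e‖ = 1) (y : hyperplane e) (s : ℝ) :
    inner ℝ e (framePoint x₀ e y s - x₀) = s := by
  have : framePoint x₀ e y s - x₀ = y + s • e := by rw [framePoint]; abel
  rw [this, inner_add_right, inner_hyperplane, real_inner_smul_right, real_inner_self_eq_norm_sq, he]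
  ring

theorem orthogonalProjection_framePoint_sub (y : hyperplane e) (s : ℝ) :
    (hyperplane e).orthogonalProjectionOnto (framePoint x₀ e y s - x₀) = y := by
  have : framePoint x₀ e y s - x₀ = y + s • e := by rw [framePoint]; abel
  rw [this, map_add, map_smul, Submodule.orthogonalProjectionOnto_mem_subspace_eq_self]
  have h0 : (hyperplane e).orthogonalProjectionOnto e = 0 := by
    rw [Submodule.orthogonalProjectionOnto_eq_zero_iff]
    exact Submodule.le_orthogonal_orthogonal _ (Submodule.mem_span_singleton_self e)
  rw [h0, smul_zero, add_zero]

theorem framePoint_mem_frameCyl_iff (he : ‖e‖ = 1) {r : ℝ} {y : hyperplane e} {s : ℝ} :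
    framePoint x₀ e y s ∈ frameCyl x₀ e r ↔ ‖y‖ < r ∧ |s| < r := by
  simp only [frameCyl, mem_ofPred_eq]
  rw [orthogonalProjection_framePoint_sub, inner_framePoint_sub he]

theorem isOpen_frameCyl (x₀ e : E n) (r : ℝ) : IsOpen (frameCyl x₀ e r) :=
  IsOpen.and (p₁ := fun x => ‖(hyperplane e).orthogonalProjectionOnto (x - x₀)‖ < r)
    (isOpen_lt (by fun_prop) continuous_const) (isOpen_lt (by fun_prop) continuous_const)

theorem mem_frameCyl_self {r : ℝ} (hr : 0 < r) : x₀ ∈ frameCyl x₀ e r := by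
  simp [frameCyl, hr]

theorem framePoint_mem_ball (he : ‖e‖ = 1) {r : ℝ} {y : hyperplane e} {s : ℝ} (hy : ‖y‖ < r)
    (hs : |s| ≤ r) : framePoint x₀ e y s ∈ Metric.ball x₀ (3 * r) := by
  have h0 : 0 < r := (norm_nonneg y).trans_lt hy
  rw [mem_ball_iff_norm]
  have : framePoint x₀ e y s - x₀ = y + s • e := by rw [framePoint]; abel
  rw [this]
  calc ‖(y : E n) + s • e‖ ≤ ‖(y : E n)‖ + ‖s • e‖ := norm_add_le _ _
    _ = ‖y‖ + |s| := by rw [norm_smul, he, mul_one]; rfl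
    _ < 3 * r := by linarith

theorem frameCyl_subset_ball (he : ‖e‖ = 1) {r : ℝ} :
    frameCyl x₀ e r ⊆ Metric.ball x₀ (3 * r) := by
  intro x hx
  rw [← framePoint_orthogonalProjection (x₀ := x₀) he x]
  exact framePoint_mem_ball he hx.1 hx.2.le

/-- The coordinate map is a linear isomorphism, so it carries the product of Lebesgue measures to a
Haar measure, which is a multiple of Lebesgue measure. Only the positivity of the constant matters,
and it does not depend on the origin `x₀`. -/
theorem exists_integral_eq_iterated (he : ‖e‖ = 1) :
    ∃ c : ℝ, 0 < c ∧ ∀ (x₀ : E n) (f : E n → ℝ), Integrable f →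
      ∫ x, f x = c * ∫ y : hyperplane e, ∫ s : ℝ, f (framePoint x₀ e y s) := by
  let L : (hyperplane e × ℝ) ≃L[ℝ] E n := LinearEquiv.toContinuousLinearEquiv
    { toFun := fun p => framePoint 0 e p.1 p.2
      map_add' := by intro p q; simp [framePoint, add_smul]; abel
      map_smul' := by intro c p; simp [framePoint, mul_smul]
      invFun := fun x => ((hyperplane e).orthogonalProjectionOnto (x - 0), inner ℝ e (x - 0))
      left_inv := by
        rintro ⟨y, s⟩
        exact Prod.ext (orthogonalProjection_framePoint_sub y s) (inner_framePoint_sub he y s)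
      right_inv := fun x => framePoint_orthogonalProjection he x }
  have hL : ∀ p, L p = framePoint 0 e p.1 p.2 := fun p => rfl
  set m : Measure (hyperplane e × ℝ) := (volume : Measure (hyperplane e)).prod volume with hm
  have : (Measure.map L m).IsAddHaarMeasure := L.isAddHaarMeasure_map m
  set c := (volume : Measure (E n)).addHaarScalarFactor (Measure.map L m) with hc
  have hvol : (volume : Measure (E n)) = c • Measure.map L m :=
    Measure.isAddLeftInvariant_eq_smul _ _
  have hcpos : 0 < c := Measure.addHaarScalarFactor_pos_of_isAddHaarMeasure _ _
  refine ⟨c, hcpos, fun x₀ f hf => ?_⟩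
  have hLe : MeasurableEmbedding L := L.toHomeomorph.measurableEmbedding
  have hft : Integrable fun x => f (x₀ + x) := hf.comp_add_left x₀
  have h1 : ∫ x, f x = ∫ x, f (x₀ + x) := (integral_add_left_eq_self f x₀).symm
  have hft' : Integrable (fun x => f (x₀ + x)) (Measure.map L m) := by
    rw [hvol] at hft
    exact (integrable_smul_measure (c := (c : ENNReal)) (by simpa using hcpos.ne') (by simp)).1 hft
  have hprod : Integrable (fun p => f (x₀ + L p)) m := (hLe.integrable_map_iff).1 hft'
  have h2 : ∫ x, f (x₀ + x) = c * ∫ x, f (x₀ + x) ∂(Measure.map L m) := by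
    conv_lhs => rw [hvol]
    rw [integral_smul_nnreal_measure]
    rfl
  rw [h1, h2, hLe.integral_map, hm, integral_prod _ hprod]
  simp only [hL, framePoint, zero_add, add_assoc]

end Chart

/-! ### The domain as a Lipschitz subgraph near a boundary point. -/

section GraphChart

variable {n : ℕ}

/-- In the cylinder of radius `r` around `x₀` with axis `e`, the set `Ω` is the subgraph of the
Lipschitz function `γ`. -/
structure IsGraphChart (Ω : Set (E n)) (x₀ e : E n) (r : ℝ) (γ : hyperplane e → ℝ) : Prop where
  norm_axis : ‖e‖ = 1
  abs_lt : ∀ y, ‖y‖ < r → |γ y| < r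
  mem_iff : ∀ y s, ‖y‖ < r → |s| ≤ r → (framePoint x₀ e y s ∈ Ω ↔ s < γ y)
  mem_frontier_iff : ∀ y s, ‖y‖ < r → |s| ≤ r → (framePoint x₀ e y s ∈ frontier Ω ↔ s = γ y)
  lipschitz : LipschitzOnWith 1 γ (Metric.ball 0 r)

variable {Ω : Set (E n)} {ρ : E n → ℝ} {x₀ : E n}

theorem exists_ball_of_isDefiningFunctionAt (hΩ : IsOpen Ω) (hρ : IsDefiningFunctionAt Ω ρ x₀) :
    ∃ r : ℝ, 0 < r ∧ ∀ x ∈ Metric.ball x₀ (3 * r), ContDiffAt ℝ 2 ρ x ∧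
      ‖gradient ρ x - gradient ρ x₀‖ ≤ ‖gradient ρ x₀‖ / 4 ∧ (x ∈ Ω ↔ ρ x < 0) ∧
      (x ∈ frontier Ω ↔ ρ x = 0) ∧ (x ∈ frontier Ω → IsDefiningFunctionAt Ω ρ x) := by
  have hpos := norm_pos_iff.2 hρ.gradient_ne_zero
  have h1 : ∀ᶠ y in 𝓝 x₀, ContDiffAt ℝ 2 ρ y := hρ.contDiffAt.eventually (by simp)
  have h2 : ∀ᶠ y in 𝓝 x₀, ‖gradient ρ y - gradient ρ x₀‖ < ‖gradient ρ x₀‖ / 4 := by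
    have hc : ContinuousAt (fun y => ‖gradient ρ y - gradient ρ x₀‖) x₀ :=
      ((contDiffAt_gradient hρ.contDiffAt).continuousAt.sub continuousAt_const).norm
    refine hc.eventually_lt_const ?_
    simp only [sub_self, norm_zero]
    positivity
  obtain ⟨R, hR, hball⟩ := Metric.eventually_nhds_iff_ball.1
    (h1.and (h2.and (hρ.eventually_mem_iff.and ((hρ.eventually hΩ).and
      (hρ.eventually_mem_frontier hΩ)))))
  -- Division by 3 because a frame cylinder of size `r` lies in the ball of radius `3r`.
  refine ⟨R / 3, by positivity, fun x hx => ?_⟩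
  rw [mul_div_cancel₀ _ (by norm_num : (3 : ℝ) ≠ 0)] at hx
  obtain ⟨a1, a2, a3, a4, a5⟩ := hball x hx
  exact ⟨a1, a2.le, a3, ⟨fun h => (a4 h).map_eq_zero, a5⟩, a4⟩

/-- On the ball, `ρ` differs from its linearisation at `x₀`, which has slope `a = |∇ρ x₀|` along
`e`, by a function with Lipschitz constant `a/4`. Hence `ρ` is strictly increasing in the direction
`e`, its unique zero on each line is `γ`, and the same estimate bounds the slope of `γ`. -/
theorem exists_isGraphChart (hρ : IsDefiningFunctionAt Ω ρ x₀) {r : ℝ}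
    (hball : ∀ x ∈ Metric.ball x₀ (3 * r), ContDiffAt ℝ 2 ρ x ∧
      ‖gradient ρ x - gradient ρ x₀‖ ≤ ‖gradient ρ x₀‖ / 4 ∧ (x ∈ Ω ↔ ρ x < 0) ∧
      (x ∈ frontier Ω ↔ ρ x = 0)) :
    ∃ γ, IsGraphChart Ω x₀ (‖gradient ρ x₀‖⁻¹ • gradient ρ x₀) r γ := by
  set a := ‖gradient ρ x₀‖ with ha
  have hapos : 0 < a := norm_pos_iff.2 hρ.gradient_ne_zero
  set e : E n := a⁻¹ • gradient ρ x₀ with he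
  have hnorm : ‖e‖ = 1 := by
    rw [he, norm_smul, norm_inv, ha, norm_norm, inv_mul_cancel₀ (ha ▸ hapos.ne')]
  have hge : gradient ρ x₀ = a • e := by rw [he, smul_smul, mul_inv_cancel₀ hapos.ne', one_smul]
  have hstar : ∀ x ∈ Metric.ball x₀ (3 * r), ∀ x' ∈ Metric.ball x₀ (3 * r),
      |ρ x' - ρ x - a * inner ℝ e (x' - x)| ≤ a / 4 * ‖x' - x‖ := by
    intro x hx x' hx'
    have h := (convex_ball x₀ (3 * r)).norm_image_sub_le_of_norm_fderiv_le' (𝕜 := ℝ) (f := ρ)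
      (φ := fderiv ℝ ρ x₀) (C := a / 4)
      (fun z hz => (hball z hz).1.differentiableAt (by norm_num)) ?_ hx hx'
    · rw [← inner_gradient_eq_fderiv, hge, real_inner_smul_left, Real.norm_eq_abs] at h
      exact h
    · intro z hz
      have h2 := (hball z hz).2.1
      rw [gradient, gradient, ← map_sub, LinearIsometryEquiv.norm_map] at h2
      exact h2
  have hdiff : ∀ (y y' : hyperplane e) (s s' : ℝ), framePoint x₀ e y' s' - framePoint x₀ e y s =
      ((y' - y : hyperplane e) : E n) + (s' - s) • e := by
    intro y y' s s'
    simp only [framePoint, Submodule.coe_sub, sub_smul]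
    abel
  have hP : ∀ (y y' : hyperplane e) (s s' : ℝ), ‖y‖ < r → |s| ≤ r → ‖y'‖ < r → |s'| ≤ r →
      |ρ (framePoint x₀ e y' s') - ρ (framePoint x₀ e y s) - a * (s' - s)| ≤
        a / 4 * (‖y' - y‖ + |s' - s|) := by
    intro y y' s s' hy hs hy' hs'
    have h := hstar _ (framePoint_mem_ball hnorm hy hs) _ (framePoint_mem_ball hnorm hy' hs')
    rw [hdiff, inner_add_right, inner_hyperplane, real_inner_smul_right,
      real_inner_self_eq_norm_sq, hnorm, zero_add, one_pow, mul_one] at h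
    refine h.trans ?_
    gcongr
    refine (norm_add_le _ _).trans ?_
    rw [norm_smul, hnorm, mul_one]
    rfl
  have hx0 : framePoint x₀ e 0 0 = x₀ := by simp [framePoint]
  -- At `s = ±r` the linear part is `±a r` and the error is at most `a/4 · 2r`, so `ρ` changes sign
  -- on the segment.
  have hex : ∀ y : hyperplane e, ‖y‖ < r →
      ∃ s : ℝ, |s| < r ∧ ρ (framePoint x₀ e y s) = 0 := by
    intro y hy
    have hr : 0 < r := (norm_nonneg y).trans_lt hy
    have hv : ∀ s, |s| ≤ r → |ρ (framePoint x₀ e y s) - a * s| ≤ a / 4 * (‖y‖ + |s|) := by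
      intro s hs
      have h := hP 0 y 0 s (by simpa using hr) (by simpa using hr.le) hy hs
      rwa [hx0, hρ.map_eq_zero, sub_zero, sub_zero, sub_zero] at h
    have hcont : ContinuousOn (fun s => ρ (framePoint x₀ e y s)) (Icc (-r) r) := by
      intro s hs
      have h1 := (hball _ (framePoint_mem_ball (x₀ := x₀) hnorm hy (abs_le.2 hs))).1.continuousAt
      have h2 : Continuous fun s => framePoint x₀ e y s := by unfold framePoint; fun_prop
      exact (ContinuousAt.comp (f := fun s => framePoint x₀ e y s) h1
        h2.continuousAt).continuousWithinAt
    have hlow : ρ (framePoint x₀ e y (-r)) < 0 := by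
      have h := (abs_le.1 (hv (-r) (by rw [abs_neg, abs_of_pos hr]))).2
      rw [abs_neg, abs_of_pos hr] at h
      nlinarith
    have hhigh : 0 < ρ (framePoint x₀ e y r) := by
      have h := (abs_le.1 (hv r (by rw [abs_of_pos hr]))).1
      rw [abs_of_pos hr] at h
      nlinarith
    obtain ⟨s, hs, hs0⟩ := intermediate_value_Icc (by linarith : -r ≤ r) hcont ⟨hlow.le, hhigh.le⟩
    refine ⟨s, abs_lt.2 ⟨lt_of_le_of_ne hs.1 ?_, lt_of_le_of_ne hs.2 ?_⟩, hs0⟩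
    · rintro rfl
      exact hlow.ne hs0
    · rintro rfl
      exact hhigh.ne' hs0
  choose! γ hγ1 hγ2 using hex
  -- Measured from the zero `γ y`, the error is at most a quarter of the linear part, so `ρ` has the
  -- sign of `s - γ y`.
  have hmono : ∀ y s, ‖y‖ < r → |s| ≤ r →
      |ρ (framePoint x₀ e y s) - a * (s - γ y)| ≤ a / 4 * |s - γ y| := by
    intro y s hy hs
    have h := hP y y (γ y) s hy (hγ1 y hy).le hy hs
    rwa [hγ2 y hy, sub_zero, sub_self, norm_zero, zero_add] at h
  refine ⟨γ, hnorm, hγ1, fun y s hy hs => ?_, fun y s hy hs => ?_, ?_⟩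
  · rw [(hball _ (framePoint_mem_ball hnorm hy hs)).2.2.1]
    have h := abs_le.1 (hmono y s hy hs)
    constructor
    · intro hlt
      by_contra hcon
      push Not at hcon
      rw [abs_of_nonneg (by linarith)] at h
      nlinarith
    · intro hlt
      rw [abs_of_neg (by linarith)] at h
      nlinarith
  · rw [(hball _ (framePoint_mem_ball hnorm hy hs)).2.2.2]
    have h := hmono y s hy hs
    constructor
    · intro h0
      rw [h0, zero_sub, abs_neg, abs_mul, abs_of_pos hapos] at h
      have : |s - γ y| ≤ 0 := by nlinarith [abs_nonneg (s - γ y)]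
      exact sub_eq_zero.1 (abs_nonpos_iff.1 this)
    · rintro rfl
      exact hγ2 y hy
  · refine LipschitzOnWith.of_dist_le_mul fun y hy y' hy' => ?_
    rw [mem_ball_zero_iff] at hy hy'
    have h := hP y' y (γ y') (γ y) hy' (hγ1 y' hy').le hy (hγ1 y hy).le
    rw [hγ2 y hy, hγ2 y' hy', sub_self, zero_sub, abs_neg, abs_mul, abs_of_pos hapos] at h
    rw [Real.dist_eq, dist_eq_norm, NNReal.coe_one, one_mul]
    have h' : |γ y - γ y'| ≤ 1 / 4 * (‖y - y'‖ + |γ y - γ y'|) := by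
      have : a * |γ y - γ y'| ≤ a * (1 / 4 * (‖y - y'‖ + |γ y - γ y'|)) := by linarith
      exact le_of_mul_le_mul_left this hapos
    -- The estimate gives slope at most `1/3`; the constant `1` is enough.
    linarith [norm_nonneg (y - y')]

end GraphChart

/-! ### Integration along the axis, and surface measure in a graph chart. -/

section LocalDivergence

variable {n : ℕ} {Ω : Set (E n)} {x₀ e : E n} {r : ℝ} {γ : hyperplane e → ℝ}

/-- Fubini, then the fundamental theorem of calculus on each line from `-r` to `γ y`. The support
condition kills the value at `-r` and every line with `‖y‖ ≥ r`. -/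
theorem setIntegral_fderiv_eq_graph (hΩ : IsOpen Ω) (hΩb : Bornology.IsBounded Ω)
    (hΩ2 : HasC2Boundary Ω) (hγ : IsGraphChart Ω x₀ e r γ) {c : ℝ}
    (hc : ∀ (x₀ : E n) (f : E n → ℝ), Integrable f →
      ∫ x, f x = c * ∫ y : hyperplane e, ∫ s : ℝ, f (framePoint x₀ e y s))
    {ψ : E n → ℝ} (hψ : ContDiffOn ℝ 1 ψ (closure Ω)) (hsupp : tsupport ψ ⊆ frameCyl x₀ e r) :
    ∫ x in Ω, fderiv ℝ ψ x e =
      c * ∫ y in Metric.ball (0 : hyperplane e) r, ψ (framePoint x₀ e y (γ y)) := by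
  have he := hγ.norm_axis
  have hint := (integrableOn_fderiv_apply hΩ hΩb hΩ2 hψ e).integrable_indicator hΩ.measurableSet
  obtain ⟨M, hM⟩ := exists_norm_fderiv_le hΩ hΩb hΩ2 hψ
  rw [← integral_indicator hΩ.measurableSet, hc x₀ _ hint,
    ← integral_indicator Metric.isOpen_ball.measurableSet]
  congr 1
  refine integral_congr_ae (Eventually.of_forall fun y => ?_)
  have hout : ∀ s, framePoint x₀ e y s ∉ frameCyl x₀ e r →
      fderiv ℝ ψ (framePoint x₀ e y s) = 0 := fun s hs =>
    fderiv_eq_zero_of_notMem_tsupport fun h => hs (hsupp h)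
  beta_reduce
  by_cases hy : ‖y‖ < r
  · have hyb : y ∈ Metric.ball (0 : hyperplane e) r := by simpa using hy
    have hγy := abs_lt.1 (hγ.abs_lt y hy)
    have hmem : ∀ s ∈ Ioo (-r) (γ y), framePoint x₀ e y s ∈ Ω := fun s hs =>
      (hγ.mem_iff y s hy (abs_le.2 ⟨hs.1.le, hs.2.le.trans hγy.2.le⟩)).2 hs.2
    have h1 : (fun s => Ω.indicator (fun x => fderiv ℝ ψ x e) (framePoint x₀ e y s)) =
        (Ioo (-r) (γ y)).indicator fun s => fderiv ℝ ψ (framePoint x₀ e y s) e := by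
      funext s
      by_cases hs : s ∈ Ioo (-r) (γ y)
      · rw [indicator_of_mem hs, indicator_of_mem (hmem s hs)]
      · rw [indicator_of_notMem hs]
        by_cases hs2 : |s| < r
        · rw [indicator_of_notMem]
          intro hsΩ
          exact hs ⟨(abs_lt.1 hs2).1, (hγ.mem_iff y s hy hs2.le).1 hsΩ⟩
        · refine indicator_apply_eq_zero.2 fun _ => ?_
          rw [hout s (fun h => hs2 ((framePoint_mem_frameCyl_iff he).1 h).2)]
          rfl
    have hcont : Continuous fun s => framePoint x₀ e y s := by unfold framePoint; fun_prop
    have hmaps : MapsTo (fun s => framePoint x₀ e y s) (Icc (-r) (γ y)) (closure Ω) := by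
      intro s hs
      have hsr : |s| ≤ r := abs_le.2 ⟨hs.1, hs.2.trans hγy.2.le⟩
      rcases hs.2.eq_or_lt with h | h
      · exact frontier_subset_closure ((hγ.mem_frontier_iff y s hy hsr).2 h)
      · exact subset_closure ((hγ.mem_iff y s hy hsr).2 h)
    have hder : ∀ s ∈ Ioo (-r) (γ y), HasDerivAt (fun s => ψ (framePoint x₀ e y s))
        (fderiv ℝ ψ (framePoint x₀ e y s) e) s := by
      intro s hs
      have h2 : HasDerivAt (fun s => framePoint x₀ e y s) e s := by
        simpa [framePoint] using ((hasDerivAt_id s).smul_const e).const_add (x₀ + (y : E n))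
      have h3 := ((contDiffAt_of_contDiffOn_closure hΩ hψ (hmem s hs)).differentiableAt
        one_ne_zero).hasFDerivAt
      exact h3.comp_hasDerivAt s h2
    have hii : IntervalIntegrable (fun s => fderiv ℝ ψ (framePoint x₀ e y s) e) volume
        (-r) (γ y) := by
      rw [intervalIntegrable_iff_integrableOn_Ioo_of_le hγy.1.le]
      refine integrableOn_of_continuousOn_of_bound measurableSet_Ioo (by simp) ?_
        (M := M) fun s hs => ?_
      · exact (((continuousOn_fderiv hΩ hψ).comp hcont.continuousOn hmem).clm_apply
          continuousOn_const)
      · refine ((fderiv ℝ ψ _).le_opNorm e).trans ?_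
        rw [he, mul_one]
        exact hM _ (hmem s hs)
    have hFTC := intervalIntegral.integral_eq_sub_of_hasDerivAt_of_le hγy.1.le
      (hψ.continuousOn.comp hcont.continuousOn hmaps) hder hii
    have hzero : ψ (framePoint x₀ e y (-r)) = 0 := by
      refine image_eq_zero_of_notMem_tsupport fun h => ?_
      have := ((framePoint_mem_frameCyl_iff he).1 (hsupp h)).2
      rw [abs_neg] at this
      exact (le_abs_self r).not_gt this
    rw [h1, integral_indicator measurableSet_Ioo, ← integral_Ioc_eq_integral_Ioo,
      ← intervalIntegral.integral_of_le hγy.1.le, hFTC, indicator_of_mem hyb]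
    simp [hzero]
  · have hyb : y ∉ Metric.ball (0 : hyperplane e) r := by simpa using hy
    rw [indicator_of_notMem hyb]
    refine integral_eq_zero_of_ae (Eventually.of_forall fun s => ?_)
    refine indicator_apply_eq_zero.2 fun _ => ?_
    rw [hout s (fun h => hy ((framePoint_mem_frameCyl_iff he).1 h).1)]
    rfl

theorem finrank_hyperplane (he : ‖e‖ = 1) : Module.finrank ℝ (hyperplane e) = n - 1 := by
  have h0 : e ≠ 0 := by
    rintro rfl
    simp at he
  have h1 : Module.finrank ℝ (Submodule.span ℝ {e}) + Module.finrank ℝ (hyperplane e) = _ :=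
    Submodule.finrank_add_finrank_orthogonal (Submodule.span ℝ {e})
  rw [finrank_span_singleton h0, finrank_euclideanSpace, Fintype.card_fin] at h1
  omega

theorem euclideanHausdorffMeasure_hyperplane (he : ‖e‖ = 1) :
    (Measure.euclideanHausdorffMeasure (n - 1) : Measure (hyperplane e)) = volume := by
  rw [← finrank_hyperplane he, InnerProductSpace.euclideanHausdorffMeasure_eq_volume]

theorem IsGraphChart.mem_frontier (hγ : IsGraphChart Ω x₀ e r γ) {y : hyperplane e}
    (hy : ‖y‖ < r) : framePoint x₀ e y (γ y) ∈ frontier Ω :=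
  (hγ.mem_frontier_iff y (γ y) hy (hγ.abs_lt y hy).le).2 rfl

theorem IsGraphChart.mem_frameCyl (hγ : IsGraphChart Ω x₀ e r γ) {y : hyperplane e}
    (hy : ‖y‖ < r) : framePoint x₀ e y (γ y) ∈ frameCyl x₀ e r :=
  (framePoint_mem_frameCyl_iff hγ.norm_axis).2 ⟨hy, hγ.abs_lt y hy⟩

theorem IsGraphChart.lipschitzOnWith_framePoint (hγ : IsGraphChart Ω x₀ e r γ) :
    LipschitzOnWith 2 (fun y => framePoint x₀ e y (γ y)) (Metric.ball 0 r) := by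
  refine LipschitzOnWith.of_dist_le_mul fun y hy y' hy' => ?_
  have h := hγ.lipschitz.dist_le_mul y hy y' hy'
  rw [Real.dist_eq, NNReal.coe_one, one_mul, dist_eq_norm] at h
  have h2 : framePoint x₀ e y (γ y) - framePoint x₀ e y' (γ y') =
      ((y - y' : hyperplane e) : E n) + (γ y - γ y') • e := by
    simp only [framePoint, Submodule.coe_sub, sub_smul]
    abel
  rw [dist_eq_norm, dist_eq_norm, h2]
  refine (norm_add_le _ _).trans ?_
  rw [norm_smul, hγ.norm_axis, mul_one, Real.norm_eq_abs]
  have h3 : ‖((y - y' : hyperplane e) : E n)‖ = ‖y - y'‖ := rfl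
  rw [h3, NNReal.coe_ofNat]
  linarith

/-- Orthogonal projection onto the hyperplane inverts the graph map and is 1-Lipschitz, so it does
not increase Hausdorff measure. -/
theorem IsGraphChart.volume_preimage_le (hγ : IsGraphChart Ω x₀ e r γ) {A : Set (E n)}
    (hA : MeasurableSet A) :
    volume ((fun y => framePoint x₀ e y (γ y)) ⁻¹' A ∩ Metric.ball 0 r) ≤ surfaceMeasure Ω A := by
  rw [← euclideanHausdorffMeasure_hyperplane hγ.norm_axis, surfaceMeasure,
    Measure.restrict_apply hA]
  have hlip : LipschitzWith 1 fun x : E n => (hyperplane e).orthogonalProjectionOnto (x - x₀) := by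
    have := (hyperplane e).lipschitzWith_orthogonalProjectionOnto.comp
      ((LipschitzWith.id (α := E n)).sub (LipschitzWith.const x₀))
    exact this.weaken (by simp)
  have hsub : (fun y => framePoint x₀ e y (γ y)) ⁻¹' A ∩ Metric.ball 0 r ⊆
      (fun x : E n => (hyperplane e).orthogonalProjectionOnto (x - x₀)) '' (A ∩ frontier Ω) := by
    rintro y ⟨hyA, hy⟩
    rw [mem_ball_zero_iff] at hy
    exact ⟨framePoint x₀ e y (γ y), ⟨hyA, hγ.mem_frontier hy⟩,
      orthogonalProjection_framePoint_sub y (γ y)⟩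
  refine (measure_mono hsub).trans ?_
  simpa using euclideanHausdorffMeasure_image_le (hlip.lipschitzOnWith (s := A ∩ frontier Ω))
    (n - 1)

/-- The graph map covers the boundary inside the cylinder and is 2-Lipschitz, whence the factor `2 ^
(n - 1)`. -/
theorem IsGraphChart.surfaceMeasure_le (hγ : IsGraphChart Ω x₀ e r γ) {A : Set (E n)}
    (hA : MeasurableSet A) : (surfaceMeasure Ω).restrict (frameCyl x₀ e r) A ≤
      2 ^ (n - 1) *
        volume ((fun y => framePoint x₀ e y (γ y)) ⁻¹' A ∩ Metric.ball 0 r) := by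
  rw [← euclideanHausdorffMeasure_hyperplane hγ.norm_axis, surfaceMeasure,
    Measure.restrict_restrict (isOpen_frameCyl _ _ _).measurableSet, Measure.restrict_apply hA]
  have hsub : A ∩ (frameCyl x₀ e r ∩ frontier Ω) ⊆ (fun y => framePoint x₀ e y (γ y)) ''
      ((fun y => framePoint x₀ e y (γ y)) ⁻¹' A ∩ Metric.ball 0 r) := by
    rintro x ⟨hxA, hxc, hxf⟩
    have hx := framePoint_orthogonalProjection (x₀ := x₀) hγ.norm_axis x
    have h1 := (hγ.mem_frontier_iff _ _ hxc.1 hxc.2.le).1 (by rwa [hx])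
    rw [h1] at hx
    refine ⟨(hyperplane e).orthogonalProjectionOnto (x - x₀), ⟨?_, ?_⟩, hx⟩
    · rw [mem_preimage, hx]
      exact hxA
    · rw [mem_ball_zero_iff]
      exact hxc.1
  refine (measure_mono hsub).trans ?_
  simpa using euclideanHausdorffMeasure_image_le
    (hγ.lipschitzOnWith_framePoint.mono (inter_subset_right
      (s := (fun y => framePoint x₀ e y (γ y)) ⁻¹' A))) (n - 1)

end LocalDivergence

/-! ### The local Gauss-Green measure. -/

section LocalMeasure

variable {n : ℕ} {Ω : Set (E n)} {x₀ e : E n} {r : ℝ} {γ : hyperplane e → ℝ}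

/-- The image of the measure `θ dy` under the graph map of a graph chart. -/
noncomputable def graphMeasure (x₀ e : E n) (r : ℝ) (γ : hyperplane e → ℝ) (θ : E n → ℝ) :
    Measure (E n) :=
  Measure.map (fun y => framePoint x₀ e y (γ y))
    ((volume.restrict (Metric.ball 0 r)).withDensity
      fun y => ENNReal.ofReal (θ (framePoint x₀ e y (γ y))))

theorem IsGraphChart.aemeasurable (hγ : IsGraphChart Ω x₀ e r γ) :
    AEMeasurable (fun y => framePoint x₀ e y (γ y)) (volume.restrict (Metric.ball 0 r)) :=
  hγ.lipschitzOnWith_framePoint.continuousOn.aemeasurable Metric.isOpen_ball.measurableSet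

theorem IsGraphChart.graphMeasure_apply (hγ : IsGraphChart Ω x₀ e r γ) (θ : E n → ℝ)
    {A : Set (E n)} (hA : MeasurableSet A) :
    graphMeasure x₀ e r γ θ A = ∫⁻ y in (fun y => framePoint x₀ e y (γ y)) ⁻¹' A,
      ENNReal.ofReal (θ (framePoint x₀ e y (γ y))) ∂(volume.restrict (Metric.ball 0 r)) := by
  rw [graphMeasure, Measure.map_apply_of_aemeasurable
    (hγ.aemeasurable.mono_ac (withDensity_absolutelyContinuous _ _)) hA, withDensity_apply']

theorem IsGraphChart.graphMeasure_le (hγ : IsGraphChart Ω x₀ e r γ) {θ : E n → ℝ} {M : ℝ}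
    (hθ : ∀ x ∈ frontier Ω ∩ frameCyl x₀ e r, θ x ≤ M) :
    graphMeasure x₀ e r γ θ ≤ ENNReal.ofReal M • surfaceMeasure Ω := by
  refine Measure.le_iff.2 fun A hA => ?_
  rw [hγ.graphMeasure_apply θ hA, Measure.smul_apply, smul_eq_mul]
  have hae : ∀ᵐ y ∂((volume : Measure (hyperplane e)).restrict (Metric.ball 0 r)),
      ENNReal.ofReal (θ (framePoint x₀ e y (γ y))) ≤ ENNReal.ofReal M := by
    refine (ae_restrict_iff' Metric.isOpen_ball.measurableSet).2 (Eventually.of_forall fun y hy => ?_)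
    rw [mem_ball_zero_iff] at hy
    exact ENNReal.ofReal_le_ofReal (hθ _ ⟨hγ.mem_frontier hy, hγ.mem_frameCyl hy⟩)
  refine (lintegral_mono_ae (ae_restrict_of_ae hae)).trans ?_
  rw [setLIntegral_const, Measure.restrict_apply' Metric.isOpen_ball.measurableSet]
  gcongr
  exact hγ.volume_preimage_le hA

theorem IsGraphChart.le_graphMeasure (hγ : IsGraphChart Ω x₀ e r γ) {θ : E n → ℝ} {m : ℝ}
    (hm : 0 < m) (hθ : ∀ x ∈ frontier Ω ∩ frameCyl x₀ e r, m ≤ θ x) :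
    (surfaceMeasure Ω).restrict (frameCyl x₀ e r) ≤
      ENNReal.ofReal (2 ^ (n - 1) / m) • graphMeasure x₀ e r γ θ := by
  refine Measure.le_iff.2 fun A hA => ?_
  refine (hγ.surfaceMeasure_le hA).trans ?_
  rw [Measure.smul_apply, smul_eq_mul, hγ.graphMeasure_apply θ hA]
  have hae : ∀ᵐ y ∂((volume : Measure (hyperplane e)).restrict (Metric.ball 0 r)),
      ENNReal.ofReal m ≤ ENNReal.ofReal (θ (framePoint x₀ e y (γ y))) := by
    refine (ae_restrict_iff' Metric.isOpen_ball.measurableSet).2 (Eventually.of_forall fun y hy => ?_)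
    rw [mem_ball_zero_iff] at hy
    exact ENNReal.ofReal_le_ofReal (hθ _ ⟨hγ.mem_frontier hy, hγ.mem_frameCyl hy⟩)
  have h1 := lintegral_mono_ae (ae_restrict_of_ae
    (s := (fun y => framePoint x₀ e y (γ y)) ⁻¹' A) hae)
  rw [setLIntegral_const, Measure.restrict_apply' Metric.isOpen_ball.measurableSet] at h1
  have h2 : ENNReal.ofReal (2 ^ (n - 1) / m) * ENNReal.ofReal m = 2 ^ (n - 1) := by
    rw [← ENNReal.ofReal_mul (by positivity), div_mul_cancel₀ _ hm.ne',
      ENNReal.ofReal_pow (by norm_num), ENNReal.ofReal_ofNat]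
  calc _ = ENNReal.ofReal (2 ^ (n - 1) / m) * (ENNReal.ofReal m *
        volume ((fun y => framePoint x₀ e y (γ y)) ⁻¹' A ∩ Metric.ball 0 r)) := by
        rw [← mul_assoc, h2]
    _ ≤ _ := by gcongr

theorem IsGraphChart.isFiniteMeasure_graphMeasure (hγ : IsGraphChart Ω x₀ e r γ) {θ : E n → ℝ}
    {M : ℝ} (hθ : ∀ x ∈ frontier Ω ∩ frameCyl x₀ e r, θ x ≤ M) :
    IsFiniteMeasure (graphMeasure x₀ e r γ θ) := by
  refine ⟨?_⟩
  rw [hγ.graphMeasure_apply θ MeasurableSet.univ, preimage_univ, Measure.restrict_univ]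
  have hae : ∀ᵐ y ∂((volume : Measure (hyperplane e)).restrict (Metric.ball 0 r)),
      ENNReal.ofReal (θ (framePoint x₀ e y (γ y))) ≤ ENNReal.ofReal M := by
    refine (ae_restrict_iff' Metric.isOpen_ball.measurableSet).2 (Eventually.of_forall fun y hy => ?_)
    rw [mem_ball_zero_iff] at hy
    exact ENNReal.ofReal_le_ofReal (hθ _ ⟨hγ.mem_frontier hy, hγ.mem_frameCyl hy⟩)
  refine (lintegral_mono_ae hae).trans_lt ?_
  rw [lintegral_const, Measure.restrict_apply_univ]
  exact ENNReal.mul_lt_top ENNReal.ofReal_lt_top measure_ball_lt_top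

theorem IsGraphChart.integral_graphMeasure (hγ : IsGraphChart Ω x₀ e r γ) {θ : E n → ℝ}
    (hθc : ContinuousOn θ (frameCyl x₀ e r))
    (hθ : ∀ x ∈ frontier Ω ∩ frameCyl x₀ e r, 0 ≤ θ x) {f : E n → ℝ}
    (hf : AEStronglyMeasurable f (graphMeasure x₀ e r γ θ)) :
    ∫ x, f x ∂(graphMeasure x₀ e r γ θ) = ∫ y in Metric.ball 0 r,
      θ (framePoint x₀ e y (γ y)) * f (framePoint x₀ e y (γ y)) := by
  have hmeas : AEMeasurable (fun y => ENNReal.ofReal (θ (framePoint x₀ e y (γ y))))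
      ((volume : Measure (hyperplane e)).restrict (Metric.ball 0 r)) := by
    have hc : ContinuousOn (fun y => θ (framePoint x₀ e y (γ y))) (Metric.ball 0 r) :=
      hθc.comp hγ.lipschitzOnWith_framePoint.continuousOn fun y hy =>
        hγ.mem_frameCyl (mem_ball_zero_iff.1 hy)
    exact (hc.aemeasurable Metric.isOpen_ball.measurableSet).ennreal_ofReal
  rw [graphMeasure, integral_map
    (hγ.aemeasurable.mono_ac (withDensity_absolutelyContinuous _ _)) hf,
    integral_withDensity_eq_integral_toReal_smul₀ hmeas (by simp)]
  refine setIntegral_congr_fun Metric.isOpen_ball.measurableSet fun y hy => ?_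
  rw [mem_ball_zero_iff] at hy
  simp only [smul_eq_mul]
  rw [ENNReal.toReal_ofReal (hθ _ ⟨hγ.mem_frontier hy, hγ.mem_frameCyl hy⟩)]

theorem surfaceMeasure_eq_restrict (Ω : Set (E n)) :
    (surfaceMeasure Ω).restrict (frontier Ω) = surfaceMeasure Ω := by
  rw [surfaceMeasure, Measure.restrict_restrict isClosed_frontier.measurableSet, inter_self]

theorem aestronglyMeasurable_surfaceMeasure {F' : Type*} [NormedAddCommGroup F']
    {f : E n → F'} (hf : ContinuousOn f (frontier Ω)) :
    AEStronglyMeasurable f (surfaceMeasure Ω) := by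
  rw [← surfaceMeasure_eq_restrict]
  exact hf.aestronglyMeasurable isClosed_frontier.measurableSet

theorem contDiffOn_of_tsupport {F' : Type*} [NormedAddCommGroup F'] [NormedSpace ℝ F']
    {S U : Set (E n)} {f : E n → F'} (hsupp : tsupport f ⊆ U)
    (h : ∀ x ∈ U, x ∈ S → ContDiffWithinAt ℝ 1 f S x) : ContDiffOn ℝ 1 f S := by
  intro x hx
  by_cases hxs : x ∈ tsupport f
  · exact h x (hsupp hxs) hx
  · have h1 : f =ᶠ[𝓝 x] fun _ => 0 := notMem_tsupport_iff_eventuallyEq.1 hxs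
    exact (contDiffAt_const.congr_of_eventuallyEq h1).contDiffWithinAt

/-- The Gauss-Green formula near a boundary point, for a measure comparable to the surface
measure. -/
theorem exists_local_divergence_measure_boundary (hΩ : IsOpen Ω) (hΩb : Bornology.IsBounded Ω)
    (hΩ2 : HasC2Boundary Ω) (hx₀ : x₀ ∈ frontier Ω) :
    ∃ U : Set (E n), IsOpen U ∧ x₀ ∈ U ∧ ∃ (μ : Measure (E n)) (C : NNReal),
      IsFiniteMeasure μ ∧ μ ≤ C • surfaceMeasure Ω ∧ (surfaceMeasure Ω).restrict U ≤ C • μ ∧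
      ∀ G : E n → E n, ContDiffOn ℝ 1 G (closure Ω) → tsupport G ⊆ U →
        ∫ x in Ω, divergence G x = ∫ x, inner ℝ (outwardNormal Ω x) (G x) ∂μ := by
  obtain ⟨ρ, hρ⟩ := hΩ2 x₀ hx₀
  obtain ⟨r, hr, hball⟩ := exists_ball_of_isDefiningFunctionAt hΩ hρ
  obtain ⟨e, a, γ, hapos, ha, hge, hγ⟩ : ∃ (e : E n) (a : ℝ) (γ : hyperplane e → ℝ), 0 < a ∧
      ‖gradient ρ x₀‖ = a ∧ gradient ρ x₀ = a • e ∧ IsGraphChart Ω x₀ e r γ := by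
    obtain ⟨γ, hγ⟩ := exists_isGraphChart hρ (r := r) fun x hx =>
      ⟨(hball x hx).1, (hball x hx).2.1, (hball x hx).2.2.1, (hball x hx).2.2.2.1⟩
    have hpos := norm_pos_iff.2 hρ.gradient_ne_zero
    exact ⟨_, _, γ, hpos, rfl, by rw [smul_smul, mul_inv_cancel₀ hpos.ne', one_smul], hγ⟩
  rw [ha] at hball
  have hnorm := hγ.norm_axis
  obtain ⟨c, hc, hci⟩ := exists_integral_eq_iterated hnorm
  set U := frameCyl x₀ e r with hU
  have hUB : ∀ x ∈ U, x ∈ Metric.ball x₀ (3 * r) := fun x hx => frameCyl_subset_ball hnorm hx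
  -- `b` stays above `3a/4` on `U`, so the axis is transversal to every level set of `ρ` there and
  -- division by `b` is harmless.
  set b : E n → ℝ := fun x => inner ℝ (gradient ρ x) e with hb
  have hb1 : ∀ x ∈ U, 3 / 4 * a ≤ b x := by
    intro x hx
    have h1 := (hball x (hUB x hx)).2.1
    have h2 : b x = a + inner ℝ (gradient ρ x - gradient ρ x₀) e := by
      rw [inner_sub_left, hge, real_inner_smul_left, real_inner_self_eq_norm_sq, hnorm]
      simp only [hb]
      ring
    have h3 := abs_real_inner_le_norm (gradient ρ x - gradient ρ x₀) e
    rw [hnorm, mul_one] at h3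
    linarith [(abs_le.1 (h3.trans h1)).1]
  have hb0 : ∀ x ∈ U, 0 < b x := fun x hx => by linarith [hb1 x hx]
  have hg1 : ∀ x ∈ U, ‖gradient ρ x‖ ≤ 5 / 4 * a := by
    intro x hx
    have h1 := (hball x (hUB x hx)).2.1
    have h2 := norm_le_norm_add_norm_sub (gradient ρ x₀) (gradient ρ x)
    rw [norm_sub_rev] at h2
    linarith
  have hbg : ∀ x, b x ≤ ‖gradient ρ x‖ := fun x => by
    have := real_inner_le_norm (gradient ρ x) e
    rwa [hnorm, mul_one] at this
  have hgd : ∀ x ∈ U, ContDiffAt ℝ 1 (gradient ρ) x := fun x hx =>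
    contDiffAt_gradient (hball x (hUB x hx)).1
  have hbd : ∀ x ∈ U, ContDiffAt ℝ 1 b x := fun x hx =>
    (hgd x hx).inner ℝ contDiffAt_const
  -- At boundary points `‖∇ρ‖ / b = 1 / ⟨ν, e⟩` is the area factor of the graph and `c` is the
  -- Fubini constant; with this weight `θ ⟨ν, G⟩ = c ψ` for the `ψ` below. The bounds `c ≤ θ ≤ 2c`
  -- give the comparison with surface measure.
  set θ : E n → ℝ := fun x => c * (‖gradient ρ x‖ / b x) with hθ
  have hθc : ContinuousOn θ U := fun x hx =>
    (continuousAt_const.mul ((hgd x hx).continuousAt.norm.div (hbd x hx).continuousAt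
      (hb0 x hx).ne')).continuousWithinAt
  have hθ1 : ∀ x ∈ frontier Ω ∩ U, c ≤ θ x := fun x hx =>
    le_mul_of_one_le_right hc.le ((one_le_div (hb0 x hx.2)).2 (hbg x))
  have hθ2 : ∀ x ∈ frontier Ω ∩ U, θ x ≤ 2 * c := by
    intro x hx
    rw [mul_comm 2 c]
    refine mul_le_mul_of_nonneg_left ?_ hc.le
    rw [div_le_iff₀ (hb0 x hx.2)]
    linarith [hg1 x hx.2, hb1 x hx.2]
  set C : NNReal := max (Real.toNNReal (2 * c)) (Real.toNNReal (2 ^ (n - 1) / c)) with hC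
  have hle : graphMeasure x₀ e r γ θ ≤ C • surfaceMeasure Ω := by
    refine (hγ.graphMeasure_le hθ2).trans ?_
    refine Measure.le_iff.2 fun A _ => ?_
    simp only [Measure.smul_apply, ENNReal.smul_def, smul_eq_mul]
    gcongr
    exact ENNReal.coe_le_coe.2 (le_max_left _ _)
  have hac : graphMeasure x₀ e r γ θ ≪ surfaceMeasure Ω :=
    (Measure.absolutelyContinuous_of_le hle).trans (Measure.smul_absolutelyContinuous)
  refine ⟨U, isOpen_frameCyl _ _ _, mem_frameCyl_self hr, graphMeasure x₀ e r γ θ, C,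
    hγ.isFiniteMeasure_graphMeasure hθ2, hle, ?_, fun G hG hsupp => ?_⟩
  · refine (hγ.le_graphMeasure hc hθ1).trans ?_
    refine Measure.le_iff.2 fun A _ => ?_
    simp only [Measure.smul_apply, ENNReal.smul_def, smul_eq_mul]
    gcongr
    exact ENNReal.coe_le_coe.2 (le_max_right _ _)
  · set ψ : E n → ℝ := fun x => inner ℝ (gradient ρ x) (G x) / b x with hψ
    have hψ0 : ∀ x, G x = 0 → ψ x = 0 := fun x hx => by simp [hψ, hx]
    have hψs : tsupport ψ ⊆ U :=
      (closure_mono (Function.support_subset_iff'.2 fun x hx =>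
        hψ0 x (Function.notMem_support.1 hx))).trans hsupp
    have hψd : ContDiffOn ℝ 1 ψ (closure Ω) := contDiffOn_of_tsupport hψs fun x hx hxΩ =>
      (((hgd x hx).contDiffWithinAt.inner ℝ (hG x hxΩ)).div (hbd x hx).contDiffWithinAt
        (hb0 x hx).ne')
    have hψe : ContDiffOn ℝ 1 (fun x => ψ x • e) (closure Ω) := hψd.smul contDiffOn_const
    set H : E n → E n := fun x => G x - ψ x • e with hH
    have hHs : tsupport H ⊆ U :=
      (closure_mono (Function.support_subset_iff'.2 fun x hx => by
        have hx0 := Function.notMem_support.1 hx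
        simp [hH, hψ0 x hx0, hx0])).trans hsupp
    have hHd : ContDiffOn ℝ 1 H (closure Ω) := hG.sub hψe
    have htan : ∫ x in Ω, divergence H x = 0 := by
      refine setIntegral_divergence_eq_zero_of_tangential hΩ hΩb hΩ2 (U := U) (ρ := ρ)
        (fun x hx => (hball x (hUB x hx)).1) (fun x hx => (hball x (hUB x hx)).2.2.1)
        hHd hHs fun x hx _ => ?_
      simp only [hH, hψ]
      rw [inner_sub_right, real_inner_smul_right]
      have : inner ℝ (gradient ρ x) e = b x := rfl
      rw [this, div_mul_cancel₀ _ (hb0 x hx).ne', sub_self]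
    have hsplit : ∀ x ∈ Ω, divergence G x = divergence H x + fderiv ℝ ψ x e := by
      intro x hx
      have h1 := (contDiffAt_of_contDiffOn_closure hΩ hHd hx).differentiableAt one_ne_zero
      have h2 := (contDiffAt_of_contDiffOn_closure hΩ hψd hx).differentiableAt one_ne_zero
      have h3 : G = fun y => H y + ψ y • e := by funext y; simp [hH]
      have h4 := divergence_smul h2 (differentiableAt_const e)
      rw [h3, divergence_add h1 (h2.smul_const e), h4]
      simp [divergence]
    rw [setIntegral_congr_fun hΩ.measurableSet hsplit,
      integral_add (integrableOn_divergence hΩ hΩb hΩ2 hHd)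
        (integrableOn_fderiv_apply hΩ hΩb hΩ2 hψd e), htan, zero_add,
      setIntegral_fderiv_eq_graph hΩ hΩb hΩ2 hγ hci hψd hψs]
    have hmeas : AEStronglyMeasurable (fun x => inner ℝ (outwardNormal Ω x) (G x))
        (surfaceMeasure Ω) := aestronglyMeasurable_surfaceMeasure
      ((continuousOn_outwardNormal hΩ hΩ2).inner (hG.continuousOn.mono frontier_subset_closure))
    rw [hγ.integral_graphMeasure hθc (fun x hx => hc.le.trans (hθ1 x hx)) (hmeas.mono_ac hac),
      ← integral_const_mul]
    refine setIntegral_congr_fun Metric.isOpen_ball.measurableSet fun y hy => ?_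
    rw [mem_ball_zero_iff] at hy
    have hyf := hγ.mem_frontier hy
    have hyU := hγ.mem_frameCyl hy
    have hdef := (hball _ (hUB _ hyU)).2.2.2.2 hyf
    have hgpos := norm_pos_iff.2 hdef.gradient_ne_zero
    have hbpos := hb0 _ hyU
    simp only [hψ, hθ]
    rw [outwardNormal_eq hdef, real_inner_smul_left]
    field_simp

/-- At interior points `U = Ω` and `μ = 0` work: a field supported in `Ω` is `C¹` with compact
support in the whole space, and `Ω` does not meet its frontier. -/
theorem exists_local_divergence_measure (hΩ : IsOpen Ω) (hΩb : Bornology.IsBounded Ω)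
    (hΩ2 : HasC2Boundary Ω) (hx₀ : x₀ ∈ closure Ω) :
    ∃ U : Set (E n), IsOpen U ∧ x₀ ∈ U ∧ ∃ (μ : Measure (E n)) (C : NNReal),
      IsFiniteMeasure μ ∧ μ ≤ C • surfaceMeasure Ω ∧ (surfaceMeasure Ω).restrict U ≤ C • μ ∧
      ∀ G : E n → E n, ContDiffOn ℝ 1 G (closure Ω) → tsupport G ⊆ U →
        ∫ x in Ω, divergence G x = ∫ x, inner ℝ (outwardNormal Ω x) (G x) ∂μ := by
  by_cases hx : x₀ ∈ Ω
  · refine ⟨Ω, hΩ, hx, 0, 0, inferInstance, by simp, ?_, fun G hG hsupp => ?_⟩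
    · rw [surfaceMeasure, Measure.restrict_restrict hΩ.measurableSet, hΩ.inter_frontier_eq]
      simp
    · have hGd : ContDiff ℝ 1 G := contDiff_iff_contDiffAt.2 fun x => by
        by_cases hxs : x ∈ tsupport G
        · exact contDiffAt_of_contDiffOn_closure hΩ hG (hsupp hxs)
        · have h1 : G =ᶠ[𝓝 x] fun _ => 0 := notMem_tsupport_iff_eventuallyEq.1 hxs
          exact contDiffAt_const.congr_of_eventuallyEq h1
      have hGs : HasCompactSupport G :=
        hΩb.isCompact_closure.of_isClosed_subset (isClosed_tsupport G)
          (hsupp.trans subset_closure)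
      rw [integral_zero_measure, setIntegral_eq_integral_of_forall_compl_eq_zero,
        integral_divergence_eq_zero hGd hGs]
      exact fun x hx => divergence_eq_zero_of_notMem_tsupport fun h => hx (hsupp h)
  · exact exists_local_divergence_measure_boundary hΩ hΩb hΩ2
      (by rw [hΩ.frontier_eq]; exact ⟨hx₀, hx⟩)

end LocalMeasure

/-! ### The global Gauss-Green measure by a partition of unity. -/

section GlobalMeasure

variable {n : ℕ} {Ω : Set (E n)}

theorem divergence_sum {ι : Type*} [Fintype ι] {F : ι → E n → E n} {x : E n}
    (hF : ∀ i, DifferentiableAt ℝ (F i) x) :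
    divergence (fun y => ∑ i, F i y) x = ∑ i, divergence (F i) x := by
  simp only [divergence]
  rw [fderiv_fun_sum fun i _ => hF i, Finset.sum_comm]
  refine Finset.sum_congr rfl fun j _ => ?_
  simp

theorem integrable_surfaceMeasure_of_continuousOn [IsFiniteMeasure (surfaceMeasure Ω)]
    (hΩb : Bornology.IsBounded Ω) {F' : Type*} [NormedAddCommGroup F'] {f : E n → F'}
    (hf : ContinuousOn f (frontier Ω)) : Integrable f (surfaceMeasure Ω) := by
  have hK : IsCompact (frontier Ω) := hΩb.isCompact_closure.of_isClosed_subset isClosed_frontier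
    frontier_subset_closure
  obtain ⟨M, hM⟩ := hK.exists_bound_of_continuousOn hf
  rw [← surfaceMeasure_eq_restrict]
  exact integrableOn_of_continuousOn_of_bound isClosed_frontier.measurableSet
    (measure_lt_top _ _) hf hM

/-- The Gauss-Green formula on a bounded `C²` domain, for a measure comparable to the surface
measure. -/
theorem exists_divergence_measure (hΩ : IsOpen Ω) (hΩb : Bornology.IsBounded Ω)
    (hΩ2 : HasC2Boundary Ω) :
    ∃ (μ : Measure (E n)) (C : NNReal), IsFiniteMeasure μ ∧ IsFiniteMeasure (surfaceMeasure Ω) ∧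
      μ ≤ C • surfaceMeasure Ω ∧ surfaceMeasure Ω ≤ C • μ ∧
      ∀ G : E n → E n, ContDiffOn ℝ 1 G (closure Ω) →
        ∫ x in Ω, divergence G x = ∫ x, inner ℝ (outwardNormal Ω x) (G x) ∂μ := by
  choose! U hU hxU m C hfin hup hlow hGG using fun (x : E n) (hx : x ∈ closure Ω) =>
    exists_local_divergence_measure hΩ hΩb hΩ2 hx
  obtain ⟨t, ht⟩ := hΩb.isCompact_closure.elim_nhds_subcover' (fun x _ => U x)
    fun x hx => (hU x hx).mem_nhds (hxU x hx)
  have hcov : closure Ω ⊆ ⋃ i : t, U i := by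
    intro x hx
    obtain ⟨i, hi, hxi⟩ := mem_iUnion₂.1 (ht hx)
    exact mem_iUnion.2 ⟨⟨i, hi⟩, hxi⟩
  have hmem : ∀ i : t, ((i : closure Ω) : E n) ∈ closure Ω := fun i => i.1.2
  obtain ⟨f, hf⟩ := SmoothPartitionOfUnity.exists_isSubordinate
    (modelWithCornersSelf ℝ (E n)) isClosed_closure (fun i : t => U i)
    (fun i => hU _ (hmem i)) hcov
  set χ : t → E n → ℝ := fun i => f i with hχ
  have hχd : ∀ i, ContDiff ℝ 1 (χ i) := fun i =>
    ((f i).contMDiff.contDiff).of_le (by exact_mod_cast le_top)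
  have hχ0 : ∀ i x, 0 ≤ χ i x := fun i x => f.nonneg i x
  have hχ1 : ∀ i x, χ i x ≤ 1 := fun i x => f.le_one i x
  have hχs : ∀ i, tsupport (χ i) ⊆ U i := fun i => hf i
  have hsum : ∀ x ∈ closure Ω, ∑ i, χ i x = 1 := by
    intro x hx
    rw [← finsum_eq_sum_of_fintype]
    exact f.sum_eq_one hx
  have hmeasχ : ∀ i, Measurable fun x => ENNReal.ofReal (χ i x) := fun i =>
    (hχd i).continuous.measurable.ennreal_ofReal
  -- Weighting each local measure by `χ i` turns the local formula for `χ i • G` into a formula for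
  -- `G`.
  set w : t → Measure (E n) := fun i => (m i).withDensity fun x => ENNReal.ofReal (χ i x) with hw
  have hwm : ∀ i, w i ≤ m i := by
    intro i
    refine (withDensity_mono (g := fun _ => 1) (Eventually.of_forall fun x => ?_)).trans ?_
    · simpa using hχ1 i x
    · change (m i).withDensity 1 ≤ m i
      rw [withDensity_one]
  have hwfin : ∀ i, IsFiniteMeasure (w i) := fun i =>
    have := hfin _ (hmem i)
    isFiniteMeasure_of_le _ (hwm i)
  set μ : Measure (E n) := ∑ i, w i with hμ
  set K : NNReal := ∑ i : t, C i with hK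
  have hCK : ∀ i : t, C i ≤ K := fun i =>
    Finset.single_le_sum (f := fun i : t => C i) (fun _ _ => zero_le) (Finset.mem_univ i)
  have hμfin : IsFiniteMeasure μ := by
    refine ⟨?_⟩
    rw [hμ, Measure.finsetSum_apply]
    exact ENNReal.sum_lt_top.2 fun i _ => measure_lt_top _ _
  have hupper : μ ≤ K • surfaceMeasure Ω := by
    refine Measure.le_iff.2 fun A _ => ?_
    rw [hμ, Measure.finsetSum_apply, Measure.smul_apply, ENNReal.smul_def, smul_eq_mul, hK,
      ENNReal.ofNNReal_finsetSum, Finset.sum_mul]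
    exact Finset.sum_le_sum fun i _ => ((hwm i).trans (hup _ (hmem i))) A
  -- The surface measure is the sum of its pieces with density `χ i`. Each piece lives in `U i`,
  -- where the surface measure is at most `C i • m i`.
  have hlower : surfaceMeasure Ω ≤ K • μ := by
    refine Measure.le_iff.2 fun A hA => ?_
    have h1 : surfaceMeasure Ω A = ∑ i, ∫⁻ x in A, ENNReal.ofReal (χ i x) ∂(surfaceMeasure Ω) := by
      rw [← lintegral_finsetSum _ fun i _ => hmeasχ i, ← setLIntegral_one]
      refine lintegral_congr_ae (ae_restrict_of_ae ?_)
      rw [← surfaceMeasure_eq_restrict]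
      refine (ae_restrict_iff' isClosed_frontier.measurableSet).2 (Eventually.of_forall fun x hx => ?_)
      beta_reduce
      rw [← ENNReal.ofReal_sum_of_nonneg fun i _ => hχ0 i x,
        hsum x (frontier_subset_closure hx), ENNReal.ofReal_one]
    rw [h1, Measure.smul_apply, hμ, Measure.finsetSum_apply, ENNReal.smul_def, smul_eq_mul,
      Finset.mul_sum]
    refine Finset.sum_le_sum fun i _ => ?_
    have h2 : ∫⁻ x in A, ENNReal.ofReal (χ i x) ∂(surfaceMeasure Ω) =
        ∫⁻ x in A, ENNReal.ofReal (χ i x) ∂((surfaceMeasure Ω).restrict (U i)) := by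
      rw [Measure.restrict_restrict hA, inter_comm,
        ← Measure.restrict_restrict (hU _ (hmem i)).measurableSet,
        ← lintegral_indicator (hU _ (hmem i)).measurableSet]
      congr 1
      funext x
      by_cases hx : x ∈ U i
      · rw [indicator_of_mem hx]
      · rw [indicator_of_notMem hx, image_eq_zero_of_notMem_tsupport fun h => hx (hχs i h),
          ENNReal.ofReal_zero]
    rw [h2, hw, withDensity_apply _ hA]
    calc ∫⁻ x in A, ENNReal.ofReal (χ i x) ∂((surfaceMeasure Ω).restrict (U i))
        ≤ ∫⁻ x in A, ENNReal.ofReal (χ i x) ∂(C i • m i) :=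
          lintegral_mono' (Measure.restrict_mono_measure (hlow _ (hmem i)) A) le_rfl
      _ = C i * ∫⁻ x in A, ENNReal.ofReal (χ i x) ∂(m i) := by
          rw [Measure.restrict_smul, lintegral_smul_measure]
          rfl
      _ ≤ _ := by
          gcongr
          exact hCK i
  -- Finiteness of the surface measure is a by-product of the lower comparison.
  have hσfin : IsFiniteMeasure (surfaceMeasure Ω) := isFiniteMeasure_of_le _ hlower
  refine ⟨μ, K, hμfin, hσfin, hupper, hlower, fun G hG => ?_⟩
  have hcG : ContinuousOn (fun x => inner ℝ (outwardNormal Ω x) (G x)) (frontier Ω) :=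
    (continuousOn_outwardNormal hΩ hΩ2).inner (hG.continuousOn.mono frontier_subset_closure)
  have hiσ := integrable_surfaceMeasure_of_continuousOn hΩb hcG
  have hiw : ∀ i, Integrable (fun x => inner ℝ (outwardNormal Ω x) (G x)) (w i) := fun i =>
    hiσ.of_measure_le_smul (c := C i) (by simp) ((hwm i).trans (hup _ (hmem i)))
  rw [hμ, integral_finsetSum_measure fun i _ => hiw i]
  have hχG : ∀ i, ContDiffOn ℝ 1 (fun x => χ i x • G x) (closure Ω) := fun i =>
    (hχd i).contDiffOn.smul hG
  have hdiv : ∀ x ∈ Ω, divergence G x = ∑ i, divergence (fun y => χ i y • G y) x := by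
    intro x hx
    rw [← divergence_sum fun i =>
      (contDiffAt_of_contDiffOn_closure hΩ (hχG i) hx).differentiableAt one_ne_zero]
    refine divergence_congr ?_
    filter_upwards [hΩ.mem_nhds hx] with y hy
    rw [← Finset.sum_smul, hsum y (subset_closure hy), one_smul]
  rw [setIntegral_congr_fun hΩ.measurableSet hdiv,
    integral_finsetSum _ fun i _ => integrableOn_divergence hΩ hΩb hΩ2 (hχG i)]
  refine Finset.sum_congr rfl fun i _ => ?_
  rw [hGG _ (hmem i) _ (hχG i) ((closure_mono (Function.support_smul_subset_left _ _)).trans (hχs i)),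
    hw, integral_withDensity_eq_integral_toReal_smul (hmeasχ i) (by simp)]
  refine integral_congr_ae (Eventually.of_forall fun x => ?_)
  simp only [smul_eq_mul]
  rw [ENNReal.toReal_ofReal (hχ0 i x), real_inner_smul_right]

end GlobalMeasure

/-! ### Integration by parts in time and in space on the cylinder. -/

section Cylinder

variable {n : ℕ} {Ω : Set (E n)} {T : ℝ}
  {F' : Type*} [NormedAddCommGroup F'] [NormedSpace ℝ F']

theorem isOpen_cyl (hΩ : IsOpen Ω) : IsOpen (cyl T Ω) := isOpen_Ioo.prod hΩ

theorem cyl_subset_closedCyl : cyl T Ω ⊆ closedCyl T Ω :=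
  prod_mono Ioo_subset_Icc_self subset_closure

theorem lateral_subset_closedCyl : lateral T Ω ⊆ closedCyl T Ω :=
  prod_mono Ioo_subset_Icc_self frontier_subset_closure

theorem closedCyl_mem_nhds (hΩ : IsOpen Ω) {p : ℝ × E n} (hp : p ∈ cyl T Ω) :
    closedCyl T Ω ∈ 𝓝 p :=
  mem_of_superset ((isOpen_cyl hΩ).mem_nhds hp) cyl_subset_closedCyl

theorem isCompact_closedCyl (hΩb : Bornology.IsBounded Ω) : IsCompact (closedCyl T Ω) :=
  isCompact_Icc.prod hΩb.isCompact_closure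

theorem dirDeriv_eq_fderiv (hΩ : IsOpen Ω) {p w : ℝ × E n} (hp : p ∈ cyl T Ω)
    (f : ℝ × E n → F') : dirDeriv T Ω w f p = fderiv ℝ f p w := by
  rw [dirDeriv, fderivWithin_of_mem_nhds (closedCyl_mem_nhds hΩ hp)]

theorem contDiffOn_dirDeriv (hK : UniqueDiffOn ℝ (closedCyl T Ω)) {f : ℝ × E n → F'}
    (hf : ContDiffOn ℝ 2 f (closedCyl T Ω)) (w : ℝ × E n) :
    ContDiffOn ℝ 1 (dirDeriv T Ω w f) (closedCyl T Ω) :=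
  (hf.fderivWithin hK (by norm_num)).clm_apply contDiffOn_const

theorem continuousOn_dirDeriv (hK : UniqueDiffOn ℝ (closedCyl T Ω)) {f : ℝ × E n → F'}
    (hf : ContDiffOn ℝ 1 f (closedCyl T Ω)) (w : ℝ × E n) :
    ContinuousOn (dirDeriv T Ω w f) (closedCyl T Ω) :=
  (hf.continuousOn_fderivWithin hK le_rfl).clm_apply continuousOn_const

theorem integrableOn_cyl (hΩb : Bornology.IsBounded Ω) {G : Type*} [NormedAddCommGroup G]
    {f : ℝ × E n → G} (hf : ContinuousOn f (closedCyl T Ω)) : IntegrableOn f (cyl T Ω) :=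
  (hf.integrableOn_compact (isCompact_closedCyl hΩb)).mono_set cyl_subset_closedCyl

theorem volume_restrict_cyl : (volume : Measure (ℝ × E n)).restrict (cyl T Ω) =
    (volume.restrict (Ioo 0 T)).prod (volume.restrict Ω) := by
  rw [Measure.volume_eq_prod, Measure.prod_restrict, cyl]

/-- The fundamental theorem of calculus in time on the cylinder. -/
theorem setIntegral_timeDeriv (hΩ : IsOpen Ω) (hΩb : Bornology.IsBounded Ω)
    (hΩ2 : HasC2Boundary Ω) (hT : 0 < T) {f : ℝ × E n → ℝ}
    (hf : ContDiffOn ℝ 1 f (closedCyl T Ω)) :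
    ∫ p in cyl T Ω, timeDeriv T Ω f p = ∫ x in Ω, (f (T, x) - f (0, x)) := by
  have hK := uniqueDiffOn_closedCyl hΩ hΩ2 hT
  have hc := continuousOn_dirDeriv hK hf (1, 0)
  have hint : IntegrableOn (timeDeriv T Ω f) (cyl T Ω) := integrableOn_cyl hΩb hc
  rw [IntegrableOn, volume_restrict_cyl] at hint
  rw [volume_restrict_cyl, integral_prod_symm _ hint]
  refine setIntegral_congr_fun hΩ.measurableSet fun x hx => ?_
  have hxc := subset_closure hx
  have hmaps : MapsTo (fun t : ℝ => (t, x)) (Icc 0 T) (closedCyl T Ω) := fun t ht => ⟨ht, hxc⟩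
  have hcont : Continuous fun t : ℝ => (t, x) := by fun_prop
  have hder : ∀ t ∈ Ioo 0 T, HasDerivAt (fun t => f (t, x)) (timeDeriv T Ω f (t, x)) t := by
    intro t ht
    have hp : (t, x) ∈ cyl T Ω := ⟨ht, hx⟩
    have h1 : HasFDerivAt f (fderiv ℝ f (t, x)) (t, x) :=
      ((hf.contDiffAt (closedCyl_mem_nhds hΩ hp)).differentiableAt one_ne_zero).hasFDerivAt
    have h2 : HasDerivAt (fun t : ℝ => (t, x)) ((1 : ℝ), (0 : E n)) t :=
      (hasDerivAt_id t).prodMk (hasDerivAt_const t x)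
    rw [timeDeriv, dirDeriv_eq_fderiv hΩ hp]
    exact h1.comp_hasDerivAt t h2
  have hii : IntervalIntegrable (fun t => timeDeriv T Ω f (t, x)) volume 0 T := by
    refine ContinuousOn.intervalIntegrable ?_
    rw [uIcc_of_le hT.le]
    exact hc.comp hcont.continuousOn hmaps
  have := intervalIntegral.integral_eq_sub_of_hasDerivAt_of_le hT.le
    (hf.continuousOn.comp hcont.continuousOn hmaps) hder hii
  rw [← integral_Ioc_eq_integral_Ioo, ← intervalIntegral.integral_of_le hT.le, this]
  rfl

theorem ae_mem_prod_of_ae {α β : Type*} [MeasurableSpace α] [MeasurableSpace β]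
    {κ : Measure α} {μ : Measure β} [SFinite κ] [SFinite μ] {A : Set α} {B : Set β}
    (hA : ∀ᵐ a ∂κ, a ∈ A) (hB : ∀ᵐ b ∂μ, b ∈ B) : ∀ᵐ p ∂(κ.prod μ), p ∈ A ×ˢ B := by
  filter_upwards [Measure.quasiMeasurePreserving_fst.ae hA,
    Measure.quasiMeasurePreserving_snd.ae hB] with p h1 h2 using ⟨h1, h2⟩

/-- The divergence theorem in space on the cylinder. -/
theorem setIntegral_sum_spaceDeriv (hΩ : IsOpen Ω) (hΩb : Bornology.IsBounded Ω)
    (hΩ2 : HasC2Boundary Ω) (hT : 0 < T) {μ : Measure (E n)} [IsFiniteMeasure μ]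
    (hμ : ∀ᵐ x ∂μ, x ∈ frontier Ω)
    (hGG : ∀ G : E n → E n, ContDiffOn ℝ 1 G (closure Ω) →
        ∫ x in Ω, divergence G x = ∫ x, inner ℝ (outwardNormal Ω x) (G x) ∂μ)
    {F : Fin n → ℝ × E n → ℝ} (hF : ∀ i, ContDiffOn ℝ 1 (F i) (closedCyl T Ω)) :
    ∫ p in cyl T Ω, ∑ i, spaceDeriv T Ω i (F i) p =
      ∫ p, ∑ i, outwardNormal Ω p.2 i * F i p ∂((volume.restrict (Ioo 0 T)).prod μ) := by
  have hK := uniqueDiffOn_closedCyl hΩ hΩ2 hT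
  have hint : IntegrableOn (fun p => ∑ i, spaceDeriv T Ω i (F i) p) (cyl T Ω) :=
    integrableOn_cyl hΩb (continuousOn_finsetSum _ fun i _ => continuousOn_dirDeriv hK (hF i) _)
  rw [IntegrableOn, volume_restrict_cyl] at hint
  -- The closed time interval makes the lateral set compact, so continuity of the flux there gives
  -- integrability.
  have hlat : ∀ᵐ p ∂((volume.restrict (Ioo 0 T)).prod μ), p ∈ Icc 0 T ×ˢ frontier Ω :=
    ae_mem_prod_of_ae ((ae_restrict_iff' measurableSet_Ioo).2
      (Eventually.of_forall fun t ht => Ioo_subset_Icc_self ht)) hμ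
  have hcS : ContinuousOn (fun p : ℝ × E n => ∑ i, outwardNormal Ω p.2 i * F i p)
      (Icc 0 T ×ˢ frontier Ω) := by
    refine continuousOn_finsetSum _ fun i _ => ContinuousOn.mul ?_ ?_
    · have h1 : ContinuousOn (fun p : ℝ × E n => outwardNormal Ω p.2) (Icc 0 T ×ˢ frontier Ω) :=
        (continuousOn_outwardNormal hΩ hΩ2).comp continuousOn_snd fun p hp => hp.2
      exact (EuclideanSpace.proj i : E n →L[ℝ] ℝ).continuous.comp_continuousOn h1
    · exact (hF i).continuousOn.mono (prod_mono_right frontier_subset_closure)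
  have hSc : IsCompact (Icc 0 T ×ˢ frontier Ω) :=
    isCompact_Icc.prod (hΩb.isCompact_closure.of_isClosed_subset isClosed_frontier
      frontier_subset_closure)
  have hintS : Integrable (fun p : ℝ × E n => ∑ i, outwardNormal Ω p.2 i * F i p)
      ((volume.restrict (Ioo 0 T)).prod μ) := by
    rw [← Measure.restrict_eq_self_of_ae_mem hlat]
    exact hcS.integrableOn_compact hSc
  rw [volume_restrict_cyl, integral_prod _ hint, integral_prod _ hintS]
  refine setIntegral_congr_fun measurableSet_Ioo fun t ht => ?_
  have hmaps : MapsTo (fun x : E n => (t, x)) (closure Ω) (closedCyl T Ω) := fun x hx =>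
    ⟨Ioo_subset_Icc_self ht, hx⟩
  have hGd : ContDiffOn ℝ 1 (fun x => WithLp.toLp 2 fun i => F i (t, x) : E n → E n)
      (closure Ω) := by
    refine contDiffOn_euclidean.2 fun i => ?_
    exact (hF i).comp (f := fun x : E n => (t, x)) (by fun_prop) hmaps
  have hflux : ∫ x, inner ℝ (outwardNormal Ω x) (WithLp.toLp 2 fun i => F i (t, x) : E n) ∂μ =
      ∫ x, ∑ i, outwardNormal Ω x i * F i (t, x) ∂μ := by
    refine integral_congr_ae (Eventually.of_forall fun x => ?_)
    simp only [PiLp.inner_apply]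
    refine Finset.sum_congr rfl fun i _ => ?_
    simp [mul_comm]
  refine Eq.trans ?_ ((hGG _ hGd).trans hflux)
  refine setIntegral_congr_fun hΩ.measurableSet fun x hx => ?_
  have hp : (t, x) ∈ cyl T Ω := ⟨ht, hx⟩
  refine Finset.sum_congr rfl fun i _ => ?_
  rw [spaceDeriv, dirDeriv_eq_fderiv hΩ hp]
  have h1 : HasFDerivAt (F i) (fderiv ℝ (F i) (t, x)) (t, x) :=
    (((hF i).contDiffAt (closedCyl_mem_nhds hΩ hp)).differentiableAt one_ne_zero).hasFDerivAt
  have h2 : HasFDerivAt (fun x : E n => (t, x)) (ContinuousLinearMap.inr ℝ ℝ (E n)) x :=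
    hasFDerivAt_prodMk_right t x
  have h3 := h1.comp x h2
  have h4 := (EuclideanSpace.proj i : E n →L[ℝ] ℝ).hasFDerivAt.comp x
    ((contDiffAt_of_contDiffOn_closure hΩ hGd hx).differentiableAt one_ne_zero).hasFDerivAt
  have h5 := congrArg (fun L : E n →L[ℝ] ℝ => L (EuclideanSpace.single i 1)) (h3.unique h4)
  simpa using h5

end Cylinder

/-! ### Product and linearity rules for one-sided directional derivatives. -/

section Calculus

variable {n : ℕ} {Ω : Set (E n)} {T : ℝ} {p w : ℝ × E n}
  {F' : Type*} [NormedAddCommGroup F'] [NormedSpace ℝ F']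
  {H : Type*} [NormedAddCommGroup H] [InnerProductSpace ℝ H]

theorem dirDeriv_congr {f g : ℝ × E n → F'} (h : EqOn f g (closedCyl T Ω))
    (hp : p ∈ closedCyl T Ω) : dirDeriv T Ω w f p = dirDeriv T Ω w g p := by
  rw [dirDeriv, dirDeriv, fderivWithin_congr h (h hp)]

theorem dirDeriv_inner (hK : UniqueDiffOn ℝ (closedCyl T Ω)) (hp : p ∈ closedCyl T Ω)
    {f g : ℝ × E n → H} (hf : ContDiffOn ℝ 1 f (closedCyl T Ω))
    (hg : ContDiffOn ℝ 1 g (closedCyl T Ω)) :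
    dirDeriv T Ω w (fun p => inner ℝ (f p) (g p)) p =
      inner ℝ (f p) (dirDeriv T Ω w g p) + inner ℝ (dirDeriv T Ω w f p) (g p) := by
  have h := ((hf.differentiableOn one_ne_zero p hp).hasFDerivWithinAt.inner ℝ
    (hg.differentiableOn one_ne_zero p hp).hasFDerivWithinAt).fderivWithin (hK p hp)
  rw [dirDeriv, h]
  rfl

theorem dirDeriv_smul (hK : UniqueDiffOn ℝ (closedCyl T Ω)) (hp : p ∈ closedCyl T Ω)
    {f : ℝ × E n → ℝ} {g : ℝ × E n → F'} (hf : ContDiffOn ℝ 1 f (closedCyl T Ω))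
    (hg : ContDiffOn ℝ 1 g (closedCyl T Ω)) :
    dirDeriv T Ω w (fun p => f p • g p) p =
      f p • dirDeriv T Ω w g p + dirDeriv T Ω w f p • g p := by
  rw [dirDeriv, fderivWithin_fun_smul (hK p hp) (hf.differentiableOn one_ne_zero p hp)
    (hg.differentiableOn one_ne_zero p hp)]
  simp [dirDeriv]

theorem dirDeriv_add (hK : UniqueDiffOn ℝ (closedCyl T Ω)) (hp : p ∈ closedCyl T Ω)
    {f g : ℝ × E n → F'} (hf : ContDiffOn ℝ 1 f (closedCyl T Ω))
    (hg : ContDiffOn ℝ 1 g (closedCyl T Ω)) :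
    dirDeriv T Ω w (fun p => f p + g p) p = dirDeriv T Ω w f p + dirDeriv T Ω w g p := by
  rw [dirDeriv, fderivWithin_fun_add (hK p hp) (hf.differentiableOn one_ne_zero p hp)
    (hg.differentiableOn one_ne_zero p hp)]
  rfl

theorem dirDeriv_sub (hK : UniqueDiffOn ℝ (closedCyl T Ω)) (hp : p ∈ closedCyl T Ω)
    {f g : ℝ × E n → F'} (hf : ContDiffOn ℝ 1 f (closedCyl T Ω))
    (hg : ContDiffOn ℝ 1 g (closedCyl T Ω)) :
    dirDeriv T Ω w (fun p => f p - g p) p = dirDeriv T Ω w f p - dirDeriv T Ω w g p := by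
  rw [dirDeriv, fderivWithin_fun_sub (hK p hp) (hf.differentiableOn one_ne_zero p hp)
    (hg.differentiableOn one_ne_zero p hp)]
  rfl

theorem dirDeriv_const_smul (hK : UniqueDiffOn ℝ (closedCyl T Ω)) (hp : p ∈ closedCyl T Ω)
    {g : ℝ × E n → F'} (hg : ContDiffOn ℝ 1 g (closedCyl T Ω)) (c : ℝ) :
    dirDeriv T Ω w (fun p => c • g p) p = c • dirDeriv T Ω w g p := by
  rw [dirDeriv, fderivWithin_fun_const_smul (hK p hp) (hg.differentiableOn one_ne_zero p hp)]
  rfl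

theorem dirDeriv_sum (hK : UniqueDiffOn ℝ (closedCyl T Ω)) (hp : p ∈ closedCyl T Ω)
    {ι : Type*} [Fintype ι] {g : ι → ℝ × E n → F'}
    (hg : ∀ i, ContDiffOn ℝ 1 (g i) (closedCyl T Ω)) :
    dirDeriv T Ω w (fun p => ∑ i, g i p) p = ∑ i, dirDeriv T Ω w (g i) p := by
  rw [dirDeriv, fderivWithin_fun_sum (hK p hp) fun i _ => hg i |>.differentiableOn one_ne_zero p hp]
  simp [dirDeriv]

theorem sum_smul_spaceDeriv (f : ℝ × E n → F') (p : ℝ × E n) (v : E n) :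
    ∑ i, v i • spaceDeriv T Ω i f p = dirDeriv T Ω (0, v) f p := by
  have h : ((0 : ℝ), v) = ∑ i, v i • ((0 : ℝ), (EuclideanSpace.single i (1 : ℝ) : E n)) := by
    refine Prod.ext ?_ ?_
    · rw [Prod.fst_sum]
      simp
    · rw [Prod.snd_sum]
      exact (sum_smul_single v).symm
  simp only [spaceDeriv, dirDeriv]
  rw [h, map_sum]
  exact Finset.sum_congr rfl fun i _ => (map_smul _ _ _).symm

/-- In the open cylinder one-sided derivatives are ordinary ones, also in a neighbourhood of `p`, so
this is the symmetry of the second derivative. -/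
theorem dirDeriv_comm (hΩ : IsOpen Ω) {f : ℝ × E n → F'}
    (hf : ContDiffOn ℝ 2 f (closedCyl T Ω)) (hp : p ∈ cyl T Ω) (w w' : ℝ × E n) :
    dirDeriv T Ω w (dirDeriv T Ω w' f) p = dirDeriv T Ω w' (dirDeriv T Ω w f) p := by
  have hsymm : IsSymmSndFDerivAt ℝ f p :=
    (hf.contDiffAt (closedCyl_mem_nhds hΩ hp)).isSymmSndFDerivAt (by simp)
  have key : ∀ a b : ℝ × E n, dirDeriv T Ω a (dirDeriv T Ω b f) p = fderiv ℝ (fderiv ℝ f) p a b := by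
    intro a b
    have h1 : dirDeriv T Ω b f =ᶠ[𝓝 p] fun z => fderiv ℝ f z b := by
      filter_upwards [(isOpen_cyl hΩ).mem_nhds hp] with z hz using dirDeriv_eq_fderiv hΩ hz f
    have h2 : DifferentiableAt ℝ (fderiv ℝ f) p :=
      ((hf.contDiffAt (closedCyl_mem_nhds hΩ hp)).fderiv_right (m := 1)
        (by norm_num)).differentiableAt one_ne_zero
    rw [dirDeriv_eq_fderiv hΩ hp, h1.fderiv_eq,
      fderiv_clm_apply h2 (differentiableAt_const b)]
    simp
  rw [key, key, hsymm]

end Calculus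

/-! ### The energy identity for the multiplier `∂_t - ω·∇`. -/

section Energy

variable {n : ℕ} {Ω : Set (E n)} {T : ℝ} {p : ℝ × E n}
  {H : Type*} [NormedAddCommGroup H] [InnerProductSpace ℝ H]

/-- The density of the energy of `v` along the field `∂_t - ω·∇`. -/
noncomputable def energyDensity (T : ℝ) (Ω : Set (E n)) (ω : E n) (v : ℝ × E n → H)
    (p : ℝ × E n) : ℝ :=
  (1 / 2 : ℝ) • inner ℝ (timeDeriv T Ω v p) (timeDeriv T Ω v p)
    + (1 / 2 : ℝ) • (∑ j, inner ℝ (spaceDeriv T Ω j v p) (spaceDeriv T Ω j v p))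
    - inner ℝ (timeDeriv T Ω v p) (dirDeriv T Ω (0, ω) v p)

/-- The `i`-th component of the flux of the energy of `v` along the field `∂_t - ω·∇`. -/
noncomputable def energyFlux (T : ℝ) (Ω : Set (E n)) (ω : E n) (v : ℝ × E n → H) (i : Fin n)
    (p : ℝ × E n) : ℝ :=
  (inner ℝ (spaceDeriv T Ω i v p) (dirDeriv T Ω (0, ω) v p)
    - inner ℝ (spaceDeriv T Ω i v p) (timeDeriv T Ω v p))
    + (ω i / 2) • (inner ℝ (timeDeriv T Ω v p) (timeDeriv T Ω v p)
    - ∑ j, inner ℝ (spaceDeriv T Ω j v p) (spaceDeriv T Ω j v p))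

variable {v : ℝ × E n → H} {ω : E n}

theorem contDiffOn_const_smul {S : Set (ℝ × E n)} {f : ℝ × E n → ℝ} (hf : ContDiffOn ℝ 1 f S)
    (c : ℝ) : ContDiffOn ℝ 1 (fun p => c • f p) S :=
  (contDiffOn_const (c := c)).smul hf

theorem contDiffOn_energyDensity (hK : UniqueDiffOn ℝ (closedCyl T Ω))
    (hv : ContDiffOn ℝ 2 v (closedCyl T Ω)) :
    ContDiffOn ℝ 1 (energyDensity T Ω ω v) (closedCyl T Ω) := by
  have h : ∀ w, ContDiffOn ℝ 1 (dirDeriv T Ω w v) (closedCyl T Ω) := contDiffOn_dirDeriv hK hv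
  exact ((contDiffOn_const_smul ((h _).inner ℝ (h _)) _).add
    (contDiffOn_const_smul (ContDiffOn.sum fun j _ => (h _).inner ℝ (h _)) _)).sub
      ((h _).inner ℝ (h _))

theorem contDiffOn_energyFlux (hK : UniqueDiffOn ℝ (closedCyl T Ω))
    (hv : ContDiffOn ℝ 2 v (closedCyl T Ω)) (i : Fin n) :
    ContDiffOn ℝ 1 (energyFlux T Ω ω v i) (closedCyl T Ω) := by
  have h : ∀ w, ContDiffOn ℝ 1 (dirDeriv T Ω w v) (closedCyl T Ω) := contDiffOn_dirDeriv hK hv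
  exact (((h _).inner ℝ (h _)).sub ((h _).inner ℝ (h _))).add
    (contDiffOn_const_smul (((h _).inner ℝ (h _)).sub
      (ContDiffOn.sum fun j _ => (h _).inner ℝ (h _))) _)

theorem dirDeriv_inner_self (hK : UniqueDiffOn ℝ (closedCyl T Ω)) (hp : p ∈ closedCyl T Ω)
    {w : ℝ × E n} {f : ℝ × E n → H} (hf : ContDiffOn ℝ 1 f (closedCyl T Ω)) :
    dirDeriv T Ω w (fun p => inner ℝ (f p) (f p)) p = 2 * inner ℝ (dirDeriv T Ω w f p) (f p) := by
  rw [dirDeriv_inner hK hp hf hf, real_inner_comm]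
  ring

/-- The wave operator is invariant under translations and the multiplier is a constant vector field,
so Noether's identity has no bulk remainder. The proof expands by the product rule and cancels the
mixed second derivatives by symmetry. -/
theorem inner_box_eq_divergence (hΩ : IsOpen Ω) (hK : UniqueDiffOn ℝ (closedCyl T Ω))
    (hv : ContDiffOn ℝ 2 v (closedCyl T Ω)) (hp : p ∈ cyl T Ω) :
    inner ℝ (box T Ω v p) (timeDeriv T Ω v p - dirDeriv T Ω (0, ω) v p) =
      timeDeriv T Ω (energyDensity T Ω ω v) p
        + ∑ i, spaceDeriv T Ω i (energyFlux T Ω ω v i) p := by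
  have hpK := cyl_subset_closedCyl hp
  have h : ∀ w, ContDiffOn ℝ 1 (dirDeriv T Ω w v) (closedCyl T Ω) := contDiffOn_dirDeriv hK hv
  have hi : ∀ w w', ContDiffOn ℝ 1
      (fun p => inner ℝ (dirDeriv T Ω w v p) (dirDeriv T Ω w' v p)) (closedCyl T Ω) :=
    fun w w' => (h w).inner ℝ (h w')
  set t : ℝ × E n := (1, 0) with ht
  set s : Fin n → ℝ × E n := fun i => (0, EuclideanSpace.single i 1) with hs
  set o : ℝ × E n := (0, ω) with ho
  set D : (ℝ × E n) → (ℝ × E n) → H := fun a b => dirDeriv T Ω a (dirDeriv T Ω b v) p with hD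
  set d : (ℝ × E n) → H := fun a => dirDeriv T Ω a v p with hd
  have hcomm : ∀ a b, D a b = D b a := fun a b => dirDeriv_comm hΩ hv hp a b
  have hin : ∀ a b c, dirDeriv T Ω a
      (fun p => inner ℝ (dirDeriv T Ω b v p) (dirDeriv T Ω c v p)) p =
      inner ℝ (d b) (D a c) + inner ℝ (D a b) (d c) := fun a b c =>
    dirDeriv_inner hK hpK (h b) (h c)
  have hself : ∀ a b, dirDeriv T Ω a
      (fun p => inner ℝ (dirDeriv T Ω b v p) (dirDeriv T Ω b v p)) p =
      2 * inner ℝ (D a b) (d b) := fun a b => dirDeriv_inner_self hK hpK (h b)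
  have hsumc : ContDiffOn ℝ 1
      (fun p => ∑ j, inner ℝ (dirDeriv T Ω (s j) v p) (dirDeriv T Ω (s j) v p)) (closedCyl T Ω) :=
    ContDiffOn.sum fun j _ => hi _ _
  have hsumd : ∀ a, dirDeriv T Ω a
      (fun p => ∑ j, inner ℝ (dirDeriv T Ω (s j) v p) (dirDeriv T Ω (s j) v p)) p =
      2 * ∑ j, inner ℝ (D a (s j)) (d (s j)) := by
    intro a
    rw [dirDeriv_sum hK hpK fun j => hi (s j) (s j), Finset.mul_sum]
    exact Finset.sum_congr rfl fun j _ => hself a (s j)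
  have hE : timeDeriv T Ω (energyDensity T Ω ω v) p =
      inner ℝ (D t t) (d t) + ∑ j, inner ℝ (D t (s j)) (d (s j))
        - (inner ℝ (d t) (D t o) + inner ℝ (D t t) (d o)) := by
    have h1 := dirDeriv_sub (w := t) hK hpK
      ((contDiffOn_const_smul (hi t t) (1 / 2)).add
        (contDiffOn_const_smul hsumc (1 / 2))) (hi t o)
    have h2 := dirDeriv_add (w := t) hK hpK
      (contDiffOn_const_smul (hi t t) (1 / 2))
        (contDiffOn_const_smul hsumc (1 / 2))
    rw [h2, dirDeriv_const_smul hK hpK (hi t t), dirDeriv_const_smul hK hpK hsumc, hself, hsumd,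
      hin] at h1
    refine h1.trans ?_
    simp only [smul_eq_mul]
    ring
  have hF : ∀ i, spaceDeriv T Ω i (energyFlux T Ω ω v i) p =
      (inner ℝ (d (s i)) (D (s i) o) + inner ℝ (D (s i) (s i)) (d o))
      - (inner ℝ (d (s i)) (D (s i) t) + inner ℝ (D (s i) (s i)) (d t))
      + (ω i * inner ℝ (D (s i) t) (d t) - ∑ j, ω i * inner ℝ (D (s i) (s j)) (d (s j))) := by
    intro i
    have h1 := dirDeriv_add (w := s i) hK hpK ((hi (s i) o).sub (hi (s i) t))
      (contDiffOn_const_smul ((hi t t).sub hsumc) (ω i / 2))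
    rw [dirDeriv_const_smul hK hpK ((hi t t).sub hsumc), dirDeriv_sub hK hpK (hi _ _) (hi _ _),
      dirDeriv_sub hK hpK (hi _ _) hsumc, hself, hsumd, hin, hin] at h1
    refine h1.trans ?_
    rw [← Finset.mul_sum]
    simp only [smul_eq_mul]
    ring
  -- Contraction of the coordinate derivatives with `ω` recovers the derivative along `(0, ω)`; this
  -- and the next identity match the flux terms carrying the factor `ω i` with the remaining ones.
  have hω1 : ∑ i, ω i * inner ℝ (D (s i) t) (d t) = inner ℝ (D t o) (d t) := by
    rw [hcomm t o]
    have h1 : D o t = ∑ i, ω i • D (s i) t := (sum_smul_spaceDeriv (dirDeriv T Ω t v) p ω).symm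
    rw [h1, sum_inner]
    exact Finset.sum_congr rfl fun i _ => (real_inner_smul_left _ _ _).symm
  have hω2 : ∑ i, ∑ j, ω i * inner ℝ (D (s i) (s j)) (d (s j)) =
      ∑ j, inner ℝ (d (s j)) (D (s j) o) := by
    rw [Finset.sum_comm]
    refine Finset.sum_congr rfl fun j _ => ?_
    rw [hcomm (s j) o]
    have h1 : D o (s j) = ∑ i, ω i • D (s i) (s j) :=
      (sum_smul_spaceDeriv (dirDeriv T Ω (s j) v) p ω).symm
    rw [h1, inner_sum]
    refine Finset.sum_congr rfl fun i _ => ?_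
    rw [real_inner_smul_right, real_inner_comm]
  have hbox : box T Ω v p = D t t - ∑ i, D (s i) (s i) := rfl
  have hx : timeDeriv T Ω v p - dirDeriv T Ω (0, ω) v p = d t - d o := rfl
  have hts : ∑ i, inner ℝ (d (s i)) (D (s i) t) = ∑ j, inner ℝ (D t (s j)) (d (s j)) :=
    Finset.sum_congr rfl fun i _ => by rw [hcomm, real_inner_comm]
  rw [hE, Finset.sum_congr rfl fun i _ => hF i, hbox, hx, inner_sub_left, inner_sub_right,
    inner_sub_right, sum_inner, sum_inner]
  simp only [Finset.sum_add_distrib, Finset.sum_sub_distrib]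
  rw [hω1, hω2, hts, real_inner_comm (D t o) (d t)]
  ring

end Energy

/-! ### First derivatives on the lateral boundary and at the initial time. -/

section BoundaryValues

variable {n : ℕ} {Ω : Set (E n)} {T : ℝ} {p : ℝ × E n}
  {F' : Type*} [NormedAddCommGroup F'] [NormedSpace ℝ F'] {v : ℝ × E n → F'}

theorem timeDeriv_eq_zero_of_lateral (hv : ContDiffOn ℝ 1 v (closedCyl T Ω)) (h0 : ∀ p ∈ lateral T Ω, v p = 0)
    (hp : p ∈ lateral T Ω) : timeDeriv T Ω v p = 0 := by
  have hpK := lateral_subset_closedCyl hp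
  have h1 := (hv.differentiableOn one_ne_zero p hpK).hasFDerivWithinAt
  have h2 : HasDerivAt (fun t : ℝ => (t, p.2)) ((1 : ℝ), (0 : E n)) p.1 :=
    (hasDerivAt_id p.1).prodMk (hasDerivAt_const p.1 p.2)
  have hev : ∀ᶠ t in 𝓝 p.1, (t, p.2) ∈ lateral T Ω := by
    filter_upwards [isOpen_Ioo.mem_nhds hp.1] with t ht using ⟨ht, hp.2⟩
  have h3 : HasDerivAt (fun t : ℝ => v (t, p.2)) (fderivWithin ℝ v (closedCyl T Ω) p (1, 0)) p.1 :=
    h1.comp_hasDerivAt (f := fun t : ℝ => (t, p.2)) p.1 h2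
      (hev.mono fun t ht => lateral_subset_closedCyl ht)
  have h4 : HasDerivAt (fun t : ℝ => v (t, p.2)) 0 p.1 :=
    (hasDerivAt_const p.1 (0 : F')).congr_of_eventuallyEq (hev.mono fun t ht => h0 _ ht)
  exact h3.unique h4

/-- Differentiate `v = 0` along a boundary curve with velocity `w`. The curve stays in the closed
cylinder, so the chain rule applies to the one-sided derivative. -/
theorem dirDeriv_eq_zero_of_tangential (hΩ : IsOpen Ω) (hΩ2 : HasC2Boundary Ω)
    (hv : ContDiffOn ℝ 1 v (closedCyl T Ω)) (h0 : ∀ p ∈ lateral T Ω, v p = 0)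
    (hp : p ∈ lateral T Ω) {w : E n} (hw : inner ℝ (outwardNormal Ω p.2) w = 0) :
    dirDeriv T Ω (0, w) v p = 0 := by
  have hpK := lateral_subset_closedCyl hp
  obtain ⟨c, hc0, hcd, hcf⟩ := exists_curve_frontier hΩ hΩ2 hp.2 hw
  have hpc : (p.1, c 0) = p := by rw [hc0]
  have h1 := (hv.differentiableOn one_ne_zero p hpK).hasFDerivWithinAt
  rw [← hpc] at h1
  have h2 : HasDerivAt (fun s : ℝ => (p.1, c s)) ((0 : ℝ), w) 0 :=
    (hasDerivAt_const (0 : ℝ) p.1).prodMk hcd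
  have hev : ∀ᶠ s in 𝓝 (0 : ℝ), (p.1, c s) ∈ lateral T Ω := hcf.mono fun s hs => ⟨hp.1, hs⟩
  have h3 : HasDerivAt (fun s : ℝ => v (p.1, c s))
      (fderivWithin ℝ v (closedCyl T Ω) (p.1, c 0) (0, w)) 0 :=
    h1.comp_hasDerivAt (f := fun s : ℝ => (p.1, c s)) (0 : ℝ) h2
      (hev.mono fun t ht => lateral_subset_closedCyl ht)
  have h4 : HasDerivAt (fun s : ℝ => v (p.1, c s)) 0 0 :=
    (hasDerivAt_const (0 : ℝ) (0 : F')).congr_of_eventuallyEq (hev.mono fun t ht => h0 _ ht)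
  rw [hpc] at h3
  exact h3.unique h4

/-- The gradient of a function vanishing on the lateral boundary is normal there. -/
theorem dirDeriv_eq_inner_smul_normalDeriv (hΩ : IsOpen Ω) (hΩ2 : HasC2Boundary Ω)
    (hv : ContDiffOn ℝ 1 v (closedCyl T Ω)) (h0 : ∀ p ∈ lateral T Ω, v p = 0)
    (hp : p ∈ lateral T Ω) (w : E n) :
    dirDeriv T Ω (0, w) v p = inner ℝ (outwardNormal Ω p.2) w • normalDeriv T Ω v p := by
  set ν := outwardNormal Ω p.2 with hν
  have hν1 : ‖ν‖ = 1 := norm_outwardNormal hΩ2 hp.2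
  have h1 := dirDeriv_eq_zero_of_tangential hΩ hΩ2 hv h0 hp (w := w - inner ℝ ν w • ν) (by
    rw [← hν, inner_sub_right, real_inner_smul_right, real_inner_self_eq_norm_sq, hν1]
    ring)
  have h2 : ((0 : ℝ), w - inner ℝ ν w • ν) = (0, w) - inner ℝ ν w • ((0 : ℝ), ν) := by
    ext <;> simp
  rw [dirDeriv, h2, map_sub, map_smul] at h1
  exact sub_eq_zero.1 h1

theorem dirDeriv_eq_zero_of_initial (hΩ : IsOpen Ω) (hT : 0 < T)
    (hv : ContDiffOn ℝ 1 v (closedCyl T Ω)) (h0 : ∀ x ∈ Ω, v (0, x) = 0) {x : E n} (hx : x ∈ Ω)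
    (w : E n) : dirDeriv T Ω (0, w) v (0, x) = 0 := by
  have hmem : ∀ x ∈ Ω, ((0 : ℝ), x) ∈ closedCyl T Ω := fun x hx =>
    ⟨⟨le_rfl, hT.le⟩, subset_closure hx⟩
  have h1 := (hv.differentiableOn one_ne_zero _ (hmem x hx)).hasFDerivWithinAt
  have h2 : HasFDerivAt (fun x : E n => ((0 : ℝ), x)) (ContinuousLinearMap.inr ℝ ℝ (E n)) x :=
    hasFDerivAt_prodMk_right 0 x
  have h3 := h1.comp_hasFDerivAt x h2 (by
    filter_upwards [hΩ.mem_nhds hx] with y hy using hmem y hy)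
  have h4 : HasFDerivAt (v ∘ fun x : E n => ((0 : ℝ), x)) (0 : E n →L[ℝ] F') x :=
    (hasFDerivAt_const (0 : F') x).congr_of_eventuallyEq (by
      filter_upwards [hΩ.mem_nhds hx] with y hy using h0 y hy)
  have h5 := congrArg (fun L : E n →L[ℝ] F' => L w) (h3.unique h4)
  simpa [dirDeriv] using h5

end BoundaryValues

/-! ### Integrated energy identity, Poincaré inequality, conjugated estimate. -/

section IntegralIdentities

variable {n : ℕ} {Ω : Set (E n)} {T : ℝ}
  {H : Type*} [NormedAddCommGroup H] [InnerProductSpace ℝ H]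
  {v : ℝ × E n → H} {ω : E n} {μ : Measure (E n)} [IsFiniteMeasure μ]

theorem ae_mem_lateral (hμ : ∀ᵐ x ∂μ, x ∈ frontier Ω) :
    ∀ᵐ p ∂((volume.restrict (Ioo 0 T)).prod μ), p ∈ lateral T Ω :=
  ae_mem_prod_of_ae (ae_restrict_mem measurableSet_Ioo) hμ

theorem sum_mul_eq_inner (a b : E n) : ∑ i, a i * b i = inner ℝ a b := by
  simp only [PiLp.inner_apply]
  exact Finset.sum_congr rfl fun i _ => by simp [mul_comm]

/-- With `∂_t v = 0` and `∇v = ν ∂_ν v`, the two surviving parts of the flux are `(ν·ω) |∂_ν v|²`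
and `-1/2` times the same quantity. -/
theorem sum_energyFlux_of_lateral (hΩ : IsOpen Ω) (hΩ2 : HasC2Boundary Ω)
    (hv : ContDiffOn ℝ 1 v (closedCyl T Ω)) (h0 : ∀ p ∈ lateral T Ω, v p = 0)
    {p : ℝ × E n} (hp : p ∈ lateral T Ω) :
    ∑ i, outwardNormal Ω p.2 i * energyFlux T Ω ω v i p =
      1 / 2 * (inner ℝ (outwardNormal Ω p.2) ω * ‖normalDeriv T Ω v p‖ ^ 2) := by
  set ν := outwardNormal Ω p.2 with hν
  set N := normalDeriv T Ω v p with hN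
  have hν1 : ‖ν‖ = 1 := norm_outwardNormal hΩ2 hp.2
  have hνν : ∑ j, ν j * ν j = 1 := by
    rw [sum_mul_eq_inner, real_inner_self_eq_norm_sq, hν1, one_pow]
  have hs : ∀ i, spaceDeriv T Ω i v p = ν i • N := by
    intro i
    have h1 := dirDeriv_eq_inner_smul_normalDeriv hΩ hΩ2 hv h0 hp (EuclideanSpace.single i 1)
    rw [← hν, ← hN] at h1
    have h2 : inner ℝ ν (EuclideanSpace.single i (1 : ℝ) : E n) = ν i := by
      rw [real_inner_comm]
      simp [EuclideanSpace.inner_single_left]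
    rw [h2] at h1
    exact h1
  have hω := dirDeriv_eq_inner_smul_normalDeriv hΩ hΩ2 hv h0 hp ω
  have ht := timeDeriv_eq_zero_of_lateral hv h0 hp
  rw [← hν, ← hN] at hω
  have hf : ∀ i, ν i * energyFlux T Ω ω v i p =
      (ν i * ν i) * (inner ℝ ν ω * ‖N‖ ^ 2) - (ν i * ω i) * (1 / 2 * ‖N‖ ^ 2) := by
    intro i
    have hsum : ∑ j, inner ℝ (ν j • N) (ν j • N) = ‖N‖ ^ 2 := by
      have : ∀ j, inner ℝ (ν j • N) (ν j • N) = (ν j * ν j) * ‖N‖ ^ 2 := by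
        intro j
        rw [real_inner_smul_left, real_inner_smul_right, real_inner_self_eq_norm_sq]
        ring
      rw [Finset.sum_congr rfl fun j _ => this j, ← Finset.sum_mul, hνν, one_mul]
    simp only [energyFlux, hs, hω, ht, hsum, inner_zero_right, smul_eq_mul]
    rw [real_inner_smul_left, real_inner_smul_right, real_inner_self_eq_norm_sq]
    ring
  rw [Finset.sum_congr rfl fun i _ => hf i, Finset.sum_sub_distrib, ← Finset.sum_mul,
    ← Finset.sum_mul, hνν, sum_mul_eq_inner]
  ring

theorem energyDensity_eq_zero_of_initial (hΩ : IsOpen Ω) (hT : 0 < T)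
    (hv : ContDiffOn ℝ 1 v (closedCyl T Ω)) (h0 : ∀ x ∈ Ω, v (0, x) = 0)
    (h1 : ∀ x ∈ Ω, timeDeriv T Ω v (0, x) = 0) {x : E n} (hx : x ∈ Ω) :
    energyDensity T Ω ω v (0, x) = 0 := by
  have hs : ∀ i, spaceDeriv T Ω i v (0, x) = 0 := fun i =>
    dirDeriv_eq_zero_of_initial hΩ hT hv h0 hx _
  simp [energyDensity, h1 x hx, hs]

/-- The pointwise divergence identity, integrated; the initial energy drops because all first
derivatives vanish at `t = 0`. -/
theorem integral_inner_box (hΩ : IsOpen Ω) (hΩb : Bornology.IsBounded Ω)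
    (hΩ2 : HasC2Boundary Ω) (hT : 0 < T) (hμ : ∀ᵐ x ∂μ, x ∈ frontier Ω)
    (hGG : ∀ G : E n → E n, ContDiffOn ℝ 1 G (closure Ω) →
        ∫ x in Ω, divergence G x = ∫ x, inner ℝ (outwardNormal Ω x) (G x) ∂μ)
    (hv : ContDiffOn ℝ 2 v (closedCyl T Ω)) (hlat : ∀ p ∈ lateral T Ω, v p = 0)
    (h0 : ∀ x ∈ Ω, v (0, x) = 0) (h1 : ∀ x ∈ Ω, timeDeriv T Ω v (0, x) = 0) :
    ∫ p in cyl T Ω, inner ℝ (box T Ω v p) (timeDeriv T Ω v p - dirDeriv T Ω (0, ω) v p) =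
      (∫ x in Ω, energyDensity T Ω ω v (T, x)) +
      ∫ p, 1 / 2 * (inner ℝ (outwardNormal Ω p.2) ω * ‖normalDeriv T Ω v p‖ ^ 2)
        ∂((volume.restrict (Ioo 0 T)).prod μ) := by
  have hK := uniqueDiffOn_closedCyl hΩ hΩ2 hT
  have hv1 := hv.of_le (by norm_num : (1 : WithTop ℕ∞) ≤ 2)
  have he := contDiffOn_energyDensity (ω := ω) hK hv
  have hF := contDiffOn_energyFlux (ω := ω) hK hv
  have hi1 : IntegrableOn (timeDeriv T Ω (energyDensity T Ω ω v)) (cyl T Ω) :=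
    integrableOn_cyl hΩb (continuousOn_dirDeriv hK he _)
  have hi2 : IntegrableOn (fun p => ∑ i, spaceDeriv T Ω i (energyFlux T Ω ω v i) p) (cyl T Ω) :=
    integrableOn_cyl hΩb (continuousOn_finsetSum _ fun i _ => continuousOn_dirDeriv hK (hF i) _)
  rw [setIntegral_congr_fun (isOpen_cyl hΩ).measurableSet fun p hp =>
      inner_box_eq_divergence (ω := ω) hΩ hK hv hp,
    integral_add hi1 hi2,
    setIntegral_timeDeriv hΩ hΩb hΩ2 hT he,
    setIntegral_sum_spaceDeriv hΩ hΩb hΩ2 hT hμ hGG hF]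
  congr 1
  · refine setIntegral_congr_fun hΩ.measurableSet fun x hx => ?_
    rw [energyDensity_eq_zero_of_initial hΩ hT hv1 h0 h1 hx, sub_zero]
  · refine integral_congr_ae ?_
    filter_upwards [ae_mem_lateral hμ] with p hp
    exact sum_energyFlux_of_lateral hΩ hΩ2 hv1 hlat hp

theorem dirDeriv_sub_fst (hK : UniqueDiffOn ℝ (closedCyl T Ω)) {p : ℝ × E n}
    (hp : p ∈ closedCyl T Ω) (w : ℝ × E n) :
    dirDeriv T Ω w (fun p : ℝ × E n => T - p.1) p = -w.1 := by
  have h : HasFDerivAt (fun p : ℝ × E n => T - p.1) (-ContinuousLinearMap.fst ℝ ℝ (E n)) p :=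
    hasFDerivAt_fst.const_sub T
  rw [dirDeriv, h.hasFDerivWithinAt.fderivWithin (hK p hp)]
  rfl

/-- The Poincaré inequality along the field `∂_t - ω·∇`. -/
theorem integral_norm_sq_le (hΩ : IsOpen Ω) (hΩb : Bornology.IsBounded Ω)
    (hΩ2 : HasC2Boundary Ω) (hT : 0 < T) (hμ : ∀ᵐ x ∂μ, x ∈ frontier Ω)
    (hGG : ∀ G : E n → E n, ContDiffOn ℝ 1 G (closure Ω) →
        ∫ x in Ω, divergence G x = ∫ x, inner ℝ (outwardNormal Ω x) (G x) ∂μ)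
    (hv : ContDiffOn ℝ 1 v (closedCyl T Ω)) (hlat : ∀ p ∈ lateral T Ω, v p = 0)
    (h0 : ∀ x ∈ Ω, v (0, x) = 0) :
    ∫ p in cyl T Ω, ‖v p‖ ^ 2 ≤
      4 * T ^ 2 * ∫ p in cyl T Ω, ‖timeDeriv T Ω v p - dirDeriv T Ω (0, ω) v p‖ ^ 2 := by
  have hK := uniqueDiffOn_closedCyl hΩ hΩ2 hT
  have hvv : ContDiffOn ℝ 1 (fun p => inner ℝ (v p) (v p)) (closedCyl T Ω) := hv.inner ℝ hv
  have hT1 : ContDiffOn ℝ 1 (fun p : ℝ × E n => T - p.1) (closedCyl T Ω) := by fun_prop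
  -- The quantity `(T - t) |v|²` vanishes at `t = 0`, at `t = T` and on the lateral boundary, so its
  -- derivative along `∂_t - ω·∇` integrates to zero. That derivative is `-|v|² + 2 (T - t) ⟨X v,
  -- v⟩`.
  have hf : ContDiffOn ℝ 1 (fun p : ℝ × E n => (T - p.1) • inner ℝ (v p) (v p))
      (closedCyl T Ω) := hT1.smul hvv
  have hF : ∀ i, ContDiffOn ℝ 1 (fun p : ℝ × E n => ω i • ((T - p.1) • inner ℝ (v p) (v p)))
      (closedCyl T Ω) := fun i => contDiffOn_const_smul hf (ω i)
  have hfd : ∀ p ∈ closedCyl T Ω, ∀ w, dirDeriv T Ω w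
      (fun p : ℝ × E n => (T - p.1) • inner ℝ (v p) (v p)) p =
      2 * (T - p.1) * inner ℝ (dirDeriv T Ω w v p) (v p) - w.1 * ‖v p‖ ^ 2 := by
    intro p hp w
    rw [dirDeriv_smul hK hp hT1 hvv, dirDeriv_inner_self hK hp hv, dirDeriv_sub_fst hK hp,
      real_inner_self_eq_norm_sq, smul_eq_mul, smul_eq_mul]
    ring
  have htime := setIntegral_timeDeriv hΩ hΩb hΩ2 hT hf
  have hspace := setIntegral_sum_spaceDeriv hΩ hΩb hΩ2 hT hμ hGG hF
  have hr1 : ∫ x in Ω, ((T - ((T, x) : ℝ × E n).1) • inner ℝ (v (T, x)) (v (T, x)) -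
      (T - ((0, x) : ℝ × E n).1) • inner ℝ (v (0, x)) (v (0, x))) = 0 := by
    refine setIntegral_eq_zero_of_forall_eq_zero fun x hx => ?_
    simp [h0 x hx]
  have hr2 : ∫ p, ∑ i, outwardNormal Ω p.2 i * (ω i • ((T - p.1) • inner ℝ (v p) (v p)))
      ∂((volume.restrict (Ioo 0 T)).prod μ) = 0 := by
    refine integral_eq_zero_of_ae ?_
    filter_upwards [ae_mem_lateral hμ] with p hp
    simp [hlat p hp]
  rw [hr1] at htime
  rw [hr2] at hspace
  set X : ℝ × E n → H := fun p => timeDeriv T Ω v p - dirDeriv T Ω (0, ω) v p with hX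
  have hXc : ContinuousOn X (closedCyl T Ω) :=
    (continuousOn_dirDeriv hK hv _).sub (continuousOn_dirDeriv hK hv _)
  have hvn : IntegrableOn (fun p => ‖v p‖ ^ 2) (cyl T Ω) :=
    integrableOn_cyl hΩb (hv.continuousOn.norm.pow 2)
  have hXn : IntegrableOn (fun p => ‖X p‖ ^ 2) (cyl T Ω) := integrableOn_cyl hΩb (hXc.norm.pow 2)
  have hspw : ∀ p ∈ cyl T Ω, ∑ i, spaceDeriv T Ω i
      (fun p : ℝ × E n => ω i • ((T - p.1) • inner ℝ (v p) (v p))) p =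
      2 * (T - p.1) * inner ℝ (dirDeriv T Ω (0, ω) v p) (v p) := by
    intro p hp
    have hpK := cyl_subset_closedCyl hp
    have h1 : ∀ i, spaceDeriv T Ω i
        (fun p : ℝ × E n => ω i • ((T - p.1) • inner ℝ (v p) (v p))) p =
        ω i • spaceDeriv T Ω i (fun p : ℝ × E n => (T - p.1) • inner ℝ (v p) (v p)) p :=
      fun i => dirDeriv_const_smul hK hpK hf (ω i)
    rw [Finset.sum_congr rfl fun i _ => h1 i, sum_smul_spaceDeriv, hfd p hpK]
    ring
  have hpt : ∀ p ∈ cyl T Ω, ‖v p‖ ^ 2 =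
      2 * (T - p.1) * inner ℝ (X p) (v p) -
        (timeDeriv T Ω (fun p : ℝ × E n => (T - p.1) • inner ℝ (v p) (v p)) p -
          ∑ i, spaceDeriv T Ω i
            (fun p : ℝ × E n => ω i • ((T - p.1) • inner ℝ (v p) (v p))) p) := by
    intro p hp
    rw [hspw p hp, timeDeriv, hfd p (cyl_subset_closedCyl hp), hX, inner_sub_left]
    simp only [timeDeriv]
    ring
  have hi1 : IntegrableOn (fun p : ℝ × E n => 2 * (T - p.1) * inner ℝ (X p) (v p)) (cyl T Ω) :=
    integrableOn_cyl hΩb ((continuousOn_const.mul hT1.continuousOn).mul (hXc.inner hv.continuousOn))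
  have hi2 : IntegrableOn (timeDeriv T Ω
      (fun p : ℝ × E n => (T - p.1) • inner ℝ (v p) (v p))) (cyl T Ω) :=
    integrableOn_cyl hΩb (continuousOn_dirDeriv hK hf _)
  have hi3 : IntegrableOn (fun p => ∑ i, spaceDeriv T Ω i
      (fun p : ℝ × E n => ω i • ((T - p.1) • inner ℝ (v p) (v p))) p) (cyl T Ω) :=
    integrableOn_cyl hΩb (continuousOn_finsetSum _ fun i _ => continuousOn_dirDeriv hK (hF i) _)
  have hi23 : IntegrableOn (fun p => timeDeriv T Ω
      (fun p : ℝ × E n => (T - p.1) • inner ℝ (v p) (v p)) p - ∑ i, spaceDeriv T Ω i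
      (fun p : ℝ × E n => ω i • ((T - p.1) • inner ℝ (v p) (v p))) p) (cyl T Ω) := hi2.sub hi3
  have hkey : ∫ p in cyl T Ω, ‖v p‖ ^ 2 =
      ∫ p in cyl T Ω, 2 * (T - p.1) * inner ℝ (X p) (v p) := by
    rw [setIntegral_congr_fun (isOpen_cyl hΩ).measurableSet hpt, integral_sub hi1 hi23,
      integral_sub hi2 hi3, htime, hspace]
    ring
  have hle : ∫ p in cyl T Ω, 2 * (T - p.1) * inner ℝ (X p) (v p) ≤
      ∫ p in cyl T Ω, (2 * T ^ 2 * ‖X p‖ ^ 2 + 1 / 2 * ‖v p‖ ^ 2) := by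
    refine setIntegral_mono_on hi1 ((hXn.const_mul _).add (hvn.const_mul _))
      (isOpen_cyl hΩ).measurableSet fun p hp => ?_
    have ht : 0 < p.1 ∧ p.1 < T := hp.1
    have h1 := real_inner_le_norm (X p) (v p)
    have h2 : 2 * (T - p.1) * inner ℝ (X p) (v p) ≤ 2 * (T - p.1) * (‖X p‖ * ‖v p‖) :=
      mul_le_mul_of_nonneg_left h1 (by linarith)
    have h3 : 2 * (T - p.1) * (‖X p‖ * ‖v p‖) ≤ 2 * T * (‖X p‖ * ‖v p‖) :=
      mul_le_mul_of_nonneg_right (by linarith) (by positivity)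
    -- Young's inequality, weighted so that half of `‖v‖²` can be moved to the left.
    nlinarith [sq_nonneg (2 * T * ‖X p‖ - ‖v p‖)]
  rw [integral_add (hXn.const_mul _) (hvn.const_mul _), integral_const_mul,
    integral_const_mul] at hle
  linarith

theorem norm_dirDeriv_sq_le (v : ℝ × E n → H) (hω : ‖ω‖ = 1) (p : ℝ × E n) :
    ‖dirDeriv T Ω (0, ω) v p‖ ^ 2 ≤ ∑ j, ‖spaceDeriv T Ω j v p‖ ^ 2 := by
  rw [← sum_smul_spaceDeriv]
  have h1 : ‖∑ i, ω i • spaceDeriv T Ω i v p‖ ≤ ∑ i, |ω i| * ‖spaceDeriv T Ω i v p‖ :=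
    (norm_sum_le _ _).trans_eq (Finset.sum_congr rfl fun i _ => by rw [norm_smul, Real.norm_eq_abs])
  have h2 := Finset.sum_mul_sq_le_sq_mul_sq Finset.univ (fun i => |ω i|)
    (fun i => ‖spaceDeriv T Ω i v p‖)
  have h3 : ∑ i, |ω i| ^ 2 = 1 := by
    rw [Finset.sum_congr rfl fun i _ => (sq_abs (ω i)).trans (sq (ω i)), sum_mul_eq_inner,
      real_inner_self_eq_norm_sq, hω, one_pow]
  rw [h3, one_mul] at h2
  exact (pow_le_pow_left₀ (norm_nonneg _) h1 2).trans h2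

/-- The field `∂_t - ω·∇` is null, so the energy does not control `∂_t v` by itself. Young's
inequality on the cross term keeps a quarter of `|∂_t v|²` at the price of a gradient term, which
the final estimate has on its right side. -/
theorem le_energyDensity (v : ℝ × E n → H) (hω : ‖ω‖ = 1) (p : ℝ × E n) :
    1 / 4 * ‖timeDeriv T Ω v p‖ ^ 2 - 1 / 2 * ∑ j, ‖spaceDeriv T Ω j v p‖ ^ 2 ≤
      energyDensity T Ω ω v p := by
  simp only [energyDensity, real_inner_self_eq_norm_sq, smul_eq_mul]
  have h1 := norm_dirDeriv_sq_le (T := T) (Ω := Ω) v hω p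
  have h2 := real_inner_le_norm (timeDeriv T Ω v p) (dirDeriv T Ω (0, ω) v p)
  nlinarith [sq_nonneg (‖timeDeriv T Ω v p‖ - 2 * ‖dirDeriv T Ω (0, ω) v p‖)]

theorem continuousOn_slice (hT : 0 < T) {G : Type*} [TopologicalSpace G] {f : ℝ × E n → G}
    (hf : ContinuousOn f (closedCyl T Ω)) : ContinuousOn (fun x => f (T, x)) (closure Ω) :=
  hf.comp (by fun_prop) fun _ hx => ⟨⟨hT.le, le_rfl⟩, hx⟩

theorem integrableOn_slice (hΩb : Bornology.IsBounded Ω) (hT : 0 < T) {G : Type*}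
    [NormedAddCommGroup G] {f : ℝ × E n → G} (hf : ContinuousOn f (closedCyl T Ω)) :
    IntegrableOn (fun x => f (T, x)) Ω :=
  ((continuousOn_slice hT hf).integrableOn_compact hΩb.isCompact_closure).mono_set subset_closure

/-- The Carleman estimate for the conjugated wave operator `h □ + 2 (∂_t - ω·∇)`. -/
theorem carleman_conjugated (hΩ : IsOpen Ω) (hΩb : Bornology.IsBounded Ω)
    (hΩ2 : HasC2Boundary Ω) (hT : 0 < T) (hμ : ∀ᵐ x ∂μ, x ∈ frontier Ω)
    (hGG : ∀ G : E n → E n, ContDiffOn ℝ 1 G (closure Ω) →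
        ∫ x in Ω, divergence G x = ∫ x, inner ℝ (outwardNormal Ω x) (G x) ∂μ)
    (hv : ContDiffOn ℝ 2 v (closedCyl T Ω)) (hlat : ∀ p ∈ lateral T Ω, v p = 0)
    (h0 : ∀ x ∈ Ω, v (0, x) = 0) (h1 : ∀ x ∈ Ω, timeDeriv T Ω v (0, x) = 0) (hω : ‖ω‖ = 1)
    {h : ℝ} (hh : 0 < h) :
    1 / T ^ 2 * (∫ p in cyl T Ω, ‖v p‖ ^ 2) + h * (∫ x in Ω, ‖timeDeriv T Ω v (T, x)‖ ^ 2)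
        + 2 * h * (∫ p, inner ℝ (outwardNormal Ω p.2) ω * ‖normalDeriv T Ω v p‖ ^ 2
          ∂((volume.restrict (Ioo 0 T)).prod μ)) ≤
      (∫ p in cyl T Ω, ‖h • box T Ω v p +
        (2 : ℝ) • (timeDeriv T Ω v p - dirDeriv T Ω (0, ω) v p)‖ ^ 2)
      + 2 * h * ∫ x in Ω, ∑ j, ‖spaceDeriv T Ω j v (T, x)‖ ^ 2 := by
  have hK := uniqueDiffOn_closedCyl hΩ hΩ2 hT
  have hv1 := hv.of_le (by norm_num : (1 : WithTop ℕ∞) ≤ 2)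
  have hd : ∀ w, ContDiffOn ℝ 1 (dirDeriv T Ω w v) (closedCyl T Ω) := contDiffOn_dirDeriv hK hv
  have hid := integral_inner_box (ω := ω) hΩ hΩb hΩ2 hT hμ hGG hv hlat h0 h1
  have hpo := integral_norm_sq_le (ω := ω) hΩ hΩb hΩ2 hT hμ hGG hv1 hlat h0
  rw [integral_const_mul] at hid
  set X : ℝ × E n → H := fun p => timeDeriv T Ω v p - dirDeriv T Ω (0, ω) v p with hX
  have hXc : ContinuousOn X (closedCyl T Ω) := (hd _).continuousOn.sub (hd _).continuousOn
  have hbc : ContinuousOn (box T Ω v) (closedCyl T Ω) :=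
    (continuousOn_dirDeriv hK (hd _) _).sub
      (continuousOn_finsetSum _ fun i _ => continuousOn_dirDeriv hK (hd _) _)
  have hXn : IntegrableOn (fun p => ‖X p‖ ^ 2) (cyl T Ω) := integrableOn_cyl hΩb (hXc.norm.pow 2)
  have hbX : IntegrableOn (fun p => inner ℝ (box T Ω v p) (X p)) (cyl T Ω) :=
    integrableOn_cyl hΩb (hbc.inner hXc)
  have hP : IntegrableOn (fun p => ‖h • box T Ω v p + (2 : ℝ) • X p‖ ^ 2) (cyl T Ω) :=
    integrableOn_cyl hΩb (((hbc.const_smul h).add (hXc.const_smul (2 : ℝ))).norm.pow 2)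
  -- Expansion of the square, with `‖h □ v‖²` discarded.
  have hlow : ∫ p in cyl T Ω, (4 * ‖X p‖ ^ 2 + 4 * h * inner ℝ (box T Ω v p) (X p)) ≤
      ∫ p in cyl T Ω, ‖h • box T Ω v p + (2 : ℝ) • X p‖ ^ 2 := by
    refine integral_mono ((hXn.const_mul _).add (hbX.const_mul _)) hP fun p => ?_
    beta_reduce
    rw [norm_add_sq_real, real_inner_smul_left, real_inner_smul_right, norm_smul, norm_smul,
      Real.norm_eq_abs, Real.norm_eq_abs, abs_of_pos hh, abs_of_pos (by norm_num : (0 : ℝ) < 2)]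
    nlinarith [sq_nonneg (h * ‖box T Ω v p‖)]
  rw [integral_add (hXn.const_mul _) (hbX.const_mul _), integral_const_mul, integral_const_mul,
    hid] at hlow
  have hen : ∫ x in Ω, (1 / 4 * ‖timeDeriv T Ω v (T, x)‖ ^ 2 -
      1 / 2 * ∑ j, ‖spaceDeriv T Ω j v (T, x)‖ ^ 2) ≤ ∫ x in Ω, energyDensity T Ω ω v (T, x) := by
    refine integral_mono ?_ ?_ fun x => le_energyDensity v hω (T, x)
    · exact integrableOn_slice (f := fun p => 1 / 4 * ‖timeDeriv T Ω v p‖ ^ 2 -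
        1 / 2 * ∑ j, ‖spaceDeriv T Ω j v p‖ ^ 2) hΩb hT
        ((continuousOn_const.mul ((hd _).continuousOn.norm.pow 2)).sub
          (continuousOn_const.mul (continuousOn_finsetSum _ fun j _ =>
            (hd _).continuousOn.norm.pow 2)))
    · exact integrableOn_slice hΩb hT (contDiffOn_energyDensity hK hv).continuousOn
  have hi1 : IntegrableOn (fun x => ‖timeDeriv T Ω v (T, x)‖ ^ 2) Ω :=
    integrableOn_slice (f := fun p => ‖timeDeriv T Ω v p‖ ^ 2) hΩb hT
      ((hd _).continuousOn.norm.pow 2)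
  have hi2 : IntegrableOn (fun x => ∑ j, ‖spaceDeriv T Ω j v (T, x)‖ ^ 2) Ω :=
    integrableOn_slice (f := fun p => ∑ j, ‖spaceDeriv T Ω j v p‖ ^ 2) hΩb hT
      (continuousOn_finsetSum _ fun j _ => (hd _).continuousOn.norm.pow 2)
  rw [integral_sub (hi1.const_mul _) (hi2.const_mul _), integral_const_mul,
    integral_const_mul] at hen
  -- All of `4 ‖X v‖²` is spent on the Poincaré inequality; nothing of it is needed for the boundary
  -- terms.
  have hpo' : 1 / T ^ 2 * (∫ p in cyl T Ω, ‖v p‖ ^ 2) ≤ 4 * ∫ p in cyl T Ω, ‖X p‖ ^ 2 := by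
    rw [one_div, inv_mul_le_iff₀ (by positivity)]
    linarith
  have hen' := mul_le_mul_of_nonneg_left hen (by linarith : 0 ≤ 4 * h)
  linarith

end IntegralIdentities

/-! ### Conjugation by the exponential weight. -/

section Weighted

variable {n : ℕ} {Ω : Set (E n)} {T h : ℝ} {ω : E n} {p : ℝ × E n}

theorem dirDeriv_phase (hK : UniqueDiffOn ℝ (closedCyl T Ω)) (hp : p ∈ closedCyl T Ω)
    (w : ℝ × E n) : dirDeriv T Ω w (phase ω) p = phase ω w := by
  have h1 : HasFDerivAt (phase ω) (ContinuousLinearMap.fst ℝ ℝ (E n) +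
      (innerSL ℝ ω).comp (ContinuousLinearMap.snd ℝ ℝ (E n))) p := by
    have h2 : phase ω = fun p => (ContinuousLinearMap.fst ℝ ℝ (E n) +
      (innerSL ℝ ω).comp (ContinuousLinearMap.snd ℝ ℝ (E n))) p := by
      funext p
      simp [phase, real_inner_comm]
    rw [h2]
    exact ContinuousLinearMap.hasFDerivAt _
  rw [dirDeriv, h1.hasFDerivWithinAt.fderivWithin (hK p hp)]
  simp [phase, real_inner_comm]

theorem contDiff_phase {k : WithTop ℕ∞} : ContDiff ℝ k (phase ω) :=
  contDiff_fst.add (contDiff_snd.inner ℝ contDiff_const)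

theorem contDiff_weight {k : WithTop ℕ∞} :
    ContDiff ℝ k fun p : ℝ × E n => Real.exp (-phase ω p / h) :=
  (contDiff_phase.neg.div_const h).exp

theorem dirDeriv_weight (hK : UniqueDiffOn ℝ (closedCyl T Ω)) (hp : p ∈ closedCyl T Ω)
    (w : ℝ × E n) : dirDeriv T Ω w (fun p => Real.exp (-phase ω p / h)) p =
      -(phase ω w / h) * Real.exp (-phase ω p / h) := by
  have hphi : HasFDerivWithinAt (phase ω) (fderivWithin ℝ (phase ω) (closedCyl T Ω) p)
      (closedCyl T Ω) p :=
    ((contDiff_phase (k := 1)).differentiable one_ne_zero p).differentiableWithinAt.hasFDerivWithinAt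
  have h1 : HasFDerivWithinAt (fun p => -phase ω p / h)
      (h⁻¹ • -fderivWithin ℝ (phase ω) (closedCyl T Ω) p) (closedCyl T Ω) p := by
    simpa [div_eq_inv_mul] using hphi.neg.const_mul h⁻¹
  rw [dirDeriv, h1.exp.fderivWithin (hK p hp)]
  have h2 : fderivWithin ℝ (phase ω) (closedCyl T Ω) p w = phase ω w := dirDeriv_phase hK hp w
  simp only [_root_.smul_apply, _root_.neg_apply, h2, smul_eq_mul]
  ring

theorem contDiffOn_weighted {k : WithTop ℕ∞} {f : ℝ × E n → V n} {S : Set (ℝ × E n)}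
    (hf : ContDiffOn ℝ k f S) : ContDiffOn ℝ k (weighted ω h f) S :=
  contDiff_weight.contDiffOn.smul hf

theorem continuousOn_weighted {f : ℝ × E n → V n} {S : Set (ℝ × E n)} (hf : ContinuousOn f S) :
    ContinuousOn (weighted ω h f) S :=
  (contDiff_weight (k := 0)).continuous.continuousOn.smul hf

theorem dirDeriv_weighted (hK : UniqueDiffOn ℝ (closedCyl T Ω)) (hp : p ∈ closedCyl T Ω)
    {f : ℝ × E n → V n} (hf : ContDiffOn ℝ 1 f (closedCyl T Ω)) (w : ℝ × E n) :
    dirDeriv T Ω w (weighted ω h f) p =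
      weighted ω h (fun p => dirDeriv T Ω w f p - (phase ω w / h) • f p) p := by
  have h1 := dirDeriv_smul (w := w) hK hp
    ((contDiff_weight (ω := ω) (h := h) (k := 1)).contDiffOn (s := closedCyl T Ω)) hf
  rw [dirDeriv_weight hK hp] at h1
  refine h1.trans ?_
  rw [weighted, smul_sub, smul_smul]
  module

theorem dirDeriv_dirDeriv_weighted (hK : UniqueDiffOn ℝ (closedCyl T Ω)) (hp : p ∈ closedCyl T Ω)
    {f : ℝ × E n → V n} (hf : ContDiffOn ℝ 2 f (closedCyl T Ω)) (w : ℝ × E n) :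
    dirDeriv T Ω w (dirDeriv T Ω w (weighted ω h f)) p =
      Real.exp (-phase ω p / h) • (dirDeriv T Ω w (dirDeriv T Ω w f) p
        - (2 * (phase ω w / h)) • dirDeriv T Ω w f p + (phase ω w / h) ^ 2 • f p) := by
  have hf1 := hf.of_le (by norm_num : (1 : WithTop ℕ∞) ≤ 2)
  have hd := contDiffOn_dirDeriv hK hf w
  have hc : ContDiffOn ℝ 1 (fun p => (phase ω w / h) • f p) (closedCyl T Ω) :=
    (contDiffOn_const (c := phase ω w / h)).smul hf1
  rw [dirDeriv_congr (fun p hp => dirDeriv_weighted hK hp hf1 w) hp,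
    dirDeriv_weighted hK hp (hd.sub hc), weighted, dirDeriv_sub hK hp hd hc,
    dirDeriv_const_smul hK hp hf1]
  congr 1
  module

theorem phase_time : phase ω (1, 0) = 1 := by simp [phase]

theorem phase_space (v : E n) : phase ω (0, v) = inner ℝ v ω := by simp [phase]

theorem phase_single (i : Fin n) : phase ω (0, EuclideanSpace.single i 1) = ω i := by
  simp [phase, EuclideanSpace.inner_single_left]

/-- Conjugation of the wave operator by the linear weight. -/
theorem conjugated_box (hK : UniqueDiffOn ℝ (closedCyl T Ω)) (hp : p ∈ closedCyl T Ω)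
    {u : ℝ × E n → V n} (hu : ContDiffOn ℝ 2 u (closedCyl T Ω)) (hω : ‖ω‖ = 1) (hh : 0 < h) :
    h • box T Ω (weighted ω h u) p + (2 : ℝ) • (timeDeriv T Ω (weighted ω h u) p -
      dirDeriv T Ω (0, ω) (weighted ω h u) p) = h • weighted ω h (box T Ω u) p := by
  have hu1 := hu.of_le (by norm_num : (1 : WithTop ℕ∞) ≤ 2)
  have hωω : inner ℝ ω ω = (1 : ℝ) := by rw [real_inner_self_eq_norm_sq, hω, one_pow]
  -- Here `|ω| = 1` enters: the zeroth order terms from `∂_t²` and from `Δ` cancel.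
  have hsum2 : ∑ i, (ω i / h) ^ 2 = (1 / h) ^ 2 := by
    rw [Finset.sum_congr rfl fun i _ => show (ω i / h) ^ 2 = (ω i * ω i) * (1 / h) ^ 2 by ring,
      ← Finset.sum_mul, sum_mul_eq_inner, hωω, one_mul]
  set g := Real.exp (-phase ω p / h) with hg
  have ht2 : timeDeriv T Ω (timeDeriv T Ω (weighted ω h u)) p =
      g • (timeDeriv T Ω (timeDeriv T Ω u) p - (2 * (1 / h)) • timeDeriv T Ω u p
        + (1 / h) ^ 2 • u p) := by
    have := dirDeriv_dirDeriv_weighted (ω := ω) (h := h) hK hp hu (1, 0)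
    rwa [phase_time] at this
  have hs2 : ∀ i, spaceDeriv T Ω i (spaceDeriv T Ω i (weighted ω h u)) p =
      g • (spaceDeriv T Ω i (spaceDeriv T Ω i u) p - (2 / h) • (ω i • spaceDeriv T Ω i u p)
        + (ω i / h) ^ 2 • u p) := by
    intro i
    have := dirDeriv_dirDeriv_weighted (ω := ω) (h := h) hK hp hu (0, EuclideanSpace.single i 1)
    rw [phase_single] at this
    refine this.trans ?_
    simp only [spaceDeriv]
    congr 1
    module
  have ht1 : timeDeriv T Ω (weighted ω h u) p = g • (timeDeriv T Ω u p - (1 / h) • u p) := by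
    have := dirDeriv_weighted (ω := ω) (h := h) hK hp hu1 (1, 0)
    rwa [phase_time] at this
  have hw1 : dirDeriv T Ω (0, ω) (weighted ω h u) p =
      g • (dirDeriv T Ω (0, ω) u p - (1 / h) • u p) := by
    have := dirDeriv_weighted (ω := ω) (h := h) hK hp hu1 (0, ω)
    rwa [phase_space, hωω] at this
  have hbox : box T Ω (weighted ω h u) p = g • (box T Ω u p
      - (2 / h) • (timeDeriv T Ω u p - dirDeriv T Ω (0, ω) u p)) := by
    rw [box, ht2, Finset.sum_congr rfl fun i _ => hs2 i, ← Finset.smul_sum,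
      Finset.sum_add_distrib, Finset.sum_sub_distrib, ← Finset.smul_sum, ← Finset.sum_smul,
      sum_smul_spaceDeriv, hsum2, box]
    module
  rw [hbox, ht1, hw1, weighted, ← hg]
  match_scalars <;> field_simp <;> ring

/-- The derivative of the weight multiplies `u`, which vanishes at `p`. -/
theorem normalDeriv_weighted_of_lateral (hK : UniqueDiffOn ℝ (closedCyl T Ω))
    {u : ℝ × E n → V n} (hu : ContDiffOn ℝ 1 u (closedCyl T Ω)) (h0 : u p = 0)
    (hp : p ∈ lateral T Ω) :
    normalDeriv T Ω (weighted ω h u) p = weighted ω h (normalDeriv T Ω u) p := by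
  rw [normalDeriv, dirDeriv_weighted hK (lateral_subset_closedCyl hp) hu]
  simp [weighted, h0, normalDeriv]

theorem norm_sub_sq_bounds {G : Type*} [SeminormedAddCommGroup G] (a b : G) :
    ‖a‖ ^ 2 ≤ 2 * ‖a - b‖ ^ 2 + 2 * ‖b‖ ^ 2 ∧ ‖a - b‖ ^ 2 ≤ 2 * ‖a‖ ^ 2 + 2 * ‖b‖ ^ 2 := by
  have h1 : ‖a‖ ≤ ‖a - b‖ + ‖b‖ := by simpa using norm_add_le (a - b) b
  have h2 := norm_sub_le a b
  constructor
  · nlinarith [norm_nonneg a, sq_nonneg (‖a - b‖ - ‖b‖)]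
  · nlinarith [norm_nonneg (a - b), sq_nonneg (‖a‖ - ‖b‖)]

/-- The commutator of `∂_t` with the weight is `1/h` times the weighted function; after
multiplication by `h` its square becomes the `1/h` term at time `T`. -/
theorem norm_timeDeriv_weighted_sq (hK : UniqueDiffOn ℝ (closedCyl T Ω))
    (hp : p ∈ closedCyl T Ω) {u : ℝ × E n → V n} (hu : ContDiffOn ℝ 1 u (closedCyl T Ω)) :
    ‖weighted ω h (timeDeriv T Ω u) p‖ ^ 2 ≤
      2 * ‖timeDeriv T Ω (weighted ω h u) p‖ ^ 2 + 2 / h ^ 2 * ‖weighted ω h u p‖ ^ 2 := by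
  have h1 : timeDeriv T Ω (weighted ω h u) p =
      weighted ω h (timeDeriv T Ω u) p - (1 / h) • weighted ω h u p := by
    have := dirDeriv_weighted (ω := ω) (h := h) hK hp hu (1, 0)
    rw [phase_time] at this
    refine this.trans ?_
    simp only [weighted, timeDeriv]
    module
  have h2 := (norm_sub_sq_bounds (weighted ω h (timeDeriv T Ω u) p)
    ((1 / h) • weighted ω h u p)).1
  rw [← h1, norm_smul, mul_pow, Real.norm_eq_abs, sq_abs] at h2
  refine h2.trans_eq ?_
  ring

/-- The commutators have coefficients `ω i / h`, whose squares add up to `1 / h²`, so the constant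
is free of `n`. -/
theorem sum_norm_spaceDeriv_weighted_sq (hK : UniqueDiffOn ℝ (closedCyl T Ω))
    (hp : p ∈ closedCyl T Ω) {u : ℝ × E n → V n} (hu : ContDiffOn ℝ 1 u (closedCyl T Ω))
    (hω : ‖ω‖ = 1) :
    ∑ i, ‖spaceDeriv T Ω i (weighted ω h u) p‖ ^ 2 ≤
      2 * ∑ i, ‖weighted ω h (spaceDeriv T Ω i u) p‖ ^ 2
        + 2 / h ^ 2 * ‖weighted ω h u p‖ ^ 2 := by
  have h1 : ∀ i, ‖spaceDeriv T Ω i (weighted ω h u) p‖ ^ 2 ≤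
      2 * ‖weighted ω h (spaceDeriv T Ω i u) p‖ ^ 2
        + (ω i * ω i) * (2 / h ^ 2 * ‖weighted ω h u p‖ ^ 2) := by
    intro i
    have h1 : spaceDeriv T Ω i (weighted ω h u) p =
        weighted ω h (spaceDeriv T Ω i u) p - (ω i / h) • weighted ω h u p := by
      have := dirDeriv_weighted (ω := ω) (h := h) hK hp hu (0, EuclideanSpace.single i 1)
      rw [phase_single] at this
      refine this.trans ?_
      simp only [weighted, spaceDeriv]
      module
    have h2 := (norm_sub_sq_bounds (weighted ω h (spaceDeriv T Ω i u) p)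
      ((ω i / h) • weighted ω h u p)).2
    rw [← h1, norm_smul, mul_pow, Real.norm_eq_abs, sq_abs] at h2
    refine h2.trans_eq ?_
    ring
  refine (Finset.sum_le_sum fun i _ => h1 i).trans_eq ?_
  rw [Finset.sum_add_distrib, ← Finset.mul_sum, ← Finset.sum_mul, sum_mul_eq_inner,
    real_inner_self_eq_norm_sq, hω]
  ring

end Weighted

/-! ### The bounded potential as a perturbation. -/

section Potential

variable {n : ℕ}

theorem norm_toLp_sum_mul_sq_le (A : Matrix (Fin n) (Fin n) ℂ) (w : V n) {M : ℝ}
    (hA : ∀ i j, ‖A i j‖ ≤ M) :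
    ‖(WithLp.toLp 2 (fun i => ∑ j : Fin n, A i j * w j) : V n)‖ ^ 2 ≤
      n * (n * M) ^ 2 * ‖w‖ ^ 2 := by
  rw [EuclideanSpace.norm_sq_eq]
  have h1 : ∀ i, ‖∑ j : Fin n, A i j * w j‖ ^ 2 ≤ (n * M) ^ 2 * ‖w‖ ^ 2 := by
    intro i
    have h2 : ‖∑ j : Fin n, A i j * w j‖ ≤ n * M * ‖w‖ := by
      refine (norm_sum_le _ _).trans ?_
      calc ∑ j, ‖A i j * w j‖ ≤ ∑ _j : Fin n, M * ‖w‖ := by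
            refine Finset.sum_le_sum fun j _ => ?_
            rw [norm_mul]
            exact mul_le_mul (hA i j) (PiLp.norm_apply_le w j) (norm_nonneg _)
              ((norm_nonneg _).trans (hA i j))
        _ = _ := by simp [mul_assoc]
    rw [← mul_pow]
    exact pow_le_pow_left₀ (norm_nonneg _) h2 2
  refine (Finset.sum_le_sum fun i _ => h1 i).trans_eq ?_
  simp [mul_assoc]

theorem exists_ae_norm_le {α : Type*} [MeasurableSpace α] {μ : Measure α}
    {q : α → Matrix (Fin n) (Fin n) ℂ} (hq : ∀ i j, MemLp (fun p => q p i j) ⊤ μ) :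
    ∃ M : ℝ, 0 ≤ M ∧ ∀ᵐ p ∂μ, ∀ i j, ‖q p i j‖ ≤ M := by
  set m : Fin n → Fin n → ℝ := fun i j => (eLpNormEssSup (fun p => q p i j) μ).toReal with hm
  have hm0 : ∀ i j, 0 ≤ m i j := fun i j => ENNReal.toReal_nonneg
  -- The sum of the essential suprema is a common bound for all entries.
  refine ⟨∑ i, ∑ j, m i j, Finset.sum_nonneg fun i _ => Finset.sum_nonneg fun j _ => hm0 i j, ?_⟩
  refine eventually_all.2 fun i => eventually_all.2 fun j => ?_
  have hfin : eLpNormEssSup (fun p => q p i j) μ ≠ ⊤ := by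
    have := (hq i j).eLpNorm_lt_top
    rw [eLpNorm_exponent_top] at this
    exact this.ne
  filter_upwards [ae_le_eLpNormEssSup (f := fun p => q p i j) (μ := μ)] with p hp
  have h1 : ‖q p i j‖ ≤ m i j := by
    have := ENNReal.toReal_mono hfin hp
    simpa using this
  calc ‖q p i j‖ ≤ m i j := h1
    _ ≤ ∑ j, m i j := Finset.single_le_sum (fun j _ => hm0 i j) (Finset.mem_univ j)
    _ ≤ _ := Finset.single_le_sum (f := fun i => ∑ j, m i j)
        (fun i _ => Finset.sum_nonneg fun j _ => hm0 i j) (Finset.mem_univ i)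

variable {Ω : Set (E n)} {T h : ℝ} {ω : E n}

/-- Integrability has to be checked because `q` is only measurable and bounded: the integral of a
nonintegrable function would be `0` by convention, which is useless as an upper bound. -/
theorem integrableOn_weighted_waveOp_sq (hΩ : IsOpen Ω) (hΩb : Bornology.IsBounded Ω)
    (hK : UniqueDiffOn ℝ (closedCyl T Ω)) {q : ℝ × E n → Matrix (Fin n) (Fin n) ℂ}
    (hq : ∀ i j, MemLp (fun p => q p i j) ⊤ (volume.restrict (cyl T Ω)))
    {M : ℝ} (hM : ∀ᵐ p ∂(volume.restrict (cyl T Ω)), ∀ i j, ‖q p i j‖ ≤ M)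
    {u : ℝ × E n → V n} (hu : ContDiffOn ℝ 2 u (closedCyl T Ω)) :
    IntegrableOn (fun p => ‖h • weighted ω h (waveOp T Ω q u) p‖ ^ 2) (cyl T Ω) := by
  have hd : ∀ w, ContDiffOn ℝ 1 (dirDeriv T Ω w u) (closedCyl T Ω) := contDiffOn_dirDeriv hK hu
  have hbc : ContinuousOn (box T Ω u) (closedCyl T Ω) :=
    (continuousOn_dirDeriv hK (hd _) _).sub
      (continuousOn_finsetSum _ fun i _ => continuousOn_dirDeriv hK (hd _) _)
  have hmeas : MeasurableSet (cyl T Ω) := (isOpen_cyl hΩ).measurableSet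
  have hucomp : ∀ j, AEMeasurable (fun p => u p j) (volume.restrict (cyl T Ω)) := fun j =>
    ((EuclideanSpace.proj j : V n →L[ℂ] ℂ).continuous.comp_continuousOn
      (hu.continuousOn.mono cyl_subset_closedCyl)).aemeasurable hmeas
  have hqu : AEMeasurable (fun p => (WithLp.toLp 2 (fun i => ∑ j : Fin n, q p i j * u p j) : V n))
      (volume.restrict (cyl T Ω)) := by
    refine (WithLp.measurable_toLp 2 (Fin n → ℂ)).comp_aemeasurable (aemeasurable_pi_iff.2 fun i => ?_)
    exact Finset.aemeasurable_fun_sum _ fun j _ =>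
      ((hq i j).aestronglyMeasurable.aemeasurable).mul (hucomp j)
  have hop : AEStronglyMeasurable (waveOp T Ω q u) (volume.restrict (cyl T Ω)) :=
    ((hbc.mono cyl_subset_closedCyl).aestronglyMeasurable hmeas).add hqu.aestronglyMeasurable
  have hw : AEStronglyMeasurable (fun p => ‖h • weighted ω h (waveOp T Ω q u) p‖ ^ 2)
      (volume.restrict (cyl T Ω)) :=
    (((contDiff_weight (k := 0)).continuous.aestronglyMeasurable.smul hop).const_smul h).norm.pow 2
  have hb : IntegrableOn (fun p => 2 * ‖h • weighted ω h (box T Ω u) p‖ ^ 2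
      + 2 * (h ^ 2 * (n * (n * M) ^ 2 * ‖weighted ω h u p‖ ^ 2))) (cyl T Ω) :=
    integrableOn_cyl hΩb ((continuousOn_const.mul
      (((continuousOn_weighted hbc).const_smul h).norm.pow 2)).add
      (continuousOn_const.mul (continuousOn_const.mul (continuousOn_const.mul
        ((continuousOn_weighted hu.continuousOn).norm.pow 2)))))
  refine hb.mono' hw ?_
  filter_upwards [hM] with p hp
  have hsplit : h • weighted ω h (waveOp T Ω q u) p = h • weighted ω h (box T Ω u) p -
      -(h • (Real.exp (-phase ω p / h) • WithLp.toLp 2 (fun i => ∑ j : Fin n, q p i j * u p j))) := by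
    simp only [weighted, waveOp, smul_add]
    rw [sub_neg_eq_add]
  have h1 := norm_toLp_sum_mul_sq_le (q p) (u p) hp
  have h2 := (norm_sub_sq_bounds (h • weighted ω h (box T Ω u) p)
    (-(h • (Real.exp (-phase ω p / h) •
      (WithLp.toLp 2 (fun i => ∑ j : Fin n, q p i j * u p j) : V n))))).2
  rw [← hsplit] at h2
  rw [Real.norm_eq_abs, abs_of_nonneg (by positivity)]
  refine h2.trans ?_
  gcongr
  rw [norm_neg, norm_smul, norm_smul, weighted, norm_smul, mul_pow, mul_pow, mul_pow,
    Real.norm_eq_abs h, sq_abs]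
  have h3 := mul_le_mul_of_nonneg_left h1
    (by positivity : 0 ≤ h ^ 2 * ‖Real.exp (-phase ω p / h)‖ ^ 2)
  linarith

/-- Write `□ u` as `L_q u - q u`; the factor `h` in front leaves the potential with a coefficient of
order `h²`, small enough to be absorbed. -/
theorem integral_weighted_box_sq_le (hΩ : IsOpen Ω) (hΩb : Bornology.IsBounded Ω)
    (hK : UniqueDiffOn ℝ (closedCyl T Ω)) {q : ℝ × E n → Matrix (Fin n) (Fin n) ℂ}
    (hq : ∀ i j, MemLp (fun p => q p i j) ⊤ (volume.restrict (cyl T Ω)))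
    {M : ℝ} (hM : ∀ᵐ p ∂(volume.restrict (cyl T Ω)), ∀ i j, ‖q p i j‖ ≤ M)
    {u : ℝ × E n → V n} (hu : ContDiffOn ℝ 2 u (closedCyl T Ω)) :
    ∫ p in cyl T Ω, ‖h • weighted ω h (box T Ω u) p‖ ^ 2 ≤
      2 * (∫ p in cyl T Ω, ‖h • weighted ω h (waveOp T Ω q u) p‖ ^ 2)
      + 2 * h ^ 2 * (n * (n * M) ^ 2) * ∫ p in cyl T Ω, ‖weighted ω h u p‖ ^ 2 := by
  have hi1 := integrableOn_weighted_waveOp_sq (h := h) (ω := ω) hΩ hΩb hK hq hM hu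
  have hi2 : IntegrableOn (fun p => ‖weighted ω h u p‖ ^ 2) (cyl T Ω) :=
    integrableOn_cyl hΩb ((continuousOn_weighted hu.continuousOn).norm.pow 2)
  rw [← integral_const_mul, ← integral_const_mul, ← integral_add (hi1.const_mul _)
    (hi2.const_mul _)]
  refine integral_mono_of_nonneg (Eventually.of_forall fun p => by positivity)
    ((hi1.const_mul _).add (hi2.const_mul _)) ?_
  filter_upwards [hM] with p hp
  have hsplit : h • weighted ω h (box T Ω u) p = h • weighted ω h (waveOp T Ω q u) p -
      h • (Real.exp (-phase ω p / h) •
        (WithLp.toLp 2 (fun i => ∑ j : Fin n, q p i j * u p j) : V n)) := by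
    simp only [weighted, waveOp, smul_add]
    abel
  have h1 := norm_toLp_sum_mul_sq_le (q p) (u p) hp
  have h2 := (norm_sub_sq_bounds (h • weighted ω h (waveOp T Ω q u) p)
    (h • (Real.exp (-phase ω p / h) •
      (WithLp.toLp 2 (fun i => ∑ j : Fin n, q p i j * u p j) : V n)))).2
  rw [← hsplit] at h2
  refine h2.trans ?_
  refine add_le_add le_rfl ?_
  rw [norm_smul, norm_smul, weighted, norm_smul, mul_pow, mul_pow, mul_pow,
    Real.norm_eq_abs h, sq_abs]
  have h3 := mul_le_mul_of_nonneg_left h1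
    (by positivity : 0 ≤ h ^ 2 * ‖Real.exp (-phase ω p / h)‖ ^ 2)
  linarith

end Potential

/-! ### Passing from the Gauss-Green measure to the surface measure. -/

section Flux

variable {n : ℕ} {Ω : Set (E n)} {T h : ℝ} {ω : E n}

theorem measurableSet_frontier_inner_nonneg (hΩ : IsOpen Ω) (hΩ2 : HasC2Boundary Ω) (ω : E n) :
    MeasurableSet {x | x ∈ frontier Ω ∧ 0 ≤ inner ℝ (outwardNormal Ω x) ω} := by
  have hc : ContinuousOn (fun x => inner ℝ (outwardNormal Ω x) ω) (frontier Ω) :=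
    (continuousOn_outwardNormal hΩ hΩ2).inner continuousOn_const
  exact (hc.preimage_isClosed_of_isClosed isClosed_frontier isClosed_Ici).measurableSet

theorem measurableSet_lateralPos (hΩ : IsOpen Ω) (hΩ2 : HasC2Boundary Ω) (ω : E n) :
    MeasurableSet (lateralPos T Ω ω) :=
  measurableSet_Ioo.prod (measurableSet_frontier_inner_nonneg hΩ hΩ2 ω)

theorem measurableSet_lateralNeg (hΩ : IsOpen Ω) (hΩ2 : HasC2Boundary Ω) (ω : E n) :
    MeasurableSet (lateralNeg T Ω ω) := by
  have h := measurableSet_frontier_inner_nonneg hΩ hΩ2 (-ω)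
  simp only [inner_neg_right, Left.nonneg_neg_iff] at h
  exact measurableSet_Ioo.prod h

theorem integral_le_mul_integral_of_le_smul {α : Type*} [MeasurableSpace α] {κ κ' : Measure α}
    {C : NNReal} (hle : κ' ≤ C • κ) {f : α → ℝ} (hf0 : ∀ x, 0 ≤ f x) (hf : Integrable f κ) :
    ∫ x, f x ∂κ' ≤ C * ∫ x, f x ∂κ := by
  refine (integral_mono_measure hle (Eventually.of_forall hf0)
    hf.smul_measure_nnreal).trans_eq ?_
  rw [integral_smul_nnreal_measure]
  rfl

/-- Positive and negative parts of the flux through the lateral boundary, for two comparable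
measures. -/
theorem flux_comparison (hΩ : IsOpen Ω) (hΩb : Bornology.IsBounded Ω)
    (hΩ2 : HasC2Boundary Ω) (hT : 0 < T) {μ : Measure (E n)} [IsFiniteMeasure μ]
    [IsFiniteMeasure (surfaceMeasure Ω)] {C : NNReal} (hμσ : μ ≤ C • surfaceMeasure Ω)
    (hσμ : surfaceMeasure Ω ≤ C • μ) (hμ : ∀ᵐ x ∂μ, x ∈ frontier Ω)
    {u : ℝ × E n → V n} (hu : ContDiffOn ℝ 1 u (closedCyl T Ω)) :
    ∃ P' M' : ℝ,
      ∫ p, inner ℝ (outwardNormal Ω p.2) ω * ‖weighted ω h (normalDeriv T Ω u) p‖ ^ 2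
        ∂((volume.restrict (Ioo 0 T)).prod μ) = P' - M' ∧ 0 ≤ P' ∧
      (∫ p in lateralPos T Ω ω, normalDeriv T Ω (phase ω) p *
        ‖weighted ω h (normalDeriv T Ω u) p‖ ^ 2 ∂(lateralMeasure T Ω)) ≤ C * P' ∧
      M' ≤ C * (∫ p in lateralNeg T Ω ω, (-normalDeriv T Ω (phase ω) p) *
        ‖weighted ω h (normalDeriv T Ω u) p‖ ^ 2 ∂(lateralMeasure T Ω)) ∧
      0 ≤ ∫ p in lateralNeg T Ω ω, (-normalDeriv T Ω (phase ω) p) *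
        ‖weighted ω h (normalDeriv T Ω u) p‖ ^ 2 ∂(lateralMeasure T Ω) := by
  have hK := uniqueDiffOn_closedCyl hΩ hΩ2 hT
  set κ := lateralMeasure T Ω with hκ
  set κ' := ((volume : Measure ℝ).restrict (Ioo 0 T)).prod μ with hκ'
  have hle1 : κ' ≤ C • κ := by
    rw [hκ, lateralMeasure, ← Measure.prod_smul_right]
    exact Measure.prod_mono le_rfl hμσ
  have hle2 : κ ≤ C • κ' := by
    rw [hκ', ← Measure.prod_smul_right]
    exact Measure.prod_mono le_rfl hσμ
  set f : ℝ × E n → ℝ := fun p =>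
    inner ℝ (outwardNormal Ω p.2) ω * ‖weighted ω h (normalDeriv T Ω u) p‖ ^ 2 with hf
  have hlat : ∀ᵐ p ∂κ', p ∈ lateral T Ω := ae_mem_lateral hμ
  have hσ : ∀ᵐ x ∂(surfaceMeasure Ω), x ∈ frontier Ω := by
    rw [← surfaceMeasure_eq_restrict]
    exact ae_restrict_mem isClosed_frontier.measurableSet
  have hlat2 : ∀ᵐ p ∂κ, p ∈ lateral T Ω := ae_mem_lateral hσ
  have hfc : ContinuousOn f (Icc 0 T ×ˢ frontier Ω) := by
    have hν : ContinuousOn (fun p : ℝ × E n => outwardNormal Ω p.2) (Icc 0 T ×ˢ frontier Ω) :=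
      (continuousOn_outwardNormal hΩ hΩ2).comp continuousOn_snd fun p hp => hp.2
    have hN : ContinuousOn (normalDeriv T Ω u) (Icc 0 T ×ˢ frontier Ω) :=
      ((hu.continuousOn_fderivWithin hK le_rfl).mono
        (prod_mono_right frontier_subset_closure)).clm_apply (continuousOn_const.prodMk hν)
    exact (hν.inner continuousOn_const).mul ((continuousOn_weighted hN).norm.pow 2)
  have hSc : IsCompact (Icc 0 T ×ˢ frontier Ω) :=
    isCompact_Icc.prod (hΩb.isCompact_closure.of_isClosed_subset isClosed_frontier
      frontier_subset_closure)
  have hsub : lateral T Ω ⊆ Icc 0 T ×ˢ frontier Ω := prod_mono_left Ioo_subset_Icc_self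
  have hfκ' : Integrable f κ' := by
    rw [← Measure.restrict_eq_self_of_ae_mem (hlat.mono fun p hp => hsub hp)]
    exact hfc.integrableOn_compact hSc
  have hκfin : IsFiniteMeasure κ := by
    rw [hκ, lateralMeasure]
    infer_instance
  have hfκ : Integrable f κ := by
    rw [← Measure.restrict_eq_self_of_ae_mem (hlat2.mono fun p hp => hsub hp)]
    exact hfc.integrableOn_compact hSc
  have hmP := measurableSet_lateralPos (T := T) hΩ hΩ2 ω
  have hmN := measurableSet_lateralNeg (T := T) hΩ hΩ2 ω
  have hnd : ∀ p ∈ lateral T Ω, normalDeriv T Ω (phase ω) p = inner ℝ (outwardNormal Ω p.2) ω := by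
    intro p hp
    rw [normalDeriv, dirDeriv_phase hK (lateral_subset_closedCyl hp), phase_space]
  -- Comparability of measures is only useful for nonnegative integrands, so the signed flux is
  -- split before `κ'` is exchanged for `κ`.
  set fp := (lateralPos T Ω ω).indicator f with hfp
  set fm := (lateralNeg T Ω ω).indicator fun p => -f p with hfm
  have hfp0 : ∀ p, 0 ≤ fp p := fun p =>
    indicator_nonneg (fun p hp => mul_nonneg hp.2.2 (by positivity)) p
  have hfm0 : ∀ p, 0 ≤ fm p := fun p =>
    indicator_nonneg (fun p hp => by
      have : f p ≤ 0 := mul_nonpos_of_nonpos_of_nonneg hp.2.2 (by positivity)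
      linarith) p
  have hfpm : ∀ p ∈ lateral T Ω, f p = fp p - fm p := by
    intro p hp
    have hPm : p ∈ lateralPos T Ω ω ↔ 0 ≤ inner ℝ (outwardNormal Ω p.2) ω :=
      ⟨fun h => h.2.2, fun h => ⟨hp.1, hp.2, h⟩⟩
    have hNm : p ∈ lateralNeg T Ω ω ↔ inner ℝ (outwardNormal Ω p.2) ω ≤ 0 :=
      ⟨fun h => h.2.2, fun h => ⟨hp.1, hp.2, h⟩⟩
    rcases lt_trichotomy (inner ℝ (outwardNormal Ω p.2) ω) 0 with hlt | heq | hgt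
    · rw [hfp, hfm, indicator_of_notMem (fun h => hlt.not_ge (hPm.1 h)),
        indicator_of_mem (hNm.2 hlt.le)]
      ring
    -- The two lateral parts overlap where `ν·ω = 0`; the flux vanishes there, so nothing is counted
    -- twice.
    · have h0 : f p = 0 := by simp only [hf, heq, zero_mul]
      rw [hfp, hfm, indicator_of_mem (hPm.2 heq.ge), indicator_of_mem (hNm.2 heq.le), h0]
      ring
    · rw [hfp, hfm, indicator_of_mem (hPm.2 hgt.le),
        indicator_of_notMem (fun h => hgt.not_ge (hNm.1 h))]
      ring
  have hPint : ∫ p in lateralPos T Ω ω, normalDeriv T Ω (phase ω) p *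
      ‖weighted ω h (normalDeriv T Ω u) p‖ ^ 2 ∂κ = ∫ p, fp p ∂κ := by
    rw [hfp, integral_indicator hmP]
    exact setIntegral_congr_fun hmP fun p hp => by
      rw [hnd p ⟨hp.1, hp.2.1⟩]
  have hMint : ∫ p in lateralNeg T Ω ω, (-normalDeriv T Ω (phase ω) p) *
      ‖weighted ω h (normalDeriv T Ω u) p‖ ^ 2 ∂κ = ∫ p, fm p ∂κ := by
    rw [hfm, integral_indicator hmN]
    exact setIntegral_congr_fun hmN fun p hp => by
      rw [hnd p ⟨hp.1, hp.2.1⟩, hf]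
      ring
  rw [hPint, hMint]
  refine ⟨∫ p, fp p ∂κ', ∫ p, fm p ∂κ', ?_, integral_nonneg hfp0,
    integral_le_mul_integral_of_le_smul hle2 hfp0 (hfκ'.indicator hmP),
    integral_le_mul_integral_of_le_smul hle1 hfm0 (hfκ.neg.indicator hmN), integral_nonneg hfm0⟩
  have hip : Integrable fp κ' := hfκ'.indicator hmP
  have him : Integrable fm κ' := hfκ'.neg.indicator hmN
  rw [← integral_sub hip him]
  exact integral_congr_ae (hlat.mono hfpm)

end Flux

/-- Absorption of the zeroth order terms in the Carleman inequality for small `h`. -/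
theorem absorb_carleman_terms {T h N k A B L S D P R Vt Vs W P' M' : ℝ} (hT : 0 < T) (hh : 0 < h)
    (hh1 : h ≤ 1) (hN : 0 ≤ N) (hh2 : h * (4 * T ^ 2 * (N + 1)) ≤ 1) (hk : 0 ≤ k)
    (hA : 0 ≤ A) (hB0 : 0 ≤ B) (hL : 0 ≤ L) (hS : 0 ≤ S) (hD : 0 ≤ D) (hR : 0 ≤ R)
    (hP' : 0 ≤ P')
    (hmain : 1 / T ^ 2 * A + h * Vt + 2 * h * (P' - M') ≤ W + 2 * h * Vs)
    (hW : W ≤ 2 * L + 2 * h ^ 2 * N * A) (hB : B ≤ 2 * Vt + 2 / h ^ 2 * S)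
    (hVs : Vs ≤ 2 * D + 2 / h ^ 2 * S) (hP : P ≤ k * P') (hM' : M' ≤ k * R) :
    A + h * P + h * B ≤
      (2 * T ^ 2 + 2 + k) * (5 + 2 * k) * (L + 1 / h * S + h * D + h * R) := by
  -- Half of the term `A / T²`: one half absorbs the potential, the other survives.
  set a : ℝ := 1 / (2 * T ^ 2) * A with ha
  have ha0 : 0 ≤ a := by positivity
  have hAa : A = 2 * T ^ 2 * a := by rw [ha]; field_simp
  have hTa : 1 / T ^ 2 * A = 2 * a := by rw [ha]; field_simp
  -- This amounts to `4 T² N h² ≤ 1`, which follows from `hh2` and `h ≤ 1`.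
  have hNA : 2 * h ^ 2 * N * A ≤ a := by
    have h1 : h * (h * (4 * T ^ 2 * N)) ≤ 1 := by
      have h2 : h * (4 * T ^ 2 * N) ≤ 1 := by
        have : 0 ≤ h * (4 * T ^ 2) := by positivity
        linarith
      have h3 : 0 ≤ h * (4 * T ^ 2 * N) := by positivity
      exact mul_le_one₀ hh1 h3 h2
    calc 2 * h ^ 2 * N * A = h * (h * (4 * T ^ 2 * N)) * a := by rw [hAa]; ring
      _ ≤ 1 * a := mul_le_mul_of_nonneg_right h1 ha0
      _ = a := one_mul a
  set s : ℝ := 1 / h * S with hs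
  have hs0 : 0 ≤ s := by positivity
  have hhs : h * (2 / h ^ 2 * S) = 2 * s := by rw [hs]; field_simp
  have hBh : h * B ≤ 2 * (h * Vt) + 2 * s := by
    have := mul_le_mul_of_nonneg_left hB hh.le
    linarith
  have hVh : h * Vs ≤ 2 * (h * D) + 2 * s := by
    have := mul_le_mul_of_nonneg_left hVs hh.le
    linarith
  have hMh : h * M' ≤ k * (h * R) := by
    have := mul_le_mul_of_nonneg_left hM' hh.le
    linarith
  have hPh : h * P ≤ k * (h * P') := by
    have := mul_le_mul_of_nonneg_left hP hh.le
    linarith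
  have hD0 : 0 ≤ h * D := by positivity
  have hR0 : 0 ≤ h * R := by positivity
  have hP0 : 0 ≤ h * P' := by positivity
  have hb0 : 0 ≤ h * B := by positivity
  -- The coefficient `5` of `s` is `1` from returning to `∂_t u` and `4` from the gradient at time
  -- `T`; `2k` comes from the negative flux.
  have hcore : a + h * B / 2 + 2 * (h * P') ≤ (5 + 2 * k) * (L + s + h * D + h * R) := by
    have e1 : 0 ≤ k * (L + s + h * D) := by positivity
    have e2 : a + h * B / 2 + 2 * (h * P') ≤ 2 * L + 5 * s + 4 * (h * D) + 2 * (k * (h * R)) := by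
      linarith
    linarith
  -- The factor dominates each conversion: `2T²` from `a` to `A`, `2` from `h B / 2` to `h B`, and
  -- `k` from `P'` to `P`.
  have hleft : A + h * P + h * B ≤
      (2 * T ^ 2 + 2 + k) * (a + h * B / 2 + 2 * (h * P')) := by
    have e1 : 0 ≤ 2 * T ^ 2 * (h * B / 2 + 2 * (h * P')) := by positivity
    have e2 : 0 ≤ k * (a + h * B / 2 + h * P') := by positivity
    linarith
  calc A + h * P + h * B ≤ (2 * T ^ 2 + 2 + k) * (a + h * B / 2 + 2 * (h * P')) := hleft
    _ ≤ (2 * T ^ 2 + 2 + k) * ((5 + 2 * k) * (L + s + h * D + h * R)) :=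
      mul_le_mul_of_nonneg_left hcore (by positivity)
    _ = _ := by ring

end CarlemanWave

/-! ### The Carleman estimate. -/

open CarlemanWave

theorem theorem4p1 (n : ℕ) (hn : 2 ≤ n) (Ω : Set (EuclideanSpace ℝ (Fin n)))
    (hΩ : IsOpen Ω) (hΩb : Bornology.IsBounded Ω) (hΩ2 : CarlemanWave.HasC2Boundary Ω)
    (T : ℝ) (hT : 0 < T)
    (q : ℝ × EuclideanSpace ℝ (Fin n) → Matrix (Fin n) (Fin n) ℂ)
    (hq : ∀ i j : Fin n, MemLp (fun p => q p i j) ⊤ (volume.restrict (CarlemanWave.cyl T Ω))) :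
    ∃ C : ℝ, 0 < C ∧ ∃ h₀ : ℝ, 0 < h₀ ∧ ∀ ω : EuclideanSpace ℝ (Fin n), ‖ω‖ = 1 →
      ∀ h : ℝ, 0 < h → h ≤ h₀ →
      ∀ u : ℝ × EuclideanSpace ℝ (Fin n) → EuclideanSpace ℂ (Fin n),
        CarlemanWave.IsAdmissible T Ω u →
        (∫ p in CarlemanWave.cyl T Ω, ‖CarlemanWave.weighted ω h u p‖ ^ 2)
          + h * (∫ p in CarlemanWave.lateralPos T Ω ω,
              CarlemanWave.normalDeriv T Ω (CarlemanWave.phase ω) p *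
                ‖CarlemanWave.weighted ω h (CarlemanWave.normalDeriv T Ω u) p‖ ^ 2
              ∂(CarlemanWave.lateralMeasure T Ω))
          + h * (∫ x in Ω,
              ‖CarlemanWave.weighted ω h (CarlemanWave.timeDeriv T Ω u) (T, x)‖ ^ 2)
        ≤ C * ((∫ p in CarlemanWave.cyl T Ω,
                ‖h • CarlemanWave.weighted ω h (CarlemanWave.waveOp T Ω q u) p‖ ^ 2)
          + 1 / h * (∫ x in Ω, ‖CarlemanWave.weighted ω h u (T, x)‖ ^ 2)
          + h * (∫ x in Ω, ∑ i : Fin n,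
              ‖CarlemanWave.weighted ω h (CarlemanWave.spaceDeriv T Ω i u) (T, x)‖ ^ 2)
          + h * (∫ p in CarlemanWave.lateralNeg T Ω ω,
              (-CarlemanWave.normalDeriv T Ω (CarlemanWave.phase ω) p) *
                ‖CarlemanWave.weighted ω h (CarlemanWave.normalDeriv T Ω u) p‖ ^ 2
              ∂(CarlemanWave.lateralMeasure T Ω))) := by
  have hK := uniqueDiffOn_closedCyl hΩ hΩ2 hT
  obtain ⟨μ, K, hμfin, hσfin, hμσ, hσμ, hGG⟩ := exists_divergence_measure hΩ hΩb hΩ2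
  obtain ⟨M, hM0, hM⟩ := exists_ae_norm_le hq
  have hμ : ∀ᵐ x ∂μ, x ∈ frontier Ω := by
    have hσ : ∀ᵐ x ∂(surfaceMeasure Ω), x ∈ frontier Ω := by
      rw [← surfaceMeasure_eq_restrict]
      exact ae_restrict_mem isClosed_frontier.measurableSet
    exact ((Measure.absolutelyContinuous_of_le hμσ).trans
      Measure.smul_absolutelyContinuous).ae_le hσ
  set k : ℝ := (K : ℝ)
  have hk0 : 0 ≤ k := K.coe_nonneg
  set N : ℝ := n * (n * M) ^ 2 with hN
  have hN0 : 0 ≤ N := by positivity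
  -- The constant involves only `T` and the comparison constant of `Ω`; the potential enters through
  -- `h₀` alone. The `N + 1` keeps the denominator positive when `N = 0`.
  refine ⟨(2 * T ^ 2 + 2 + k) * (5 + 2 * k), by positivity,
    min 1 (1 / (4 * T ^ 2 * (N + 1))), by positivity, fun ω hω h hh hh0 u hu => ?_⟩
  have hh1 : h ≤ 1 := hh0.trans (min_le_left _ _)
  have hh2 : h * (4 * T ^ 2 * (N + 1)) ≤ 1 := by
    have := hh0.trans (min_le_right _ _)
    rwa [le_div_iff₀ (by positivity)] at this
  have hu2 := hu.contDiffOn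
  have hu1 := hu2.of_le (by norm_num : (1 : WithTop ℕ∞) ≤ 2)
  have hd : ∀ w, ContDiffOn ℝ 1 (dirDeriv T Ω w u) (closedCyl T Ω) := contDiffOn_dirDeriv hK hu2
  have hv2 : ContDiffOn ℝ 2 (weighted ω h u) (closedCyl T Ω) := contDiffOn_weighted hu2
  have hdv : ∀ w, ContDiffOn ℝ 1 (dirDeriv T Ω w (weighted ω h u)) (closedCyl T Ω) :=
    contDiffOn_dirDeriv hK hv2
  have hmemT : ∀ x ∈ Ω, ((T, x) : ℝ × E n) ∈ closedCyl T Ω := fun x hx =>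
    ⟨⟨hT.le, le_rfl⟩, subset_closure hx⟩
  have hvlat : ∀ p ∈ lateral T Ω, weighted ω h u p = 0 := fun p hp => by
    rw [weighted, hu.eq_zero_lateral p hp, smul_zero]
  have hv0 : ∀ x ∈ Ω, weighted ω h u (0, x) = 0 := fun x hx => by
    rw [weighted, hu.eq_zero_initial x hx, smul_zero]
  have hvt0 : ∀ x ∈ Ω, timeDeriv T Ω (weighted ω h u) (0, x) = 0 := fun x hx => by
    have hp : ((0, x) : ℝ × E n) ∈ closedCyl T Ω := ⟨⟨le_rfl, hT.le⟩, subset_closure hx⟩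
    rw [timeDeriv, dirDeriv_weighted hK hp hu1, weighted, hu.eq_zero_initial x hx, smul_zero,
      sub_zero]
    have := hu.timeDeriv_eq_zero_initial x hx
    rw [timeDeriv] at this
    rw [this, smul_zero]
  have hmain := carleman_conjugated hΩ hΩb hΩ2 hT hμ hGG hv2 hvlat hv0 hvt0 hω hh
  -- The conjugated estimate for `v` is rewritten in terms of `u`: the operator by `conjugated_box`,
  -- the flux because `u = 0` on the lateral boundary.
  rw [setIntegral_congr_fun (isOpen_cyl hΩ).measurableSet fun p hp =>
      congrArg (fun z => ‖z‖ ^ 2) (conjugated_box hK (cyl_subset_closedCyl hp) hu2 hω hh),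
    integral_congr_ae ((ae_mem_lateral hμ).mono fun p hp =>
      show _ = inner ℝ (outwardNormal Ω p.2) ω * ‖weighted ω h (normalDeriv T Ω u) p‖ ^ 2 by
        rw [normalDeriv_weighted_of_lateral hK hu1 (hu.eq_zero_lateral p hp) hp])] at hmain
  obtain ⟨P', M', hflux, hP'0, hPP', hM'M, hMm0⟩ :=
    flux_comparison (h := h) (ω := ω) hΩ hΩb hΩ2 hT hμσ hσμ hμ hu1
  rw [hflux] at hmain
  have hbox := integral_weighted_box_sq_le (h := h) (ω := ω) hΩ hΩb hK hq hM hu2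
  rw [← hN] at hbox
  have hiU : IntegrableOn (fun x => ‖weighted ω h u (T, x)‖ ^ 2) Ω :=
    integrableOn_slice (f := fun p => ‖weighted ω h u p‖ ^ 2) hΩb hT (hv2.continuousOn.norm.pow 2)
  have hiVt : IntegrableOn (fun x => ‖timeDeriv T Ω (weighted ω h u) (T, x)‖ ^ 2) Ω :=
    integrableOn_slice (f := fun p => ‖timeDeriv T Ω (weighted ω h u) p‖ ^ 2) hΩb hT
      ((hdv _).continuousOn.norm.pow 2)
  have hiB : IntegrableOn (fun x => ‖weighted ω h (timeDeriv T Ω u) (T, x)‖ ^ 2) Ω :=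
    integrableOn_slice (f := fun p => ‖weighted ω h (timeDeriv T Ω u) p‖ ^ 2) hΩb hT
      ((continuousOn_weighted (hd _).continuousOn).norm.pow 2)
  have hiVs : IntegrableOn (fun x => ∑ i, ‖spaceDeriv T Ω i (weighted ω h u) (T, x)‖ ^ 2) Ω :=
    integrableOn_slice (f := fun p => ∑ i, ‖spaceDeriv T Ω i (weighted ω h u) p‖ ^ 2) hΩb hT
      (continuousOn_finsetSum _ fun i _ => (hdv _).continuousOn.norm.pow 2)
  have hiG : IntegrableOn (fun x => ∑ i, ‖weighted ω h (spaceDeriv T Ω i u) (T, x)‖ ^ 2) Ω :=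
    integrableOn_slice (f := fun p => ∑ i, ‖weighted ω h (spaceDeriv T Ω i u) p‖ ^ 2) hΩb hT
      (continuousOn_finsetSum _ fun i _ =>
        (continuousOn_weighted (hd _).continuousOn).norm.pow 2)
  have hB := setIntegral_mono_on hiB ((hiVt.const_mul 2).add (hiU.const_mul (2 / h ^ 2)))
    hΩ.measurableSet fun x hx => norm_timeDeriv_weighted_sq hK (hmemT x hx) hu1
  have hG := setIntegral_mono_on hiVs ((hiG.const_mul 2).add (hiU.const_mul (2 / h ^ 2)))
    hΩ.measurableSet fun x hx => sum_norm_spaceDeriv_weighted_sq hK (hmemT x hx) hu1 hω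
  rw [integral_add' (hiVt.const_mul 2) (hiU.const_mul _), integral_const_mul,
    integral_const_mul] at hB
  rw [integral_add' (hiG.const_mul 2) (hiU.const_mul _), integral_const_mul,
    integral_const_mul] at hG
  have hA0 : 0 ≤ ∫ p in cyl T Ω, ‖weighted ω h u p‖ ^ 2 :=
    integral_nonneg fun p => by positivity
  have hB0 : 0 ≤ ∫ x in Ω, ‖weighted ω h (timeDeriv T Ω u) (T, x)‖ ^ 2 :=
    integral_nonneg fun p => by positivity
  have hL0 : 0 ≤ ∫ p in cyl T Ω, ‖h • weighted ω h (waveOp T Ω q u) p‖ ^ 2 :=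
    integral_nonneg fun p => by positivity
  have hU0 : 0 ≤ ∫ x in Ω, ‖weighted ω h u (T, x)‖ ^ 2 := integral_nonneg fun p => by positivity
  have hG0 : 0 ≤ ∫ x in Ω, ∑ i, ‖weighted ω h (spaceDeriv T Ω i u) (T, x)‖ ^ 2 :=
    integral_nonneg fun p => Finset.sum_nonneg fun i _ => sq_nonneg _
  exact absorb_carleman_terms hT hh hh1 hN0 hh2 hk0 hA0 hB0 hL0 hU0 hG0 hMm0 hP'0 hmain hbox hB hG
    hPP' hM'M
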